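/- Let $n,r\ge 1$, let $\mathcal A=\mathbb Z[t,t^{-1}]$ and $q=t^2$. Let $W$ be the extended affine Weyl group of type $\tilde A_{r-1}$, i.e. the group of permutations $\sigma$ of $\mathbb Z$ with $\sigma(i+r)=\sigma(i)+r$ for all $i$, with simple reflections $S=\{s_0,\dots,s_{r-1}\}$ ($s_i$ interchanges $i+kr$ and $i+1+kr$ for all $k\in\mathbb Z$; $S=\emptyset$ if $r=1$), length function $l$ and Bruhat order $\le$, extended to $W=\langle\rho\rangle\ltimes\langle S\rangle$ from $\langle S\rangle$ with $\rho:i\mapsto i+1$ of length $0$. Let $\mathcal H$ be the Hecke algebra of $W$ over $\mathcal A$, with basis $\{T_w\}_{w\in W}$ and relations $T_wT_{w'}=T_{ww'}$ if $l(ww')=l(w)+l(w')$, and $(T_s+1)(T_s-q)=0$ for $s\in S$. Let $\bar{\ }$ be the ring involution of $\mathcal H$ with $\bar t=t^{-1}$, $\overline{T_w}=T_{w^{-1}}^{-1}$; let $j$ be the ring involution with $j(t)=t^{-1}$, $j(T_w)=(-q)^{-l(w)}T_w$; and let $\Psi$ be the ring involution with $\Psi(t)=-t$, $\Psi(T_w)=(-q)^{l(w)}T_{w^{-1}}^{-1}$.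 For $w\in W$ let $C'_w\in\mathcal H$ be the unique element with $\overline{C'_w}=C'_w$ and $$C'_w=\sum_{y\le w}(-1)^{l(w)-l(y)}\,t^{\,l(w)-2l(y)}P_{y,w}(q^{-1})\,T_y,$$ where $P_{y,w}$ are polynomials with integer coefficients, $P_{w,w}=1$ and $\deg P_{y,w}\le\frac12(l(w)-l(y)-1)$ for $y<w$. Put $C_w=(-1)^{l(w)}j(C'_w)$. Let $\Lambda$ be the set of $\lambda=(\lambda_1,\dots,\lambda_n)\in\mathbb N^n$ with $\sum_i\lambda_i=r$. For $\lambda\in\Lambda$ let $W_\lambda\subseteq\langle s_1,\dots,s_{r-1}\rangle$ be the standard Young subgroup, $w_{0,\lambda}$ its longest element, $x_\lambda=\sum_{w\in W_\lambda}T_w$ and $y_\lambda=j(x_\lambda)$. For $\lambda,\mu\in\Lambda$ let $\mathcal D_{\lambda\mu}$ be the set of the $w\in W$ of minimal length in $W_\lambda wW_\mu$; for such $w$ let $w^+$ be the element of maximal length in $W_\lambda wW_\mu$. Let $\mathcal B$ be the set of triples $B=(\lambda,w_B,\mu)$ with $\lambda,\mu\in\Lambda$, $w_B\in\mathcal D_{\lambda\mu}$.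 For a double coset $D=W_\lambda zW_\mu$ put $T_D=\sum_{x\in D}T_x$ and $\widetilde T_D=\sum_{x\in D}(-q)^{-l(x)}T_x$. Let $$\mathcal S=\mathrm{End}_{\mathcal H}\Big(\bigoplus_{\lambda\in\Lambda}x_\lambda\mathcal H\Big),\qquad \widetilde{\mathcal S}=\mathrm{End}_{\mathcal H}\Big(\bigoplus_{\lambda\in\Lambda}y_\lambda\mathcal H\Big)$$ be the endomorphism algebras of right $\mathcal H$-modules. For $w\in\mathcal D_{\lambda\mu}$ define $\phi^w_{\lambda\mu}\in\mathcal S$ and $\psi^w_{\lambda\mu}\in\widetilde{\mathcal S}$, with values in the summands $x_\lambda\mathcal H$ and $y_\lambda\mathcal H$, by $$\phi^w_{\lambda\mu}(x_\nu h)=\delta_{\mu\nu}T_{W_\lambda wW_\mu}h,\qquad \psi^w_{\lambda\mu}(y_\nu h)=\delta_{\mu\nu}\widetilde T_{W_\lambda wW_\mu}h\qquad(\nu\in\Lambda,\ h\in\mathcal H).$$ For $B=(\lambda,w_B,\mu)\in\mathcal B$ write $$C_{w_B^+}=\sum_{z\in\mathcal D_{\lambda\mu}}\alpha_{z,w_B}T_{W_\lambda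 zW_\mu},\qquad C'_{w_B^+}=\sum_{z\in\mathcal D_{\lambda\mu}}\widetilde\alpha_{z,w_B}\widetilde T_{W_\lambda zW_\mu}$$ (finite sums with coefficients in $\mathcal A$) and put $$\theta_B=t^{\,l(w_{0,\mu})}\sum_{z\in\mathcal D_{\lambda\mu}}\alpha_{z,w_B}\,\phi^z_{\lambda\mu},\qquad \widetilde\theta_B=(-t)^{-l(w_{0,\mu})}\sum_{z\in\mathcal D_{\lambda\mu}}\widetilde\alpha_{z,w_B}\,\psi^z_{\lambda\mu}.$$ **Theorem.** (1) The elements $\{\widetilde\theta_B\}_{B\in\mathcal B}$ form an $\mathcal A$-basis of $\widetilde{\mathcal S}$. (2) For each $B=(\lambda,w_B,\mu)\in\mathcal B$, regarding $\widetilde\theta_B$ as a map from $y_\mu\mathcal H$ to $y_\lambda\mathcal H$, we have $C'_{w_{0,\mu}}\in y_\mu\mathcal H$, $C'_{w_B^+}\in y_\lambda\mathcal H$ and $\widetilde\theta_B(C'_{w_{0,\mu}})=C'_{w_B^+}$. (3) Applying $\Psi$ in each component gives a bijection $E:\bigoplus_\lambda x_\lambda\mathcal H\to\bigoplus_\lambda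 y_\lambda\mathcal H$ and thus a ring isomorphism $\Psi:\mathcal S\to\widetilde{\mathcal S}$, $f\mapsto E\circ f\circ E^{-1}$; it satisfies $\Psi(\theta_B)=\widetilde\theta_B$ for all $B\in\mathcal B$. -/

import Mathlib

noncomputable section

namespace AffineSchur

/-! ### The ground ring -/

/-- The ring `ℤ[t, t⁻¹]` of Laurent polynomials. -/
abbrev Laurent : Type := LaurentPolynomial ℤ

/-- The power `t ^ k` for an integer `k`. -/
abbrev tpow (k : ℤ) : Laurent := LaurentPolynomial.T k

/-- `q = t ^ 2`. -/
abbrev q : Laurent := tpow 2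

/-- The element `(-t) ^ k` for an integer `k`. -/
abbrev negtpow (k : ℤ) : Laurent := ((k.negOnePow : ℤˣ) : ℤ) • tpow k

/-- The element `(-q) ^ k` for an integer `k`. -/
abbrev negqpow (k : ℤ) : Laurent := ((k.negOnePow : ℤˣ) : ℤ) • tpow (2 * k)

/-- The involution `t ↦ t⁻¹` of `ℤ[t, t⁻¹]`. -/
def barA : Laurent →+* Laurent := (LaurentPolynomial.invert : Laurent ≃ₐ[ℤ] Laurent)

/-- The involution `t ↦ -t` of `ℤ[t, t⁻¹]`. -/
def signA : Laurent →+* Laurent :=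
  LaurentPolynomial.eval₂ LaurentPolynomial.C (-(LaurentPolynomial.isUnit_T (R := ℤ) 1).unit)

theorem barA_tpow (k : ℤ) : barA (tpow k) = tpow (-k) := by
  simp [barA]

theorem signA_tpow (k : ℤ) : signA (tpow k) = negtpow k := by
  have h1 : ∀ m : ℕ, signA (tpow m) = (-tpow 1) ^ m := by
    intro m
    unfold signA
    rw [LaurentPolynomial.eval₂_T_n]
    simp
  have h2 : ∀ m : ℕ, signA (tpow m) = negtpow m := by
    intro m
    rw [h1, neg_pow, LaurentPolynomial.T_pow]
    simp [negtpow, Int.negOnePow_def]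
  obtain ⟨m, rfl | rfl⟩ := Int.eq_nat_or_neg k
  · exact h2 m
  · have e1 : signA (tpow (-m)) * negtpow m = 1 := by
      rw [← h2, ← map_mul, ← LaurentPolynomial.T_add]
      simp
    have e2 : negtpow m * negtpow (-m) = 1 := by
      unfold negtpow
      rw [smul_mul_smul_comm, ← LaurentPolynomial.T_add, Int.negOnePow_neg, ← Units.val_mul,
        Int.units_mul_self]
      simp
    calc signA (tpow (-m)) = signA (tpow (-m)) * (negtpow m * negtpow (-m)) := by
          rw [e2, mul_one]
      _ = negtpow (-m) := by rw [← mul_assoc, e1, one_mul]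

/-! ### The extended affine symmetric group -/

/-- The group of all permutations `σ` of `ℤ` with `σ (i + r) = σ i + r`. -/
def affineSubgroup (r : ℕ) : Subgroup (Equiv.Perm ℤ) where
  carrier := {σ | ∀ i : ℤ, σ (i + r) = σ i + r}
  one_mem' := by intro i; rfl
  mul_mem' := by
    intro a b ha hb i
    rw [Equiv.Perm.mul_apply, Equiv.Perm.mul_apply, hb, ha]
  inv_mem' := by
    intro a ha i
    rw [Equiv.Perm.inv_eq_iff_eq, ha]
    simp

/-- The extended affine Weyl group `W` of type `Ã_{r-1}`. -/
abbrev W (r : ℕ) : Type := affineSubgroup r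

variable {r : ℕ}

/-- The shift `ρ : j ↦ j + 1`. -/
def rho (r : ℕ) : W r := ⟨Equiv.addRight (1 : ℤ), by intro i; simp [add_right_comm]⟩

/-- The infinite cyclic group `Ω` generated by `ρ`. -/
def Omega (r : ℕ) : Subgroup (W r) := Subgroup.zpowers (rho r)

/-- `s` is the simple reflection `s_i`: it sends `j` to `j + 1` if `j ≡ i`, to `j - 1` if
`j ≡ i + 1`, and fixes all other `j`, the congruences being modulo `r`.  (For `r = 1` no
permutation has this property, and there are no simple reflections.) -/
def IsSimple (i : ℤ) (s : W r) : Prop :=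
  ∀ j : ℤ, (j ≡ i [ZMOD r] → s.1 j = j + 1) ∧ (j ≡ i + 1 [ZMOD r] → s.1 j = j - 1) ∧
    (¬ j ≡ i [ZMOD r] → ¬ j ≡ i + 1 [ZMOD r] → s.1 j = j)

/-- The set `S = {s_0, …, s_{r-1}}` of simple reflections (`s_i` only depends on `i` mod `r`). -/
def simples (r : ℕ) : Set (W r) := {s | ∃ i : ℤ, IsSimple i s}

/-- `w = c s_{i_1} ⋯ s_{i_k}` with `c ∈ Ω` and `k` simple reflections. -/
def HasWord (w : W r) (k : ℕ) : Prop :=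
  ∃ c ∈ Omega r, ∃ L : List (W r), (∀ s ∈ L, s ∈ simples r) ∧ L.length = k ∧ w = c * L.prod

/-- The length function of `W = Ω ⋉ W'`: the Coxeter length of the `W'`-component. -/
def len (w : W r) : ℕ := sInf {k | HasWord w k}

/-- The reflections: the conjugates of the simple reflections. -/
def IsReflection (x : W r) : Prop := ∃ u : W r, ∃ s ∈ simples r, x = u * s * u⁻¹

/-- The Bruhat order on `W`: the order generated by `x < x * y` for reflections `y` with
`l (x) < l (x * y)`.  (Elements of different cosets of `W'` are not comparable.) -/
def BruhatLE : W r → W r → Prop :=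
  Relation.ReflTransGen fun x z => ∃ y, IsReflection y ∧ z = x * y ∧ len x < len z

theorem simples_mul_self {s : W r} (hs : s ∈ simples r) : s * s = 1 := by
  obtain ⟨i, hi⟩ := hs
  apply Subtype.ext
  apply Equiv.ext
  intro j
  change s.1 (s.1 j) = j
  by_cases h1 : j ≡ i [ZMOD r]
  · rw [(hi j).1 h1, (hi (j + 1)).2.1 (h1.add_right 1)]
    ring
  · by_cases h2 : j ≡ i + 1 [ZMOD r]
    · have h3 : j - 1 ≡ i [ZMOD r] := by simpa using h2.sub_right 1
      rw [(hi j).2.1 h2, (hi (j - 1)).1 h3]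
      ring
    · have h3 := (hi j).2.2 h1 h2
      rw [h3, h3]

theorem simples_inv {s : W r} (hs : s ∈ simples r) : s⁻¹ = s :=
  inv_eq_of_mul_eq_one_left (simples_mul_self hs)

theorem Omega_apply {c : W r} (hc : c ∈ Omega r) : ∃ a : ℤ, ∀ j, c.1 j = j + a := by
  obtain ⟨a, rfl⟩ := Subgroup.mem_zpowers_iff.1 hc
  refine ⟨a, ?_⟩
  intro j
  have : ((rho r ^ a : W r) : Equiv.Perm ℤ) = Equiv.addRight (1 : ℤ) ^ a := rfl
  rw [this]
  simp

theorem simples_conj {c s : W r} (hc : c ∈ Omega r) (hs : s ∈ simples r) :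
    c * s * c⁻¹ ∈ simples r := by
  obtain ⟨a, ha⟩ := Omega_apply hc
  obtain ⟨i, hi⟩ := hs
  have hinv : ∀ j, (c⁻¹).1 j = j - a := by
    intro j
    change (c.1)⁻¹ j = j - a
    rw [Equiv.Perm.inv_eq_iff_eq, ha]
    ring
  have happ : ∀ j, (c * s * c⁻¹).1 j = s.1 (j - a) + a := by
    intro j
    change c.1 (s.1 ((c⁻¹).1 j)) = _
    rw [hinv, ha]
  refine ⟨i + a, ?_⟩
  intro j
  obtain ⟨h1, h2, h3⟩ := hi (j - a)
  have e1 : j - a ≡ i [ZMOD r] ↔ j ≡ i + a [ZMOD r] := by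
    constructor
    · intro h; simpa using h.add_right a
    · intro h; simpa using h.sub_right a
  have e2 : j - a ≡ i + 1 [ZMOD r] ↔ j ≡ i + a + 1 [ZMOD r] := by
    constructor
    · intro h; simpa [add_right_comm] using h.add_right a
    · intro h
      have h' := h.sub_right a
      rwa [show i + a + 1 - a = i + 1 by ring] at h'
  rw [e1] at h1 h3
  rw [e2] at h2 h3
  rw [happ]
  refine ⟨?_, ?_, ?_⟩
  · intro h; rw [h1 h]; ring
  · intro h; rw [h2 h]; ring
  · intro h h'; rw [h3 h h']; ring

theorem HasWord.inv {w : W r} {k : ℕ} (h : HasWord w k) : HasWord w⁻¹ k := by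
  obtain ⟨c, hc, L, hL, rfl, rfl⟩ := h
  refine ⟨c⁻¹, inv_mem hc, (L.reverse.map fun s => c * s * c⁻¹), ?_, by simp, ?_⟩
  · intro s hs
    rw [List.mem_map] at hs
    obtain ⟨x, hx, rfl⟩ := hs
    exact simples_conj hc (hL x (List.mem_reverse.1 hx))
  · have h1 : (L.reverse.map fun s => c * s * c⁻¹).prod = c * L.reverse.prod * c⁻¹ := by
      exact List.prod_hom L.reverse (MulAut.conj c).toMonoidHom
    have h2 : L.reverse.prod = L.prod⁻¹ := by
      rw [List.prod_inv_reverse]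
      congr 1
      symm
      have : L.map (fun x => x⁻¹) = L := by
        conv_rhs => rw [← List.map_id L]
        apply List.map_congr_left
        intro s hs
        exact simples_inv (hL s hs)
      rw [this]
    rw [h1, h2]
    group

theorem len_inv (w : W r) : len w⁻¹ = len w := by
  unfold len
  congr 1
  ext k
  constructor
  · intro h; simpa using HasWord.inv h
  · intro h; exact HasWord.inv h

theorem HasWord.mul_simple {w s : W r} {k : ℕ} (h : HasWord w k) (hs : s ∈ simples r) :
    HasWord (w * s) (k + 1) := by
  obtain ⟨c, hc, L, hL, rfl, rfl⟩ := h
  refine ⟨c, hc, L ++ [s], ?_, by simp, by simp [mul_assoc]⟩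
  intro x hx
  rcases List.mem_append.1 hx with hx | hx
  · exact hL x hx
  · rw [List.mem_singleton.1 hx]; exact hs

theorem hasWord_one : HasWord (1 : W r) 0 :=
  ⟨1, one_mem _, [], by simp, rfl, by simp⟩

theorem len_one : len (1 : W r) = 0 := by
  exact Nat.eq_zero_of_le_zero (Nat.sInf_le hasWord_one)

theorem len_simple {s : W r} (hs : s ∈ simples r) : len s = 1 := by
  have h1 : HasWord s 1 := by simpa using hasWord_one.mul_simple hs
  have hle : len s ≤ 1 := Nat.sInf_le h1
  have hne : len s ≠ 0 := by
    intro h0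
    have hm : HasWord s (len s) := Nat.sInf_mem (s := {k | HasWord s k}) ⟨1, h1⟩
    rw [h0] at hm
    obtain ⟨c, hc, L, -, hl, rfl⟩ := hm
    rw [List.length_eq_zero_iff] at hl
    subst hl
    obtain ⟨a, ha⟩ := Omega_apply hc
    obtain ⟨i, hi⟩ := hs
    simp only [List.prod_nil, mul_one] at hi
    have e1 := (hi i).1 rfl
    have e2 := (hi (i + 1)).2.1 rfl
    rw [ha] at e1 e2
    omega
  omega

theorem exists_descent {w : W r} {k : ℕ} (h : len w = k + 1) :
    ∃ w' : W r, ∃ s ∈ simples r, w = w' * s ∧ len w' = k := by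
  have hne : {k | HasWord w k}.Nonempty := by
    by_contra hn
    rw [Set.not_nonempty_iff_eq_empty] at hn
    unfold len at h
    rw [hn] at h
    simp at h
  have hm : HasWord w (len w) := Nat.sInf_mem hne
  rw [h] at hm
  obtain ⟨c, hc, L, hL, hl, rfl⟩ := hm
  obtain ⟨L', s, rfl⟩ : ∃ L' s, L = L' ++ [s] := by
    refine ⟨L.dropLast, L.getLast ?_, (List.dropLast_append_getLast _).symm⟩
    intro h0
    simp [h0] at hl
  have hs : s ∈ simples r := hL s (by simp)
  have hw' : HasWord (c * L'.prod) k :=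
    ⟨c, hc, L', fun x hx => hL x (by simp [hx]), by simpa using hl, rfl⟩
  refine ⟨c * L'.prod, s, hs, by simp [mul_assoc], ?_⟩
  have hle : len (c * L'.prod) ≤ k := Nat.sInf_le hw'
  have hm' : HasWord (c * L'.prod) (len (c * L'.prod)) :=
    Nat.sInf_mem (s := {k | HasWord (c * L'.prod) k}) ⟨k, hw'⟩
  have h2 : HasWord (c * (L' ++ [s]).prod) (len (c * L'.prod) + 1) := by
    simpa [mul_assoc] using hm'.mul_simple hs
  have h3 : len (c * (L' ++ [s]).prod) ≤ len (c * L'.prod) + 1 := Nat.sInf_le h2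
  omega

/-! ### The extended affine Hecke algebra -/

/-- The defining relations of the Hecke algebra. -/
inductive HeckeRel (r : ℕ) : FreeAlgebra Laurent (W r) → FreeAlgebra Laurent (W r) → Prop
  | one : HeckeRel r (FreeAlgebra.ι Laurent 1) 1
  | mul (w w' : W r) (h : len (w * w') = len w + len w') :
      HeckeRel r (FreeAlgebra.ι Laurent w * FreeAlgebra.ι Laurent w')
        (FreeAlgebra.ι Laurent (w * w'))
  | quad (s : W r) (hs : s ∈ simples r) :
      HeckeRel r ((FreeAlgebra.ι Laurent s + 1) *
        (FreeAlgebra.ι Laurent s - algebraMap Laurent _ q)) 0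

/-- The extended affine Hecke algebra over `ℤ[t, t⁻¹]`: the algebra with generators `T_w`, `w ∈ W`,
and relations `T_1 = 1`, `T_w T_{w'} = T_{w w'}` if `l (w w') = l (w) + l (w')`, and
`(T_s + 1) (T_s - q) = 0` for `s ∈ S`. -/
def Hecke (r : ℕ) : Type := RingQuot (HeckeRel r)

instance : Ring (Hecke r) := inferInstanceAs (Ring (RingQuot (HeckeRel r)))

instance : Algebra Laurent (Hecke r) := inferInstanceAs (Algebra Laurent (RingQuot (HeckeRel r)))

/-- The quotient map from the free algebra. -/
def toHecke (r : ℕ) : FreeAlgebra Laurent (W r) →ₐ[Laurent] Hecke r :=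
  RingQuot.mkAlgHom Laurent (HeckeRel r)

/-- The standard generators `T_w`. -/
def T (w : W r) : Hecke r := toHecke r (FreeAlgebra.ι Laurent w)

theorem toHecke_rel {x y : FreeAlgebra Laurent (W r)} (h : HeckeRel r x y) :
    toHecke r x = toHecke r y :=
  RingQuot.mkAlgHom_rel Laurent h

theorem T_one : T (1 : W r) = 1 := by
  have := toHecke_rel (HeckeRel.one (r := r))
  rwa [map_one] at this

theorem T_mul (w w' : W r) (h : len (w * w') = len w + len w') : T w * T w' = T (w * w') := by
  have := toHecke_rel (HeckeRel.mul w w' h)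
  rwa [map_mul] at this

theorem T_quad (s : W r) (hs : s ∈ simples r) :
    (T s + 1) * (T s - algebraMap Laurent _ q) = 0 := by
  have := toHecke_rel (HeckeRel.quad s hs)
  simpa [T] using this

/-- The ring homomorphism from the free algebra to the Hecke algebra that is `σ` on scalars and
maps the generator `w` to `f w`. -/
def freeLift (σ : Laurent →+* Laurent) (f : W r → Hecke r) :
    FreeAlgebra Laurent (W r) →+* Hecke r :=
  letI : Algebra Laurent (Hecke r) := ((algebraMap Laurent (Hecke r)).comp σ).toAlgebra'
    fun c x => Algebra.commutes (σ c) x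
  (FreeAlgebra.lift Laurent f).toRingHom

theorem freeLift_gen (σ : Laurent →+* Laurent) (f : W r → Hecke r) (w : W r) :
    freeLift σ f (FreeAlgebra.ι Laurent w) = f w := by
  let : Algebra Laurent (Hecke r) := ((algebraMap Laurent (Hecke r)).comp σ).toAlgebra'
    fun c x => Algebra.commutes (σ c) x
  exact FreeAlgebra.lift_ι_apply f w

theorem freeLift_scalar (σ : Laurent →+* Laurent) (f : W r → Hecke r) (a : Laurent) :
    freeLift σ f (algebraMap Laurent _ a) = algebraMap Laurent (Hecke r) (σ a) := by
  let : Algebra Laurent (Hecke r) := ((algebraMap Laurent (Hecke r)).comp σ).toAlgebra'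
    fun c x => Algebra.commutes (σ c) x
  exact (FreeAlgebra.lift Laurent f).commutes a

/-- The ring homomorphism from the Hecke algebra to itself that is `σ` on scalars and maps `T_w` to
`f w`, for a family `f` that satisfies the (`σ`-twisted) defining relations. -/
def heckeLift (σ : Laurent →+* Laurent) (f : W r → Hecke r) (h1 : f 1 = 1)
    (hmul : ∀ w w', len (w * w') = len w + len w' → f w * f w' = f (w * w'))
    (hquad : ∀ s ∈ simples r, (f s + 1) * (f s - algebraMap Laurent _ (σ q)) = 0) :
    Hecke r →+* Hecke r :=
  RingQuot.lift (r := HeckeRel r) ⟨freeLift σ f, by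
    intro x y h
    cases h with
    | one => rw [freeLift_gen, h1, map_one]
    | mul w w' h => rw [map_mul, freeLift_gen, freeLift_gen, freeLift_gen, hmul w w' h]
    | quad s hs =>
      rw [map_mul, map_add, map_sub, freeLift_gen, freeLift_scalar, map_one, hquad s hs, map_zero]⟩

theorem heckeLift_toHecke (σ : Laurent →+* Laurent) (f : W r → Hecke r) (h1 : f 1 = 1)
    (hmul : ∀ w w', len (w * w') = len w + len w' → f w * f w' = f (w * w'))
    (hquad : ∀ s ∈ simples r, (f s + 1) * (f s - algebraMap Laurent _ (σ q)) = 0)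
    (x : FreeAlgebra Laurent (W r)) :
    heckeLift σ f h1 hmul hquad (toHecke r x) = freeLift σ f x := by
  have e : toHecke r x = RingQuot.mkRingHom (HeckeRel r) x := by
    rw [← RingQuot.mkAlgHom_coe Laurent (HeckeRel r)]
    rfl
  rw [e]
  exact RingQuot.lift_mkRingHom_apply _ _ _

theorem heckeLift_T (σ : Laurent →+* Laurent) (f : W r → Hecke r) (h1 : f 1 = 1)
    (hmul : ∀ w w', len (w * w') = len w + len w' → f w * f w' = f (w * w'))
    (hquad : ∀ s ∈ simples r, (f s + 1) * (f s - algebraMap Laurent _ (σ q)) = 0) (w : W r) :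
    heckeLift σ f h1 hmul hquad (T w) = f w := by
  unfold T
  rw [heckeLift_toHecke, freeLift_gen]

theorem heckeLift_smul (σ : Laurent →+* Laurent) (f : W r → Hecke r) (h1 : f 1 = 1)
    (hmul : ∀ w w', len (w * w') = len w + len w' → f w * f w' = f (w * w'))
    (hquad : ∀ s ∈ simples r, (f s + 1) * (f s - algebraMap Laurent _ (σ q)) = 0)
    (a : Laurent) (x : Hecke r) :
    heckeLift σ f h1 hmul hquad (a • x) = σ a • heckeLift σ f h1 hmul hquad x := by
  have e : algebraMap Laurent (Hecke r) a = toHecke r (algebraMap Laurent _ a) :=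
    ((toHecke r).commutes a).symm
  rw [Algebra.smul_def, Algebra.smul_def, map_mul, e, heckeLift_toHecke, freeLift_scalar]

/-! ### The standard generators are invertible -/

theorem q_mul_inv : q * tpow (-2) = 1 := by
  rw [← LaurentPolynomial.T_add]
  simp

theorem T_simple_mul {s : W r} (hs : s ∈ simples r) :
    T s * (tpow (-2) • (T s - q • 1 + 1)) = 1 := by
  have h := T_quad s hs
  rw [Algebra.algebraMap_eq_smul_one] at h
  have h2 : T s * (T s - q • 1 + 1) = q • (1 : Hecke r) := by
    have : T s * (T s - q • 1 + 1) = (T s + 1) * (T s - q • 1) + q • 1 := by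
      simp only [add_mul, mul_sub, mul_add, one_mul, mul_smul_comm, mul_one, smul_add]
      abel
    rw [this, h, zero_add]
  rw [mul_smul_comm, h2, smul_smul, mul_comm, q_mul_inv, one_smul]

theorem T_simple_mul' {s : W r} (hs : s ∈ simples r) :
    (tpow (-2) • (T s - q • 1 + 1)) * T s = 1 := by
  refine Eq.trans ?_ (T_simple_mul hs)
  rw [smul_mul_assoc, mul_smul_comm]
  congr 1
  simp only [smul_mul_assoc, mul_smul_comm, add_mul, sub_mul, mul_add, mul_sub, one_mul, mul_one]

theorem isUnit_T (w : W r) : IsUnit (T w) := by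
  obtain ⟨k, hk⟩ : ∃ k, len w = k := ⟨_, rfl⟩
  induction k generalizing w with
  | zero =>
    refine isUnit_iff_exists.2 ⟨T w⁻¹, ?_, ?_⟩
    · rw [T_mul, mul_inv_cancel, T_one]
      rw [mul_inv_cancel, len_inv, hk, len_one]
    · rw [T_mul, inv_mul_cancel, T_one]
      rw [inv_mul_cancel, len_inv, hk, len_one]
  | succ k ih =>
    obtain ⟨w', s, hs, rfl, hw'⟩ := exists_descent hk
    rw [← T_mul w' s (by rw [hk, hw', len_simple hs])]
    exact (ih w' hw').mul (isUnit_iff_exists.2 ⟨_, T_simple_mul hs, T_simple_mul' hs⟩)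

/-- The inverse of `T_w`. -/
def Tinv (w : W r) : Hecke r := ((isUnit_T w).unit⁻¹ : (Hecke r)ˣ)

theorem Tinv_mul (w : W r) : Tinv w * T w = 1 := (isUnit_T w).val_inv_mul

theorem mul_Tinv (w : W r) : T w * Tinv w = 1 := (isUnit_T w).mul_val_inv

theorem Tinv_eq {w : W r} {x : Hecke r} (h : T w * x = 1) : Tinv w = x := by
  rw [← mul_one (Tinv w), ← h, ← mul_assoc, Tinv_mul, one_mul]

theorem Tinv_one : Tinv (1 : W r) = 1 := Tinv_eq (by rw [T_one, one_mul])

theorem Tinv_inv_mul (w w' : W r) (h : len (w * w') = len w + len w') :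
    Tinv w⁻¹ * Tinv w'⁻¹ = Tinv (w * w')⁻¹ := by
  symm
  apply Tinv_eq
  rw [mul_inv_rev, ← T_mul w'⁻¹ w⁻¹ (by rw [← mul_inv_rev, len_inv, len_inv, len_inv, h, add_comm]),
    mul_assoc, ← mul_assoc (T w⁻¹), mul_Tinv, one_mul, mul_Tinv]

theorem Tinv_simple {s : W r} (hs : s ∈ simples r) :
    Tinv s⁻¹ = tpow (-2) • (T s - q • 1 + 1) := by
  rw [simples_inv hs]
  exact Tinv_eq (T_simple_mul hs)

theorem T_simple_sq {s : W r} (hs : s ∈ simples r) :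
    T s * T s = q • T s - T s + q • 1 := by
  have h := T_quad s hs
  rw [Algebra.algebraMap_eq_smul_one] at h
  simp only [add_mul, mul_sub, one_mul, mul_smul_comm, mul_one, smul_add] at h
  rw [← sub_eq_zero, ← h]
  abel

theorem negqpow_add (a b : ℤ) : negqpow (a + b) = negqpow a * negqpow b := by
  unfold negqpow
  rw [smul_mul_smul_comm, ← LaurentPolynomial.T_add, Int.negOnePow_add, mul_add, Units.val_mul]

theorem negqpow_zero : negqpow 0 = 1 := by
  simp [negqpow]

theorem negqpow_one : negqpow 1 = -q := by
  simp [negqpow]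

theorem negqpow_neg_one : negqpow (-1) = -tpow (-2) := by
  simp [negqpow]

theorem quad_expand (x : Hecke r) (a : Laurent) :
    (x + 1) * (x - algebraMap Laurent _ a) = x * x - a • x + x - a • 1 := by
  rw [Algebra.algebraMap_eq_smul_one]
  simp only [add_mul, mul_sub, one_mul, mul_smul_comm, mul_one, smul_add]
  abel

/-! ### The three involutions of the Hecke algebra -/

/-- The bar involution: `∑ a_w T_w ↦ ∑ \bar a_w T_{w⁻¹}⁻¹`. -/
def barH (r : ℕ) : Hecke r →+* Hecke r :=
  heckeLift barA (fun w => Tinv w⁻¹) (by rw [inv_one, Tinv_one]) Tinv_inv_mul (by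
    intro s hs
    rw [quad_expand, Tinv_simple hs, barA_tpow]
    simp only [smul_mul_assoc, mul_smul_comm, add_mul, sub_mul, mul_add, mul_sub, one_mul, mul_one,
      T_simple_sq hs]
    have hu := q_mul_inv
    match_scalars
    · linear_combination (-tpow (-2)) * hu
    · linear_combination (q * tpow (-2)) * hu)

/-- The involution `j : ∑ a_w T_w ↦ ∑ \bar a_w (-q)^{-l(w)} T_w`. -/
def jH (r : ℕ) : Hecke r →+* Hecke r :=
  heckeLift barA (fun w => negqpow (-(len w : ℤ)) • T w) (by simp [len_one, T_one])
    (by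
      intro w w' h
      rw [smul_mul_smul_comm, T_mul w w' h, ← negqpow_add, h]
      congr 2
      push_cast
      ring)
    (by
      intro s hs
      rw [quad_expand, len_simple hs, barA_tpow, Nat.cast_one, negqpow_neg_one]
      simp only [smul_mul_assoc, mul_smul_comm, T_simple_sq hs]
      have hu := q_mul_inv
      match_scalars
      · linear_combination (tpow (-2)) * hu
      · linear_combination (tpow (-2)) * hu)

/-- The ring homomorphism `Ψ` with `t ↦ -t` and `T_w ↦ (-q)^{l(w)} T_{w⁻¹}⁻¹`. -/
def Psi (r : ℕ) : Hecke r →+* Hecke r :=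
  heckeLift signA (fun w => negqpow (len w : ℤ) • Tinv w⁻¹)
    (by simp [len_one, Tinv_one])
    (by
      intro w w' h
      rw [smul_mul_smul_comm, Tinv_inv_mul w w' h, ← negqpow_add, h]
      push_cast
      rfl)
    (by
      intro s hs
      rw [quad_expand, len_simple hs, signA_tpow, Tinv_simple hs, Nat.cast_one, negqpow_one]
      simp only [smul_mul_assoc, mul_smul_comm, add_mul, sub_mul, mul_add, mul_sub, one_mul,
        mul_one, T_simple_sq hs]
      have hu := q_mul_inv
      have hs2 : negtpow 2 = q := by simp [negtpow]
      rw [hs2]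
      match_scalars
      · linear_combination (q * tpow (-2) - q ^ 2 * tpow (-2)) * hu
      · linear_combination ((q ^ 2 - q + 1) * q * tpow (-2) + q) * hu)

theorem barH_smul_T (a : Laurent) (w : W r) : barH r (a • T w) = barA a • Tinv w⁻¹ := by
  unfold barH
  rw [heckeLift_smul, heckeLift_T]

theorem jH_smul_T (a : Laurent) (w : W r) :
    jH r (a • T w) = barA a • negqpow (-(len w : ℤ)) • T w := by
  unfold jH
  rw [heckeLift_smul, heckeLift_T]

theorem Psi_smul_T (a : Laurent) (w : W r) :
    Psi r (a • T w) = signA a • negqpow (len w : ℤ) • Tinv w⁻¹ := by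
  unfold Psi
  rw [heckeLift_smul, heckeLift_T]

/-! ### Kazhdan–Lusztig elements -/

/-- An element with the property `p`, if there is one (otherwise the junk value `0`). It is only
used for properties that hold for exactly one element. -/
def theElement {X : Type*} [Zero X] (p : X → Prop) : X :=
  open Classical in if h : ∃ x, p x then h.choose else 0

/-- `h` is bar-invariant and
`h = ∑_{y ≤ w} (-1)^{l(w)-l(y)} q^{l(w)/2-l(y)} P_y(q⁻¹) T_y` for polynomials `P_y` with `P_w = 1`
and `deg P_y ≤ (l(w)-l(y)-1)/2` for `y < w`. -/
def IsKL' (w : W r) (h : Hecke r) : Prop :=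
  barH r h = h ∧ ∃ P : W r → Polynomial ℤ, P w = 1 ∧
    (∀ y, BruhatLE y w → y ≠ w → 2 * (P y).natDegree + 1 + len y ≤ len w) ∧
    h = ∑ᶠ y ∈ {y | BruhatLE y w},
      ((-1 : Laurent) ^ (len w - len y) * tpow ((len w : ℤ) - 2 * len y) *
        Polynomial.aeval (tpow (-2)) (P y)) • T y

/-- The Kazhdan–Lusztig element `C'_w`. -/
def C' (w : W r) : Hecke r := theElement (IsKL' w)

/-- The Kazhdan–Lusztig element `C_w = (-1)^{l(w)} j(C'_w)`. -/
def C (w : W r) : Hecke r := (-1 : Hecke r) ^ len w * jH r (C' w)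

/-! ### Compositions, Young subgroups and double cosets -/

/-- The compositions `Λ(n, r)` of `r` into `n` parts (the index `i : Fin n` stands for the
part number `i + 1`). -/
abbrev Comp (n r : ℕ) : Type := {lam : Fin n → ℕ // ∑ i, lam i = r}

variable {n : ℕ}

/-- The `s_i` with `1 ≤ i ≤ r - 1` for which `i` is not one of the partial sums
`λ_1 + ⋯ + λ_k`, i.e. `i` and `i + 1` lie in the same block of `λ`. -/
def youngGens (lam : Comp n r) : Set (W r) :=
  {s | ∃ i : ℕ, 1 ≤ i ∧ i < r ∧ (∀ k : ℕ, i ≠ ∑ j : Fin n with j.val < k, lam.1 j) ∧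
    IsSimple (i : ℤ) s}

/-- The standard Young subgroup `W_λ`. -/
def young (lam : Comp n r) : Subgroup (W r) := Subgroup.closure (youngGens lam)

/-- The double coset `W_λ w W_μ`. -/
def dcoset (lam : Comp n r) (w : W r) (mu : Comp n r) : Set (W r) :=
  DoubleCoset.doubleCoset w (young lam : Set (W r)) (young mu : Set (W r))

/-- `w` has minimal length in its double coset `W_λ w W_μ`. -/
def IsMin (lam : Comp n r) (w : W r) (mu : Comp n r) : Prop :=
  ∀ x ∈ dcoset lam w mu, len w ≤ len x

/-- The element of maximal length of a subset of `W` that has a unique such element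
(junk value `1` if there is none). -/
def longest (D : Set (W r)) : W r :=
  open Classical in if h : ∃ x ∈ D, ∀ y ∈ D, len y ≤ len x then h.choose else 1

/-- The longest element `w_{0,λ}` of `W_λ`. -/
def wzero (lam : Comp n r) : W r := longest (young lam : Set (W r))

/-- The triples `(λ, w, μ)` with `w` of minimal length in `W_λ w W_μ`. -/
structure Triple (n r : ℕ) where
  /-- the first composition -/
  lam : Comp n r
  /-- the distinguished representative -/
  w : W r
  /-- the second composition -/
  mu : Comp n r
  isMin : IsMin lam w mu

/-- The element `w⁺` of maximal length in `W_λ w W_μ`. -/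
def Triple.wplus (B : Triple n r) : W r := longest (dcoset B.lam B.w B.mu)

/-- `T_D = ∑_{x ∈ D} T_x` for `D = W_λ w W_μ`. -/
def TD (lam : Comp n r) (w : W r) (mu : Comp n r) : Hecke r :=
  ∑ᶠ x ∈ dcoset lam w mu, T x

/-- `T̃_D = ∑_{x ∈ D} (-q)^{-l(x)} T_x` for `D = W_λ w W_μ`. -/
def TDtilde (lam : Comp n r) (w : W r) (mu : Comp n r) : Hecke r :=
  ∑ᶠ x ∈ dcoset lam w mu, negqpow (-(len x : ℤ)) • T x

/-- `x_λ = ∑_{w ∈ W_λ} T_w`. -/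
def xElt (lam : Comp n r) : Hecke r := ∑ᶠ w ∈ (young lam : Set (W r)), T w

/-- `y_λ = j(x_λ)`. -/
def yElt (lam : Comp n r) : Hecke r := jH r (xElt lam)

/-! ### Endomorphism algebras of sums of right ideals -/

/-- The right ideal `v H`, a right `H`-module. -/
abbrev rightIdeal (v : Hecke r) : Submodule (Hecke r)ᵐᵒᵖ (Hecke r) := Submodule.span _ {v}

/-- The right `H`-module `⨁_λ v_λ H`. -/
abbrev IdealSum (v : Comp n r → Hecke r) : Type :=
  DirectSum (Comp n r) fun lam => rightIdeal (v lam)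

/-- The algebra `End_H (⨁_λ v_λ H)` over `ℤ[t, t⁻¹]`. -/
abbrev EndAlg (v : Comp n r → Hecke r) : Type := Module.End (Hecke r)ᵐᵒᵖ (IdealSum v)

/-- The inclusion of the summand `v_λ H`. -/
def incl (v : Comp n r → Hecke r) (lam : Comp n r) :
    rightIdeal (v lam) →ₗ[(Hecke r)ᵐᵒᵖ] IdealSum v :=
  DirectSum.lof (Hecke r)ᵐᵒᵖ (Comp n r) (fun lam => rightIdeal (v lam)) lam

/-- The element `v_λ h` of `v_λ H`. -/
def genMul (v : Comp n r → Hecke r) (lam : Comp n r) (h : Hecke r) : rightIdeal (v lam) :=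
  MulOpposite.op h • ⟨v lam, Submodule.mem_span_singleton_self (v lam)⟩

/-- The endomorphism of `⨁_λ v_λ H` that maps `v_ν h` to `δ_{μν} d h` in the summand `v_λ H`. -/
def stdMap (v : Comp n r → Hecke r) (lam mu : Comp n r) (d : Hecke r) : EndAlg v :=
  theElement fun f => ∀ (nu : Comp n r) (h : Hecke r) (kappa : Comp n r),
    (f (incl v nu (genMul v nu h)) kappa : Hecke r) = if nu = mu ∧ kappa = lam then d * h else 0

/-- The affine `q`-Schur algebra `End_H (⨁_λ x_λ H)`. -/
abbrev Schur (n r : ℕ) : Type := EndAlg (xElt : Comp n r → Hecke r)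

/-- The algebra `End_H (⨁_λ y_λ H)`. -/
abbrev SchurTilde (n r : ℕ) : Type := EndAlg (yElt : Comp n r → Hecke r)

/-- The standard basis element `φ_{λμ}^w : x_ν h ↦ δ_{μν} ∑_{x ∈ W_λ w W_μ} T_x h`. -/
def phi (lam : Comp n r) (w : W r) (mu : Comp n r) : Schur n r :=
  stdMap xElt lam mu (TD lam w mu)

/-- The signed standard basis element
`ψ_{λμ}^w : y_ν h ↦ δ_{μν} ∑_{x ∈ W_λ w W_μ} (-q)^{-l(x)} T_x h`. -/
def psi (lam : Comp n r) (w : W r) (mu : Comp n r) : SchurTilde n r :=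
  stdMap yElt lam mu (TDtilde lam w mu)

/-! ### The Kazhdan–Lusztig bases -/

/-- The coefficients `α_{z,w}` in `C_{w⁺} = ∑_z α_{z,w} T_{W_λ z W_μ}`, the sum being over the `z`
of minimal length in `W_λ z W_μ`. -/
def alpha (B : Triple n r) : W r →₀ Laurent :=
  theElement fun a => (∀ z ∈ a.support, IsMin B.lam z B.mu) ∧
    C B.wplus = a.sum fun z c => c • TD B.lam z B.mu

/-- The coefficients `α̃_{z,w}` in `C'_{w⁺} = ∑_z α̃_{z,w} T̃_{W_λ z W_μ}`, the sum being over the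
`z` of minimal length in `W_λ z W_μ`. -/
def alphaTilde (B : Triple n r) : W r →₀ Laurent :=
  theElement fun a => (∀ z ∈ a.support, IsMin B.lam z B.mu) ∧
    C' B.wplus = a.sum fun z c => c • TDtilde B.lam z B.mu

/-- `θ_B = t^{l(w_{0,μ})} ∑_z α_{z,w} φ_{λμ}^z`. -/
def theta (B : Triple n r) : Schur n r :=
  tpow (len (wzero B.mu)) • (alpha B).sum fun z c => c • phi B.lam z B.mu

/-- `θ̃_B = (-t)^{-l(w_{0,μ})} ∑_z α̃_{z,w} ψ_{λμ}^z`. -/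
def thetaTilde (B : Triple n r) : SchurTilde n r :=
  negtpow (-(len (wzero B.mu) : ℤ)) • (alphaTilde B).sum fun z c => c • psi B.lam z B.mu

/-- The ring isomorphism `F` is induced by `Ψ`: applying `Ψ` in every component is a bijection
`E : ⨁_λ x_λ H → ⨁_λ y_λ H`, and `F f = E ∘ f ∘ E⁻¹`. -/
def IsInducedByPsi (F : Schur n r ≃+* SchurTilde n r) : Prop :=
  ∃ E : IdealSum (xElt : Comp n r → Hecke r) ≃+ IdealSum (yElt : Comp n r → Hecke r),
    (∀ m lam, (E m lam : Hecke r) = Psi r (m lam : Hecke r)) ∧ ∀ f m, F f (E m) = E (f m)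

end AffineSchur

end

noncomputable section

namespace AffineSchur

section

variable {r : ℕ}

/-! ### Reflections and inversions -/

/-! An endomorphism of `⨁ y_λ H` is a matrix: its entry at `(κ, ν)` is the `κ`-component of the
image of the generator `y_ν`. Call `signSpace κ ν` the set of `d` on which `T_s` acts by `-1` on the
left for the generators `s` of `W_κ` and on the right for those of `W_ν`. Entries lie there
(`entry_mem_signSpace`), since `T_s y = -y = y T_s` for `y = y_λ` and the map is right linear.
Conversely, every `d` in `signSpace λ μ` factors as `y_λ g = g' y_μ` (`exists_eq_yElt_mul`,
`exists_eq_mul_yElt`), so left multiplication by `g'` realises it as an entry (`stdMap_apply`). The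
theorem thus becomes a statement about the spaces `signSpace λ μ`. In the coordinates that multiply
the coefficient of `T_x` by `(-q)^{l(x)}`, `signSpace λ μ` consists of the finitely supported
functions that are constant on double cosets (`mul_simple_eq_neg_iff`), so the `T̃_D` span it
(`exists_eq_sum_TDtilde`). In this normalization `C'_w T_s = -C'_w` whenever `ws < w`, and likewise
on the left; hence `C'_{w⁺}` belongs to the space. Its leading coefficient is a unit and its other
terms are smaller in the Bruhat order, so the `C'_{w⁺}` form a basis as well (`TDtilde_mem_span`,
`linearIndependent_C'`). The only nonzero entry of `θ̃_B` is `(-t)^{-l(w_{0,μ})} C'_{w_B⁺}`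
(`entry_thetaTilde`), which gives (1). Since `C'_{w_{0,μ}} = (-t)^{l(w_{0,μ})} y_μ` (`C'_wzero`), it
gives (2) too. For (3), `Ψ ∘ j` is the bar involution followed by `t ↦ -t`, `T_w ↦ T_w` (`Psi_jH`).
All exponents of `t` in `C'_w` have the parity of `l(w)`, so `Ψ(C_w) = C'_w` (`Psi_C`). For `w =
w_{0,λ}` this says `Ψ(x_λ) = q^{l(w_{0,λ})} y_λ`; hence `Ψ` exchanges the ideals, and comparing
entries gives `Ψ(θ_B) = θ̃_B`. The Coxeter and Hecke theory underneath is built from the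
permutations. Length is the number of inversions (`len_eq`), and the cocycle rule
`mem_inversions_mul` yields strong exchange, the lifting property and the length formulas for
parabolic cosets. Commuting left and right regular operators show that the `T_w` are independent
(`linearIndependent_T`). The elements `C'_w` exist by the Kazhdan–Lusztig induction
(`exists_isKLElement`) and are unique because the bar involution is triangular. -/

theorem apply_add_mul (w : W r) (a k : ℤ) : w.1 (a + r * k) = w.1 a + r * k := by
  have h : ∀ (m : ℕ) (a : ℤ), w.1 (a + r * m) = w.1 a + r * m := by
    intro m
    induction m with
    | zero => simp
    | succ m ih =>
      intro a
      rw [Nat.cast_succ, mul_add, mul_one, ← add_assoc, w.2, ih, add_assoc]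
  obtain ⟨m, rfl | rfl⟩ := Int.eq_nat_or_neg k
  · exact h m a
  · have := h m (a + r * -m)
    rw [mul_neg, neg_add_cancel_right] at this
    rw [mul_neg]
    linarith

theorem apply_modEq {w : W r} {a b : ℤ} (h : a ≡ b [ZMOD r]) : w.1 a ≡ w.1 b [ZMOD r] := by
  obtain ⟨k, hk⟩ := (Int.modEq_iff_add_fac.1 h)
  rw [hk, apply_add_mul]
  exact (Int.modEq_iff_add_fac.2 ⟨k, rfl⟩)

theorem mul_val_apply (x y : W r) (a : ℤ) : (x * y).1 a = x.1 (y.1 a) := rfl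

theorem inv_val_apply_self (x : W r) (a : ℤ) : (x⁻¹).1 (x.1 a) = a := by
  rw [← mul_val_apply, inv_mul_cancel]; rfl

theorem apply_inv_val_self (x : W r) (a : ℤ) : x.1 ((x⁻¹).1 a) = a := by
  rw [← mul_val_apply, mul_inv_cancel]; rfl

theorem apply_modEq_iff {w : W r} {a b : ℤ} : w.1 a ≡ w.1 b [ZMOD r] ↔ a ≡ b [ZMOD r] := by
  refine ⟨fun h => ?_, apply_modEq⟩
  have := apply_modEq (w := w⁻¹) h
  rwa [inv_val_apply_self, inv_val_apply_self] at this

theorem ext_apply {x y : W r} (h : ∀ a, x.1 a = y.1 a) : x = y :=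
  Subtype.ext (Equiv.ext h)

/-- `t` interchanges `a + kr` and `b + kr` for all `k` and fixes all other integers. -/
def IsTransp (a b : ℤ) (t : W r) : Prop :=
  ∀ j : ℤ, (j ≡ a [ZMOD r] → t.1 j = j + (b - a)) ∧ (j ≡ b [ZMOD r] → t.1 j = j - (b - a)) ∧
    (¬ j ≡ a [ZMOD r] → ¬ j ≡ b [ZMOD r] → t.1 j = j)

theorem IsSimple.isTransp {i : ℤ} {s : W r} (h : IsSimple i s) : IsTransp i (i + 1) s := by
  intro j
  rw [add_sub_cancel_left]
  exact h j

theorem IsTransp.symm {a b : ℤ} {t : W r} (h : IsTransp a b t) : IsTransp b a t := by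
  intro j
  obtain ⟨h1, h2, h3⟩ := h j
  refine ⟨fun e => ?_, fun e => ?_, fun e e' => h3 e' e⟩
  · rw [h2 e]; ring
  · rw [h1 e]; ring

theorem IsTransp.conj {a b : ℤ} {t : W r} (h : IsTransp a b t) (u : W r) :
    IsTransp (u.1 a) (u.1 b) (u * t * u⁻¹) := by
  intro j
  obtain ⟨i, rfl⟩ : ∃ i, u.1 i = j := ⟨(u⁻¹).1 j, apply_inv_val_self _ _⟩
  rw [apply_modEq_iff, apply_modEq_iff, mul_val_apply, mul_val_apply, inv_val_apply_self]
  obtain ⟨h1, h2, h3⟩ := h i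
  refine ⟨fun e => ?_, fun e => ?_, fun e e' => by rw [h3 e e']⟩
  · rw [h1 e]
    obtain ⟨k, hk⟩ := Int.modEq_iff_add_fac.1 e.symm
    rw [hk, show a + r * k + (b - a) = b + r * k by ring, apply_add_mul, apply_add_mul]
    ring
  · rw [h2 e]
    obtain ⟨k, hk⟩ := Int.modEq_iff_add_fac.1 e.symm
    rw [hk, show b + r * k - (b - a) = a + r * k by ring, apply_add_mul, apply_add_mul]
    ring

theorem IsTransp.apply_left {a b : ℤ} {t : W r} (h : IsTransp a b t) : t.1 a = b := by
  rw [(h a).1 rfl]; ring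

theorem IsTransp.apply_right {a b : ℤ} {t : W r} (h : IsTransp a b t) : t.1 b = a := by
  rw [(h b).2.1 rfl]; ring

/-- The residue class of the smaller endpoint is recovered from `t` alone, so membership in
`inversions` can be tested on any one pair that `t` interchanges. -/
theorem IsTransp.lt_apply_iff {a b : ℤ} {t : W r} (h : IsTransp a b t) (hab : a < b) (j : ℤ) :
    j < t.1 j ↔ j ≡ a [ZMOD r] := by
  obtain ⟨h1, h2, h3⟩ := h j
  by_cases e : j ≡ a [ZMOD r]
  · simp only [e, iff_true]; rw [h1 e]; linarith
  · by_cases e' : j ≡ b [ZMOD r]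
    · simp only [e, iff_false]; rw [h2 e']; linarith
    · simp only [e, iff_false]; rw [h3 e e']; exact lt_irrefl _

theorem IsTransp.unique {a b : ℤ} {t t' : W r} (h : IsTransp a b t) (h' : IsTransp a b t') :
    t = t' := by
  refine ext_apply fun j => ?_
  obtain ⟨h1, h2, h3⟩ := h j
  obtain ⟨h1', h2', h3'⟩ := h' j
  by_cases e : j ≡ a [ZMOD r]
  · rw [h1 e, h1' e]
  · by_cases e' : j ≡ b [ZMOD r]
    · rw [h2 e', h2' e']
    · rw [h3 e e', h3' e e']

theorem IsTransp.of_modEq {a b c : ℤ} {t : W r} (h : IsTransp a b t) (hc : c ≡ a [ZMOD r]) :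
    IsTransp c (t.1 c) t := by
  obtain ⟨k, rfl⟩ := Int.modEq_iff_add_fac.1 hc.symm
  have hb : b + r * k ≡ b [ZMOD r] := (Int.modEq_iff_add_fac.2 ⟨k, rfl⟩).symm
  rw [apply_add_mul, h.apply_left]
  intro j
  obtain ⟨h1, h2, h3⟩ := h j
  refine ⟨fun e => ?_, fun e => ?_, fun e e' => h3 ?_ ?_⟩
  · rw [h1 (e.trans hc)]; ring
  · rw [h2 (e.trans hb)]; ring
  · exact fun e1 => e (e1.trans hc.symm)
  · exact fun e1 => e' (e1.trans hb.symm)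

theorem IsReflection.exists_isTransp {t : W r} (h : IsReflection t) :
    ∃ a b, a < b ∧ IsTransp a b t := by
  obtain ⟨u, s, ⟨i, hi⟩, rfl⟩ := h
  have h1 := hi.isTransp.conj u
  have hne : u.1 i ≠ u.1 (i + 1) := fun e => by simpa using u.1.injective e
  rcases lt_or_gt_of_ne hne with h2 | h2
  · exact ⟨_, _, h2, h1⟩
  · exact ⟨_, _, h2, h1.symm⟩

theorem isReflection_of_mem_simples {s : W r} (hs : s ∈ simples r) : IsReflection s :=
  ⟨1, s, hs, by simp⟩

theorem IsReflection.conj {t : W r} (h : IsReflection t) (u : W r) :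
    IsReflection (u * t * u⁻¹) := by
  obtain ⟨v, s, hs, rfl⟩ := h
  exact ⟨u * v, s, hs, by group⟩

theorem IsReflection.mul_self {t : W r} (h : IsReflection t) : t * t = 1 := by
  obtain ⟨v, s, hs, rfl⟩ := h
  calc v * s * v⁻¹ * (v * s * v⁻¹) = v * (s * s) * v⁻¹ := by group
    _ = 1 := by rw [simples_mul_self hs]; group

theorem IsReflection.inv {t : W r} (h : IsReflection t) : t⁻¹ = t :=
  inv_eq_of_mul_eq_one_left h.mul_self

/-- The reflections `t` that interchange some `a < b` with `w a > w b`. -/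
def inversions (w : W r) : Set (W r) :=
  {t | IsReflection t ∧ ∃ a, a < t.1 a ∧ w.1 (t.1 a) < w.1 a}

theorem IsTransp.mem_inversions_iff {a b : ℤ} {t : W r} (h : IsTransp a b t) (hab : a < b)
    (ht : IsReflection t) (w : W r) : t ∈ inversions w ↔ w.1 b < w.1 a := by
  constructor
  · rintro ⟨-, c, hc, hw⟩
    rw [h.lt_apply_iff hab] at hc
    obtain ⟨k, rfl⟩ := Int.modEq_iff_add_fac.1 hc.symm
    rw [apply_add_mul, apply_add_mul, apply_add_mul, h.apply_left] at hw
    linarith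
  · intro hw
    exact ⟨ht, a, by rwa [h.apply_left], by rwa [h.apply_left]⟩

/-- The cocycle rule behind all the length arguments. If `t` interchanges `a < b`, then `x * y`
reverses the pair exactly when one, but not both, of the following happens: `y` reverses `(a, b)`,
or `x` reverses the sorted pair formed by `y a` and `y b`, which belongs to `y * t * y⁻¹`. -/
theorem mem_inversions_mul {t : W r} (ht : IsReflection t) (x y : W r) :
    t ∈ inversions (x * y) ↔ Xor (y * t * y⁻¹ ∈ inversions x) (t ∈ inversions y) := by
  obtain ⟨a, b, hab, h⟩ := ht.exists_isTransp
  have hc := h.conj y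
  have hne : y.1 a ≠ y.1 b := fun e => hab.ne (y.1.injective e)
  have hne' : x.1 (y.1 a) ≠ x.1 (y.1 b) := fun e => hne (x.1.injective e)
  rw [h.mem_inversions_iff hab ht, h.mem_inversions_iff hab ht]
  rw [mul_val_apply, mul_val_apply]
  rcases lt_or_gt_of_ne hne with h1 | h1
  · rw [hc.mem_inversions_iff h1 (ht.conj y)]
    simp [Xor, h1.not_gt]
  · rw [hc.symm.mem_inversions_iff h1 (ht.conj y)]
    simp only [Xor, h1, not_true_eq_false, and_false, true_and, false_or, not_lt]
    exact ⟨le_of_lt, fun h => lt_of_le_of_ne h hne'.symm⟩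

theorem inversions_one : inversions (1 : W r) = ∅ := by
  ext t
  simp only [Set.mem_empty_iff_false, iff_false]
  rintro ⟨-, a, h1, h2⟩
  exact lt_asymm h1 h2

theorem inversions_Omega {c : W r} (hc : c ∈ Omega r) : inversions c = ∅ := by
  obtain ⟨m, hm⟩ := Omega_apply hc
  ext t
  simp only [Set.mem_empty_iff_false, iff_false]
  rintro ⟨-, a, h1, h2⟩
  rw [hm, hm] at h2
  linarith

theorem inversions_simple {s : W r} (hs : s ∈ simples r) : inversions s = {s} := by
  have hs' := isReflection_of_mem_simples hs
  obtain ⟨i, hi⟩ := hs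
  have hT := hi.isTransp
  ext t
  rw [Set.mem_singleton_iff]
  constructor
  · rintro ⟨ht, a, h1, h2⟩
    obtain ⟨a', b', hab, h⟩ := ht.exists_isTransp
    have ht' := h.of_modEq ((h.lt_apply_iff hab a).1 h1)
    have hb : ∀ j, s.1 j ≤ j + 1 ∧ j - 1 ≤ s.1 j := by
      intro j
      obtain ⟨e1, e2, e3⟩ := hi j
      by_cases c1 : j ≡ i [ZMOD r]
      · rw [e1 c1]; omega
      · by_cases c2 : j ≡ i + 1 [ZMOD r]
        · rw [e2 c2]; omega
        · rw [e3 c1 c2]; omega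
    have c1 := hb a
    have c2 := hb (t.1 a)
    -- Since `s` moves every integer by at most one, it can only reverse neighbours, and then it
    -- must interchange them.
    have h3 : t.1 a = a + 1 := by omega
    have h4 : s.1 a = a + 1 := by omega
    have h5 : a < s.1 a := by omega
    have hs2 := hT.of_modEq ((hT.lt_apply_iff (by omega) a).1 h5)
    rw [h4] at hs2
    rw [h3] at ht'
    exact ht'.unique hs2
  · rintro rfl
    rw [hT.mem_inversions_iff (by omega) hs', hT.apply_left, hT.apply_right]
    omega

end

section

variable {r : ℕ}

/-! ### The length function counts inversions -/

theorem exists_isSimple (hr : 1 < r) (i : ℤ) : ∃ s : W r, IsSimple i s := by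
  classical
  have hne : ¬ i + 1 ≡ i [ZMOD r] := by
    intro h
    have h1 := h.symm.dvd
    rw [add_sub_cancel_left] at h1
    have := Int.le_of_dvd one_pos h1
    omega
  let f : ℤ → ℤ := fun j =>
    if j ≡ i [ZMOD r] then j + 1 else if j ≡ i + 1 [ZMOD r] then j - 1 else j
  have e1 : ∀ j : ℤ, j - 1 ≡ i [ZMOD r] ↔ j ≡ i + 1 [ZMOD r] := fun j =>
    ⟨fun h => by simpa using h.add_right 1, fun h => by simpa using h.sub_right 1⟩
  have e2 : ∀ j : ℤ, j + 1 ≡ i + 1 [ZMOD r] ↔ j ≡ i [ZMOD r] := fun j =>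
    ⟨fun h => by simpa using h.sub_right 1, fun h => h.add_right 1⟩
  have hf : Function.Involutive f := by
    intro j
    simp only [f]
    by_cases c1 : j ≡ i [ZMOD r]
    · have c2 : ¬ j + 1 ≡ i [ZMOD r] := fun h => hne ((c1.add_right 1).symm.trans h)
      rw [if_pos c1, if_neg c2, if_pos ((e2 j).2 c1)]
      ring
    · by_cases c2 : j ≡ i + 1 [ZMOD r]
      · rw [if_neg c1, if_pos c2, if_pos ((e1 j).2 c2)]
        ring
      · simp [c1, c2]
  have e3 : ∀ j k : ℤ, j + r ≡ k [ZMOD r] ↔ j ≡ k [ZMOD r] := fun j k => by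
    simp [Int.ModEq]
  refine ⟨⟨hf.toPerm, ?_⟩, ?_⟩
  · intro j
    change f (j + r) = f j + r
    simp only [f, e3]
    split_ifs <;> ring
  · intro j
    change (_ → f j = _) ∧ (_ → f j = _) ∧ (_ → _ → f j = _)
    simp only [f]
    refine ⟨fun h => if_pos h, fun h => ?_, fun h h' => by simp [h, h']⟩
    rw [if_neg fun h' => hne (h.symm.trans h'), if_pos h]

/-- An increasing bijection of `ℤ` skips no value, so it is a translation. -/
theorem mem_Omega_of_apply_lt {w : W r} (hw : ∀ i, w.1 i < w.1 (i + 1)) : w ∈ Omega r := by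
  have hm : StrictMono w.1 := strictMono_int_of_lt_succ hw
  have h1 : ∀ i, w.1 (i + 1) = w.1 i + 1 := by
    intro i
    obtain ⟨j, hj⟩ := w.1.surjective (w.1 i + 1)
    have h2 : i < j := hm.lt_iff_lt.1 (by omega)
    have h3 : w.1 (i + 1) ≤ w.1 j := hm.le_iff_le.2 (by omega)
    have := hw i
    omega
  rw [Omega, Subgroup.mem_zpowers_iff]
  refine ⟨w.1 0, ext_apply fun a => ?_⟩
  have : ((rho r ^ (w.1 0) : W r) : Equiv.Perm ℤ) = Equiv.addRight (1 : ℤ) ^ (w.1 0) := rfl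
  rw [this]
  have h4 : ∀ a, w.1 a = a + w.1 0 := by
    intro a
    induction a using Int.induction_on with
    | zero => simp
    | succ n ih => rw [h1, ih]; ring
    | pred n ih =>
      have := h1 (-n - 1)
      rw [sub_add_cancel] at this
      linarith
  simp [h4 a]

theorem mul_simple_mul_simple (w : W r) {s : W r} (hs : s ∈ simples r) : w * s * s = w := by
  rw [mul_assoc, simples_mul_self hs, mul_one]

theorem simple_mul_simple_mul (w : W r) {s : W r} (hs : s ∈ simples r) : s * (s * w) = w := by
  rw [← mul_assoc, simples_mul_self hs, one_mul]

theorem simple_mul_eq_inv {w s : W r} (hs : s ∈ simples r) : s * w = (w⁻¹ * s)⁻¹ := by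
  rw [mul_inv_rev, inv_inv, simples_inv hs]

/-- By the cocycle rule, right multiplication by `s` conjugates the old inversions by `s` and
toggles `s` itself. -/
theorem inversions_mul_simple_of_notMem {w s : W r} (hs : s ∈ simples r)
    (h : s ∉ inversions w) :
    inversions (w * s) = insert s ((fun t => s * t * s) '' inversions w) := by
  have hss := simples_mul_self hs
  have hsr := isReflection_of_mem_simples hs
  ext t
  by_cases ht : IsReflection t
  · rw [mem_inversions_mul ht, inversions_simple hs, Set.mem_singleton_iff, Set.mem_insert_iff,
      simples_inv hs]
    have : t ∈ (fun t => s * t * s) '' inversions w ↔ s * t * s ∈ inversions w := by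
      have hc : ∀ t, s * (s * t * s) * s = t := fun t => by
        calc s * (s * t * s) * s = (s * s) * t * (s * s) := by group
          _ = t := by rw [hss]; simp
      constructor
      · rintro ⟨u, hu, rfl⟩
        simpa only [hc] using hu
      · intro h
        exact ⟨_, h, hc t⟩
    rw [this]
    by_cases e : t = s
    · subst e
      simp [Xor, hss, h]
    · simp [Xor, e]
  · simp only [inversions, Set.mem_ofPred_eq, ht, false_and, Set.mem_insert_iff, Set.mem_image,
      false_iff, not_or, not_exists, not_and]
    refine ⟨fun e => ht (e ▸ hsr), fun u hu e => ht (e ▸ ?_)⟩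
    simpa [simples_inv hs] using hu.1.conj s

theorem mem_inversions_mul_simple {w s : W r} (hs : s ∈ simples r) :
    s ∈ inversions (w * s) ↔ s ∉ inversions w := by
  have hss := simples_mul_self hs
  rw [mem_inversions_mul (isReflection_of_mem_simples hs), inversions_simple hs, simples_inv hs]
  simp [Xor, hss]

section NeZero

variable [NeZero r]

/-- The displacement `w a - a` is periodic in `a` with period `r`, so its absolute values over one
period bound it. -/
theorem exists_bound (w : W r) : ∃ B : ℤ, ∀ a, |w.1 a - a| ≤ B := by
  have hr : (0 : ℤ) < r := by exact_mod_cast Nat.pos_of_ne_zero (NeZero.ne r)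
  refine ⟨∑ i ∈ Finset.Ico (0 : ℤ) r, |w.1 i - i|, fun a => ?_⟩
  have h1 : w.1 a - a = w.1 (a % r) - a % r := by
    have := apply_add_mul w (a % r) (a / r)
    rw [Int.emod_add_mul_ediv] at this
    have h2 := Int.emod_add_mul_ediv a r
    linarith
  rw [h1]
  refine Finset.single_le_sum (f := fun i => |w.1 i - i|) (fun i _ => abs_nonneg _) ?_
  rw [Finset.mem_Ico]
  exact ⟨Int.emod_nonneg _ hr.ne', Int.emod_lt_of_pos _ hr⟩

/-- A translate puts the smaller point `a` of a reversed pair into `[0, r]`. If `w` moves points by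
at most `B`, then `w (t a) < w a` forces `t a < a + 2 B`, so only finitely many pairs remain, and a
pair determines its reflection. -/
theorem finite_inversions (w : W r) : (inversions w).Finite := by
  have hr : (0 : ℤ) < r := by exact_mod_cast Nat.pos_of_ne_zero (NeZero.ne r)
  obtain ⟨B, hB⟩ := exists_bound w
  have key : ∀ t ∈ inversions w, ∃ a, a ∈ Set.Icc 0 (r : ℤ) ∧ t.1 a ∈ Set.Icc 0 (r + 2 * B) ∧
      IsTransp a (t.1 a) t := by
    rintro t ⟨ht, a, h1, h2⟩
    obtain ⟨a', b', hab, h⟩ := ht.exists_isTransp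
    have h0 : a % r ≡ a [ZMOD r] := Int.mod_modEq _ _
    have h3 := h.of_modEq (h0.trans ((h.lt_apply_iff hab a).1 h1))
    have h4 := Int.emod_nonneg a hr.ne'
    have h5 := Int.emod_lt_of_pos a hr
    have h6 : t.1 a - a = t.1 (a % r) - a % r := by
      have := apply_add_mul t (a % r) (a / r)
      rw [Int.emod_add_mul_ediv] at this
      have h2 := Int.emod_add_mul_ediv a r
      linarith
    have h7 := abs_le.1 (hB a)
    have h8 := abs_le.1 (hB (t.1 a))
    refine ⟨a % r, ⟨h4, h5.le⟩, ⟨?_, ?_⟩, h3⟩ <;> linarith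
  choose! f hf1 hf2 hf3 using key
  refine Set.Finite.of_injOn (f := fun t => (f t, t.1 (f t)))
    (t := Set.Icc 0 (r : ℤ) ×ˢ Set.Icc 0 (r + 2 * B)) (fun t ht => ⟨hf1 t ht, hf2 t ht⟩) ?_
    ((Set.finite_Icc _ _).prod (Set.finite_Icc _ _))
  intro t ht t' ht' e
  rw [Prod.mk.injEq] at e
  have h1 := hf3 t ht
  have h2 := hf3 t' ht'
  rw [← e.2, ← e.1] at h2
  exact h1.unique h2

theorem ncard_inversions_mul_simple {w s : W r} (hs : s ∈ simples r) (h : s ∉ inversions w) :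
    (inversions (w * s)).ncard = (inversions w).ncard + 1 := by
  have hss := simples_mul_self hs
  have hsr := isReflection_of_mem_simples hs
  rw [inversions_mul_simple_of_notMem hs h, Set.ncard_insert_of_notMem _
    ((finite_inversions w).image _), Set.ncard_image_of_injective]
  · intro a b e
    simpa using e
  · rintro ⟨u, hu, e⟩
    have : u = s := by
      have e' : s * (s * u * s) * s = s * s * s := congrArg (fun x => s * x * s) e
      rw [show s * (s * u * s) * s = (s * s) * u * (s * s) by group, hss] at e'
      simpa using e'
    exact h (this ▸ hu)

theorem ncard_inversions_mul_simple_of_mem {w s : W r} (hs : s ∈ simples r)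
    (h : s ∈ inversions w) : (inversions w).ncard = (inversions (w * s)).ncard + 1 := by
  have h1 : s ∉ inversions (w * s) := by rwa [mem_inversions_mul_simple hs, not_not]
  have := ncard_inversions_mul_simple hs h1
  rwa [mul_assoc, simples_mul_self hs, mul_one] at this

/-- Without a descent at neighbouring integers `w` would be increasing, hence a translation. -/
theorem exists_simple_mem_inversions {w : W r} (hw : w ∉ Omega r) :
    ∃ s ∈ simples r, s ∈ inversions w := by
  obtain ⟨i, hi⟩ : ∃ i, w.1 (i + 1) < w.1 i := by
    by_contra! h
    refine hw (mem_Omega_of_apply_lt fun i => lt_of_le_of_ne (h i) fun e => ?_)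
    simpa using w.1.injective e
  -- For `r = 1` every element is a translation, so the descent just found excludes this case.
  have hr : 1 < r := by
    have h0 := NeZero.ne r
    by_contra h
    obtain rfl : r = 1 := by omega
    have := w.2 i
    push_cast at this
    omega
  obtain ⟨s, hs⟩ := exists_isSimple hr i
  exact ⟨s, ⟨i, hs⟩, (hs.isTransp.mem_inversions_iff (by omega)
    (isReflection_of_mem_simples ⟨i, hs⟩) w).2 hi⟩

theorem HasWord.ncard_inversions_le {w : W r} {k : ℕ} (h : HasWord w k) :
    (inversions w).ncard ≤ k := by
  obtain ⟨c, hc, L, hL, rfl, rfl⟩ := h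
  induction L using List.reverseRecOn with
  | nil => simp [inversions_Omega hc]
  | append_singleton L s ih =>
    have hs : s ∈ simples r := hL s (by simp)
    have h1 := ih fun x hx => hL x (by simp [hx])
    rw [List.prod_append, List.prod_singleton, ← mul_assoc, List.length_append,
      List.length_singleton]
    by_cases h : s ∈ inversions (c * L.prod)
    · have := ncard_inversions_mul_simple_of_mem hs h
      omega
    · rw [ncard_inversions_mul_simple hs h]
      omega

theorem hasWord_ncard_inversions (w : W r) : HasWord w (inversions w).ncard := by
  obtain ⟨k, hk⟩ : ∃ k, (inversions w).ncard = k := ⟨_, rfl⟩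
  rw [hk]
  induction k generalizing w with
  | zero =>
    refine ⟨w, ?_, [], by simp, rfl, by simp⟩
    by_contra hw
    obtain ⟨s, -, hs⟩ := exists_simple_mem_inversions hw
    rw [Set.ncard_eq_zero (finite_inversions w)] at hk
    simp [hk] at hs
  | succ k ih =>
    have hw : w ∉ Omega r := by
      intro h
      simp [inversions_Omega h] at hk
    obtain ⟨s, hs, hsw⟩ := exists_simple_mem_inversions hw
    have h1 := ncard_inversions_mul_simple_of_mem hs hsw
    have h2 := (ih (w * s) (by omega)).mul_simple hs
    rwa [mul_assoc, simples_mul_self hs, mul_one] at h2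

/-- A letter changes the number of inversions by exactly one, so no word is shorter than that
number. Removing simple inversions until an element of `Ω` remains produces a word that attains it.
-/
theorem len_eq (w : W r) : len w = (inversions w).ncard :=
  le_antisymm (Nat.sInf_le (hasWord_ncard_inversions w))
    (HasWord.ncard_inversions_le
      (Nat.sInf_mem (s := {k | HasWord w k}) ⟨_, hasWord_ncard_inversions w⟩))

theorem mem_Omega_of_len_eq_zero {w : W r} (h : len w = 0) : w ∈ Omega r := by
  by_contra hw
  obtain ⟨s, -, hs⟩ := exists_simple_mem_inversions hw
  rw [len_eq, Set.ncard_eq_zero (finite_inversions w)] at h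
  simp [h] at hs

theorem len_Omega_mul {c : W r} (hc : c ∈ Omega r) (w : W r) : len (c * w) = len w := by
  rw [len_eq, len_eq]
  congr 1
  ext t
  by_cases ht : IsReflection t
  · rw [mem_inversions_mul ht, inversions_Omega hc]
    simp [Xor]
  · simp [inversions, ht]

theorem len_mul_Omega {c : W r} (hc : c ∈ Omega r) (w : W r) : len (w * c) = len w := by
  rw [← len_inv, mul_inv_rev, len_Omega_mul (inv_mem hc), len_inv]

theorem len_mul_simple_of_notMem {w s : W r} (hs : s ∈ simples r) (h : s ∉ inversions w) :
    len (w * s) = len w + 1 := by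
  rw [len_eq, len_eq, ncard_inversions_mul_simple hs h]

theorem len_mul_simple_of_mem {w s : W r} (hs : s ∈ simples r) (h : s ∈ inversions w) :
    len w = len (w * s) + 1 := by
  rw [len_eq, len_eq, ncard_inversions_mul_simple_of_mem hs h]

theorem len_mul_simple (w : W r) {s : W r} (hs : s ∈ simples r) :
    len (w * s) = len w + 1 ∨ len w = len (w * s) + 1 := by
  by_cases h : s ∈ inversions w
  · exact Or.inr (len_mul_simple_of_mem hs h)
  · exact Or.inl (len_mul_simple_of_notMem hs h)

theorem len_mul_simple_eq_iff {w s : W r} (hs : s ∈ simples r) :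
    len w = len (w * s) + 1 ↔ s ∈ inversions w := by
  refine ⟨fun h => ?_, len_mul_simple_of_mem hs⟩
  by_contra h'
  have := len_mul_simple_of_notMem hs h'
  omega

theorem len_mul_simple_lt_iff {w s : W r} (hs : s ∈ simples r) :
    len (w * s) < len w ↔ s ∈ inversions w := by
  rw [← len_mul_simple_eq_iff hs]
  have := len_mul_simple w hs
  omega

theorem len_simple_mul (w : W r) {s : W r} (hs : s ∈ simples r) :
    len (s * w) = len w + 1 ∨ len w = len (s * w) + 1 := by
  rw [simple_mul_eq_inv hs, len_inv, ← len_inv w]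
  exact len_mul_simple _ hs

/-- Strong exchange. Write `w = v s` with `v` shorter. For `t = s` the product is `v`; otherwise `s
t s` is an inversion of `v`, so `v (s t s)` is shorter than `v` by induction, and `w t = v (s t s)
s` is at most one longer than that. -/
theorem len_mul_lt_of_mem {w t : W r} (h : t ∈ inversions w) : len (w * t) < len w := by
  obtain ⟨k, hk⟩ : ∃ k, len w = k := ⟨_, rfl⟩
  induction k generalizing w t with
  | zero =>
    rw [inversions_Omega (mem_Omega_of_len_eq_zero hk)] at h
    simp at h
  | succ k ih =>
    obtain ⟨v, s, hs, rfl, hv⟩ := exists_descent hk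
    rw [mem_inversions_mul h.1, inversions_simple hs, Set.mem_singleton_iff, simples_inv hs] at h
    by_cases e : t = s
    · subst e
      rw [mul_simple_mul_simple _ hs]
      omega
    · simp only [Xor, e, not_false_eq_true, and_true, false_and, or_false] at h
      have h1 := ih h hv
      have h2 : v * s * t = v * (s * t * s) * s := by
        simp only [mul_assoc, simples_mul_self hs, mul_one]
      rw [h2]
      have := len_mul_simple (v * (s * t * s)) hs
      omega

theorem len_lt_of_notMem {w t : W r} (ht : IsReflection t) (h : t ∉ inversions w) :
    len w < len (w * t) := by
  have h1 : t ∈ inversions (w * t) := by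
    obtain ⟨a, b, hab, hT⟩ := ht.exists_isTransp
    rw [hT.mem_inversions_iff hab ht] at h ⊢
    rw [mul_val_apply, mul_val_apply, hT.apply_left, hT.apply_right]
    exact lt_of_le_of_ne (not_lt.1 h) fun e => hab.ne (w.1.injective e)
  have h2 := len_mul_lt_of_mem h1
  rwa [mul_assoc, ht.mul_self, mul_one] at h2

theorem mem_inversions_iff_len {w t : W r} (ht : IsReflection t) :
    t ∈ inversions w ↔ len (w * t) < len w := by
  refine ⟨len_mul_lt_of_mem, fun h => ?_⟩
  by_contra h'
  have := len_lt_of_notMem ht h'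
  omega

/-- If `s w > w` and `w s' > w`, but `s w s' < s w`, then `s w = w s'`. -/
theorem simple_mul_eq_mul_simple {w s s' : W r} (hs : s ∈ simples r) (hs' : s' ∈ simples r)
    (h2 : len (w * s') = len w + 1) (h3 : len (s * w * s') < len (s * w)) :
    s * w = w * s' := by
  have hm : s' ∉ inversions w := by
    rw [← len_mul_simple_lt_iff hs']
    omega
  rw [len_mul_simple_lt_iff hs', mem_inversions_mul (isReflection_of_mem_simples hs')] at h3
  simp only [Xor, hm, inversions_simple hs, Set.mem_singleton_iff, not_false_eq_true, and_true,
    false_and, or_false] at h3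
  rw [← h3]
  group

end NeZero

end

section

variable {r : ℕ}

/-! ### The Bruhat order -/

theorem BruhatLE.len_le {y w : W r} (h : BruhatLE y w) : len y ≤ len w := by
  induction h with
  | refl => rfl
  | tail _ h ih =>
    obtain ⟨_, _, _, h⟩ := h
    omega

theorem BruhatLE.len_lt {y w : W r} (h : BruhatLE y w) (hne : y ≠ w) : len y < len w := by
  rcases Relation.ReflTransGen.cases_tail h with h | ⟨z, h1, t, -, -, h2⟩
  · exact absurd h.symm hne
  · have := BruhatLE.len_le h1
    omega

theorem BruhatLE.refl (w : W r) : BruhatLE w w := Relation.ReflTransGen.refl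

theorem BruhatLE.trans {x y z : W r} (h : BruhatLE x y) (h' : BruhatLE y z) : BruhatLE x z :=
  Relation.ReflTransGen.trans h h'

/-- The order is defined by right multiplication; conjugating a reflection turns it into left
multiplication. -/
theorem BruhatLE.inv {y w : W r} (h : BruhatLE y w) : BruhatLE y⁻¹ w⁻¹ := by
  induction h with
  | refl => exact BruhatLE.refl _
  | tail _ h ih =>
    obtain ⟨t, ht, rfl, hl⟩ := h
    rename_i x _
    refine ih.tail ⟨x * t * x⁻¹, ht.conj x, ?_, by rwa [len_inv, len_inv]⟩
    rw [mul_inv_rev, ht.inv]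
    group

theorem bruhatLE_mul_simple {w s : W r} (hs : s ∈ simples r) (h : len w < len (w * s)) :
    BruhatLE w (w * s) :=
  Relation.ReflTransGen.single ⟨s, isReflection_of_mem_simples hs, rfl, h⟩

variable {J K : Set (W r)}

/-- Induction on the generation of `u`: the cocycle rule only conjugates inversions by elements of
the parabolic subgroup. -/
theorem inversions_subset_closure (hJ : J ⊆ simples r) {u : W r}
    (hu : u ∈ Subgroup.closure J) : inversions u ⊆ Subgroup.closure J := by
  induction hu using Subgroup.closure_induction with
  | mem s hs =>
    rw [inversions_simple (hJ hs), Set.singleton_subset_iff]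
    exact Subgroup.subset_closure hs
  | one => simp [inversions_one]
  | mul x y hx hy ihx ihy =>
    intro t ht
    rw [mem_inversions_mul ht.1] at ht
    rcases ht with ⟨h, -⟩ | ⟨h, -⟩
    · have h1 := mul_mem (mul_mem (inv_mem hy) (ihx h)) hy
      simpa [mul_assoc] using h1
    · exact ihy h
  | inv x hx ih =>
    intro t ht
    have h := mem_inversions_mul ht.1 x x⁻¹
    simp only [mul_inv_cancel, inversions_one, Set.mem_empty_iff_false, ht, Xor, not_true_eq_false,
      and_false, true_and, false_or, inv_inv, false_iff, not_not] at h
    have h1 := mul_mem (mul_mem hx (ih h)) (inv_mem hx)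
    simpa [mul_assoc] using h1

section NeZero

variable [NeZero r]

/-- The last step of a chain ending in `w` comes from some `w t` with `t` an inversion of `w`. There
are finitely many of these, all shorter. This makes the sum defining `C'_w` a genuine finite sum. -/
theorem finite_bruhatLE (w : W r) : {y | BruhatLE y w}.Finite := by
  obtain ⟨k, hk⟩ : ∃ k, len w = k := ⟨_, rfl⟩
  induction k using Nat.strong_induction_on generalizing w with
  | _ k ih =>
    have hsub : {y | BruhatLE y w} ⊆
        {w} ∪ ⋃ t ∈ inversions w, {y | BruhatLE y (w * t)} := by
      intro y hy
      rcases Relation.ReflTransGen.cases_tail hy with h | ⟨z, h1, t, ht, rfl, h2⟩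
      · exact Or.inl h.symm
      · refine Or.inr ?_
        have e : z * t * t = z := by rw [mul_assoc, ht.mul_self, mul_one]
        simp only [Set.mem_iUnion]
        refine ⟨t, ?_, ?_⟩
        · rw [mem_inversions_iff_len ht, e]
          exact h2
        · rw [e]
          exact h1
    refine Set.Finite.subset ((Set.finite_singleton w).union
      ((finite_inversions w).biUnion fun t ht => ?_)) hsub
    exact ih _ (hk ▸ len_mul_lt_of_mem ht) _ rfl

/-- The lifting property, by induction on a chain from `y` up to `w`. -/
theorem BruhatLE.mul_simple {y w s : W r} (h : BruhatLE y w) (hs : s ∈ simples r) :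
    BruhatLE (y * s) w ∨ BruhatLE (y * s) (w * s) := by
  have hsr := isReflection_of_mem_simples hs
  induction h using Relation.ReflTransGen.head_induction_on with
  | refl => exact Or.inr (BruhatLE.refl _)
  | head h1 h2 ih =>
    obtain ⟨t, ht, rfl, hl⟩ := h1
    rename_i x
    by_cases e : t = s
    · subst e
      exact Or.inl h2
    by_cases hx : s ∈ inversions x
    · left
      have h3 := len_mul_simple_of_mem hs hx
      refine BruhatLE.trans ?_ (Relation.ReflTransGen.head ⟨t, ht, rfl, hl⟩ h2)
      exact Relation.ReflTransGen.single ⟨s, hsr, (mul_simple_mul_simple x hs).symm, by omega⟩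
    -- As `x s > x` and `t ≠ s`, the reflection `s t s` is an inversion of `x s` only if `t` is one
    -- of `x`, which `x < x t` excludes. Hence `x s < x s (s t s) = x t s`.
    · have h3 : BruhatLE (x * s) (x * t * s) := by
        have hc := ht.conj s
        rw [simples_inv hs] at hc
        have h4 : x * t * s = x * s * (s * t * s) := by
          rw [← mul_assoc, ← mul_assoc, mul_simple_mul_simple x hs]
        refine Relation.ReflTransGen.single ⟨s * t * s, hc, h4, ?_⟩
        rw [h4]
        refine len_lt_of_notMem hc ?_
        have h5 : s * (s * t * s) * s = t := by
          rw [mul_assoc s t s, simple_mul_simple_mul _ hs, mul_simple_mul_simple _ hs]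
        have h6 : s * t * s ≠ s := by
          intro e'
          rw [e', simples_mul_self hs, one_mul] at h5
          exact e h5.symm
        rw [mem_inversions_mul hc, inversions_simple hs, simples_inv hs, h5,
          Set.mem_singleton_iff, mem_inversions_iff_len ht]
        simp only [Xor, h6, not_false_eq_true, and_true, false_and, or_false]
        omega
      exact ih.imp h3.trans h3.trans

theorem BruhatLE.mul_simple_of_lt {y w s : W r} (h : BruhatLE y w) (hs : s ∈ simples r)
    (hw : len w < len (w * s)) : BruhatLE (y * s) (w * s) :=
  (h.mul_simple hs).elim (fun h => h.trans (bruhatLE_mul_simple hs hw)) id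

/-! ### Parabolic subgroups -/

/-- Parabolic subgroups are lower sets: in a step `x < x t`, the reflection `t` is an inversion of
`x t`, hence lies in the subgroup as soon as `x t` does. -/
theorem BruhatLE.mem_closure (hJ : J ⊆ simples r) {y w : W r} (h : BruhatLE y w)
    (hw : w ∈ Subgroup.closure J) : y ∈ Subgroup.closure J := by
  induction h using Relation.ReflTransGen.head_induction_on with
  | refl => exact hw
  | head h1 h2 ih =>
    obtain ⟨t, ht, rfl, hl⟩ := h1
    rename_i x
    have h3 : t ∈ inversions (x * t) := by
      rw [mem_inversions_iff_len ht, mul_assoc, ht.mul_self, mul_one]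
      exact hl
    have h4 := mul_mem ih (inversions_subset_closure hJ ih h3)
    rwa [mul_assoc, ht.mul_self, mul_one] at h4

/-- By the cocycle rule the inversions of `x u` are those of `u` together with the `u`-conjugates of
those of `x`. The first lie in the parabolic subgroup and the second do not, so there is no
cancellation. -/
theorem len_mul_of_disjoint (hJ : J ⊆ simples r) {x u : W r}
    (hx : ∀ t ∈ inversions x, t ∉ Subgroup.closure J) (hu : u ∈ Subgroup.closure J) :
    len (x * u) = len x + len u := by
  have h1 : inversions (x * u) = (fun t => u⁻¹ * t * u) '' inversions x ∪ inversions u := by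
    ext t
    have him : t ∈ (fun t => u⁻¹ * t * u) '' inversions x ↔ u * t * u⁻¹ ∈ inversions x := by
      constructor
      · rintro ⟨t, ht, rfl⟩
        simpa [mul_assoc] using ht
      · intro h
        exact ⟨_, h, by simp [mul_assoc]⟩
    rw [Set.mem_union, him]
    by_cases ht : IsReflection t
    · rw [mem_inversions_mul ht]
      have : u * t * u⁻¹ ∈ inversions x → t ∉ inversions u := fun h h' =>
        hx _ h (mul_mem (mul_mem hu (inversions_subset_closure hJ hu h')) (inv_mem hu))
      unfold Xor
      tauto
    · refine iff_of_false (fun h => ht h.1) ?_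
      rintro (h | h)
      · exact ht (by simpa [mul_assoc] using h.1.conj u⁻¹)
      · exact ht h.1
  rw [len_eq, h1, Set.ncard_union_eq _ ((finite_inversions x).image _) (finite_inversions u),
    Set.ncard_image_of_injective, ← len_eq, ← len_eq]
  · intro a b e
    simpa using e
  · rw [Set.disjoint_left]
    rintro _ ⟨t, ht, rfl⟩ h
    refine hx t ht ?_
    have := mul_mem (mul_mem hu (inversions_subset_closure hJ hu h)) (inv_mem hu)
    simpa [mul_assoc] using this

theorem len_mul_of_disjoint' (hJ : J ⊆ simples r) {x u : W r}
    (hx : ∀ t ∈ inversions x⁻¹, t ∉ Subgroup.closure J) (hu : u ∈ Subgroup.closure J) :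
    len (u * x) = len u + len x := by
  rw [← len_inv, mul_inv_rev, len_mul_of_disjoint hJ hx (inv_mem hu), len_inv, len_inv, add_comm]

/-- A double coset contains at most one element without descents in the two parabolic
subgroups. -/
theorem eq_of_disjoint (hJ : J ⊆ simples r) (hK : K ⊆ simples r)
    (hJ0 : ∀ u ∈ Subgroup.closure J, len u = 0 → u = 1)
    (hK0 : ∀ u ∈ Subgroup.closure K, len u = 0 → u = 1) {w w' : W r}
    (hw : ∀ t ∈ inversions w, t ∉ Subgroup.closure K)
    (hw' : ∀ t ∈ inversions w', t ∉ Subgroup.closure K)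
    (hwi : ∀ t ∈ inversions w⁻¹, t ∉ Subgroup.closure J)
    (hwi' : ∀ t ∈ inversions w'⁻¹, t ∉ Subgroup.closure J)
    {u v : W r} (hu : u ∈ Subgroup.closure J) (hv : v ∈ Subgroup.closure K)
    (h : w' * v = u * w) : w = w' := by
  obtain ⟨k, hk⟩ : ∃ k, len v = k := ⟨_, rfl⟩
  have base : ∀ {u}, u ∈ Subgroup.closure J → w' = u * w → w = w' := by
    intro u hu h
    have h1 := len_mul_of_disjoint' hJ hwi hu
    have h2 := len_mul_of_disjoint' hJ hwi' (inv_mem hu)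
    rw [← h] at h1
    rw [h, inv_mul_cancel_left, ← h] at h2
    have h3 := hJ0 u hu (by omega)
    rw [h, h3, one_mul]
  induction k generalizing u v with
  | zero =>
    rw [hK0 v hv hk, mul_one] at h
    exact base hu h
  | succ k ih =>
    obtain ⟨v', s, hs, rfl, hv'⟩ := exists_descent hk
    have hsK : s ∈ Subgroup.closure K := by
      refine inversions_subset_closure hK hv ?_
      rw [mem_inversions_iff_len (isReflection_of_mem_simples hs), mul_simple_mul_simple _ hs]
      omega
    have hvK : v' ∈ Subgroup.closure K := by
      simpa [mul_simple_mul_simple _ hs] using mul_mem hv hsK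
    have h1 : s ∈ inversions (u * w) := by
      rw [mem_inversions_iff_len (isReflection_of_mem_simples hs), ← h,
        len_mul_of_disjoint hK hw' hv, mul_assoc, mul_simple_mul_simple _ hs,
        len_mul_of_disjoint hK hw' hvK]
      omega
    rw [mem_inversions_mul (isReflection_of_mem_simples hs)] at h1
    -- The last letter `s` of `v` is an inversion of `u w` but not of `w`, so it comes from `u`. It
    -- therefore moves across: `w' v' = (u · w s w⁻¹) w` with a shorter `v'`.
    have h2 : w * s * w⁻¹ ∈ inversions u := by
      rcases h1 with ⟨h1, -⟩ | ⟨h1, -⟩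
      · exact h1
      · exact absurd hsK (hw s h1)
    refine ih (mul_mem hu (inversions_subset_closure hJ hu h2)) hvK ?_ hv'
    rw [← mul_simple_mul_simple (w' * v') hs, mul_assoc w' v' s, h]
    group

end NeZero

end

section

variable {r n : ℕ}

/-! ### Young subgroups and their double cosets -/

theorem youngGens_subset (lam : Comp n r) : youngGens lam ⊆ simples r := by
  rintro s ⟨i, -, -, -, hs⟩
  exact ⟨i, hs⟩

/-- The generators `s_i` with `1 ≤ i < r` permute the window `1, …, r`. Since an element of `W` is
determined by its values there, a Young subgroup is finite and contains no nontrivial translation.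
-/
theorem young_mapsTo {lam : Comp n r} {u : W r} (hu : u ∈ young lam) :
    Set.MapsTo u.1 (Set.Icc 1 (r : ℤ)) (Set.Icc 1 (r : ℤ)) := by
  have h : ∀ u ∈ young lam, ∀ j ∈ Set.Icc 1 (r : ℤ), u.1 j ∈ Set.Icc 1 (r : ℤ) := by
    intro u hu
    have hs : ∀ s ∈ youngGens lam, ∀ j ∈ Set.Icc 1 (r : ℤ), s.1 j ∈ Set.Icc 1 (r : ℤ) := by
      rintro s ⟨i, h1, h2, -, hs⟩ j ⟨h3, h4⟩
      have key : ∀ k : ℤ, 1 ≤ k → k ≤ r → j ≡ k [ZMOD r] → j = k := by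
        intro k h5 h6 h
        have h7 := Int.emod_emod_of_dvd (j - 1) (dvd_refl (r : ℤ))
        have h8 : (j - 1) % r = (k - 1) % r := (h.sub_right 1)
        rw [Int.emod_eq_of_lt (by omega) (by omega),
          Int.emod_eq_of_lt (by omega) (by omega)] at h8
        omega
      obtain ⟨e1, e2, e3⟩ := hs j
      by_cases c1 : j ≡ i [ZMOD r]
      · have := key i (by omega) (by omega) c1
        rw [e1 c1]
        constructor <;> omega
      · by_cases c2 : j ≡ i + 1 [ZMOD r]
        · have := key (i + 1) (by omega) (by omega) c2
          rw [e2 c2]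
          constructor <;> omega
        · rw [e3 c1 c2]
          exact ⟨h3, h4⟩
    induction hu using Subgroup.closure_induction'' with
    | mem s h => exact hs s h
    | inv_mem s h => rw [simples_inv (youngGens_subset lam h)]; exact hs s h
    | one => intro j hj; exact hj
    | mul x y _ _ hx hy => intro j hj; exact hx _ (hy _ hj)
  exact h u hu

theorem young_ext {lam : Comp n r} [NeZero r] {u v : W r}
    (h : ∀ j ∈ Set.Icc 1 (r : ℤ), u.1 j = v.1 j) : u = v := by
  have hr : (0 : ℤ) < r := by exact_mod_cast Nat.pos_of_ne_zero (NeZero.ne r)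
  refine ext_apply fun a => ?_
  have h1 : a = ((a - 1) % r + 1) + r * ((a - 1) / r) := by
    have := Int.emod_add_mul_ediv (a - 1) r
    linarith
  have h2 := Int.emod_nonneg (a - 1) hr.ne'
  have h3 := Int.emod_lt_of_pos (a - 1) hr
  rw [h1, apply_add_mul, apply_add_mul, h _ ⟨by omega, by omega⟩]

variable [NeZero r]

theorem finite_young (lam : Comp n r) : (young lam : Set (W r)).Finite := by
  have : Finite (Set.Icc 1 (r : ℤ)) := Set.finite_Icc _ _
  let f : (young lam) → (Set.Icc 1 (r : ℤ) → Set.Icc 1 (r : ℤ)) :=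
    fun u j => ⟨u.1.1 j, young_mapsTo u.2 j.2⟩
  have hf : Function.Injective f := by
    intro u v e
    refine Subtype.ext (young_ext (lam := lam) fun j hj => ?_)
    exact congrArg Subtype.val (congrFun e ⟨j, hj⟩)
  exact Finite.of_injective f hf

theorem eq_one_of_mem_young {lam : Comp n r} {u : W r} (hu : u ∈ young lam) (h : len u = 0) :
    u = 1 := by
  have hr : (0 : ℤ) < r := by exact_mod_cast Nat.pos_of_ne_zero (NeZero.ne r)
  obtain ⟨a, ha⟩ := Omega_apply (mem_Omega_of_len_eq_zero h)
  have h1 := young_mapsTo hu (x := 1) ⟨le_rfl, by omega⟩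
  have h2 := young_mapsTo hu (x := r) ⟨by omega, le_rfl⟩
  rw [ha] at h1 h2
  have : a = 0 := by
    have := h1.1
    have := h2.2
    omega
  exact ext_apply fun j => by rw [ha, this]; simp

variable {lam mu : Comp n r}

omit [NeZero r] in
theorem mem_dcoset {w x : W r} :
    x ∈ dcoset lam w mu ↔ ∃ u ∈ young lam, ∃ v ∈ young mu, x = u * w * v :=
  DoubleCoset.mem_doubleCoset

omit [NeZero r] in
theorem self_mem_dcoset (w : W r) : w ∈ dcoset lam w mu :=
  DoubleCoset.mem_doubleCoset_self _ _ _

omit [NeZero r] in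
theorem dcoset_eq {w x : W r} (h : x ∈ dcoset lam w mu) : dcoset lam x mu = dcoset lam w mu :=
  DoubleCoset.doubleCoset_eq_of_mem h

theorem finite_dcoset (lam : Comp n r) (w : W r) (mu : Comp n r) : (dcoset lam w mu).Finite := by
  have := ((finite_young lam).mul (Set.finite_singleton w)).mul (finite_young mu)
  exact this

omit [NeZero r] in
theorem mul_mem_dcoset {w x v : W r} (hx : x ∈ dcoset lam w mu) (hv : v ∈ young mu) :
    x * v ∈ dcoset lam w mu := by
  obtain ⟨u, hu, v', hv', rfl⟩ := mem_dcoset.1 hx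
  exact mem_dcoset.2 ⟨u, hu, v' * v, mul_mem hv' hv, by group⟩

omit [NeZero r] in
theorem mem_dcoset_mul {w x u : W r} (hx : x ∈ dcoset lam w mu) (hu : u ∈ young lam) :
    u * x ∈ dcoset lam w mu := by
  obtain ⟨u', hu', v, hv, rfl⟩ := mem_dcoset.1 hx
  exact mem_dcoset.2 ⟨u * u', mul_mem hu hu', v, hv, by group⟩

theorem exists_isMin (lam : Comp n r) (w : W r) (mu : Comp n r) :
    ∃ z ∈ dcoset lam w mu, IsMin lam z mu := by
  obtain ⟨z, hz, h⟩ := Set.exists_min_image _ len (finite_dcoset lam w mu)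
    ⟨w, self_mem_dcoset w⟩
  exact ⟨z, hz, fun x hx => h x (by rwa [dcoset_eq hz] at hx)⟩

/-- An inversion of a minimal element lying in `W_μ`, or one of its inverse lying in `W_λ`, would
shorten it within the double coset. With no such inversions, `eq_of_disjoint` applies. -/
theorem IsMin.unique {z z' : W r} (hz : IsMin lam z mu) (hz' : IsMin lam z' mu)
    (h : z' ∈ dcoset lam z mu) : z' = z := by
  have key : ∀ z, IsMin lam z mu → (∀ t ∈ inversions z, t ∉ young mu) ∧
      (∀ t ∈ inversions z⁻¹, t ∉ young lam) := by
    intro z hz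
    constructor
    · intro t ht h
      have h1 := hz _ (mul_mem_dcoset (self_mem_dcoset z) h)
      have h2 := len_mul_lt_of_mem ht
      omega
    · intro t ht h
      have h1 := hz _ (mem_dcoset_mul (self_mem_dcoset z) (inv_mem h))
      have h2 := len_mul_lt_of_mem ht
      rw [← len_inv, mul_inv_rev, inv_inv, len_inv z] at h2
      omega
  obtain ⟨u, hu, v, hv, e⟩ := mem_dcoset.1 h
  symm
  refine eq_of_disjoint (youngGens_subset lam) (youngGens_subset mu)
    (fun u => eq_one_of_mem_young) (fun u => eq_one_of_mem_young) (key z hz).1 (key z' hz').1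
    (key z hz).2 (key z' hz').2 hu (inv_mem hv) ?_
  rw [e, mul_inv_cancel_right]

omit [NeZero r] in
theorem longest_spec {D : Set (W r)} (hD : D.Finite) (hne : D.Nonempty) :
    longest D ∈ D ∧ ∀ y ∈ D, len y ≤ len (longest D) := by
  have h : ∃ x ∈ D, ∀ y ∈ D, len y ≤ len x := Set.exists_max_image D len hD hne
  unfold longest
  rw [dif_pos h]
  exact h.choose_spec

theorem wzero_mem (lam : Comp n r) : wzero lam ∈ young lam :=
  (longest_spec (finite_young lam) ⟨1, one_mem _⟩).1

theorem len_le_wzero {u : W r} (hu : u ∈ young lam) : len u ≤ len (wzero lam) :=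
  (longest_spec (finite_young lam) ⟨1, one_mem _⟩).2 u hu

theorem Triple.wplus_mem (B : Triple n r) : B.wplus ∈ dcoset B.lam B.w B.mu :=
  (longest_spec (finite_dcoset B.lam B.w B.mu) ⟨B.w, self_mem_dcoset _⟩).1

theorem Triple.len_le_wplus (B : Triple n r) {x : W r} (hx : x ∈ dcoset B.lam B.w B.mu) :
    len x ≤ len B.wplus :=
  (longest_spec (finite_dcoset B.lam B.w B.mu) ⟨B.w, self_mem_dcoset _⟩).2 x hx

end

section

variable {r : ℕ}

/-! ### The regular representation and the standard basis of the Hecke algebra -/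

/-- The operator `T_s ·` of the left regular representation. -/
def leftOp (s : W r) : Module.End Laurent (W r →₀ Laurent) :=
  Finsupp.linearCombination Laurent fun w =>
    if len w < len (s * w) then Finsupp.single (s * w) 1
    else q • Finsupp.single (s * w) 1 + (q - 1) • Finsupp.single w 1

/-- The operator `· T_s` of the right regular representation. -/
def rightOp (s : W r) : Module.End Laurent (W r →₀ Laurent) :=
  Finsupp.linearCombination Laurent fun w =>
    if len w < len (w * s) then Finsupp.single (w * s) 1
    else q • Finsupp.single (w * s) 1 + (q - 1) • Finsupp.single w 1

/-- The operator `T_c ·` for `c` of length `0`. -/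
def leftShift (c : W r) : Module.End Laurent (W r →₀ Laurent) :=
  Finsupp.lmapDomain Laurent Laurent (c * ·)

/-- The operator `· T_c` for `c` of length `0`. -/
def rightShift (c : W r) : Module.End Laurent (W r →₀ Laurent) :=
  Finsupp.lmapDomain Laurent Laurent (· * c)

theorem leftShift_single (c w : W r) :
    leftShift c (Finsupp.single w 1) = Finsupp.single (c * w) 1 := by
  simp [leftShift]

theorem rightShift_single (c w : W r) :
    rightShift c (Finsupp.single w 1) = Finsupp.single (w * c) 1 := by
  simp [rightShift]

theorem leftOp_of_lt {s w : W r} (h : len w < len (s * w)) :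
    leftOp s (Finsupp.single w 1) = Finsupp.single (s * w) 1 := by
  simp [leftOp, h]

theorem leftOp_of_gt {s w : W r} (h : len (s * w) < len w) :
    leftOp s (Finsupp.single w 1) =
      q • Finsupp.single (s * w) 1 + (q - 1) • Finsupp.single w 1 := by
  simp [leftOp, h.not_gt]

theorem rightOp_of_lt {s w : W r} (h : len w < len (w * s)) :
    rightOp s (Finsupp.single w 1) = Finsupp.single (w * s) 1 := by
  simp [rightOp, h]

theorem rightOp_of_gt {s w : W r} (h : len (w * s) < len w) :
    rightOp s (Finsupp.single w 1) =
      q • Finsupp.single (w * s) 1 + (q - 1) • Finsupp.single w 1 := by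
  simp [rightOp, h.not_gt]

theorem end_ext {f g : Module.End Laurent (W r →₀ Laurent)}
    (h : ∀ w, f (Finsupp.single w 1) = g (Finsupp.single w 1)) : f = g := by
  refine Finsupp.lhom_ext' fun w => LinearMap.ext_ring ?_
  exact h w

theorem leftShift_comm_rightShift (c c' : W r) :
    leftShift c * rightShift c' = rightShift c' * leftShift c := by
  refine end_ext fun w => ?_
  rw [Module.End.mul_apply, Module.End.mul_apply, leftShift_single, rightShift_single,
    leftShift_single, rightShift_single, mul_assoc]

theorem exists_left_descent {w : W r} {k : ℕ} (h : len w = k + 1) :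
    ∃ w' : W r, ∃ s ∈ simples r, w = s * w' ∧ len w' = k := by
  rw [← len_inv] at h
  obtain ⟨v, s, hs, e, hv⟩ := exists_descent h
  refine ⟨v⁻¹, s, hs, ?_, by rw [len_inv, hv]⟩
  rw [← inv_inv w, e, mul_inv_rev, simples_inv hs]

section NeZero

variable [NeZero r]

/-- The computation that makes the regular representation work. The two sides agree term by term
according to the lengths of `w`, `s w`, `w s'` and `s w s'`; in the two mixed cases exchange forces
`s w = w s'`. -/
theorem leftOp_comm_rightOp {s s' : W r} (hs : s ∈ simples r) (hs' : s' ∈ simples r) :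
    leftOp s * rightOp s' = rightOp s' * leftOp s := by
  refine end_ext fun w => ?_
  rw [Module.End.mul_apply, Module.End.mul_apply]
  have e : s * (w * s') = s * w * s' := (mul_assoc _ _ _).symm
  have h0 : len (s * (w * s')) = len (s * w * s') := by rw [e]
  have h1 := len_simple_mul w hs
  have h2 := len_mul_simple w hs'
  have h3 := len_simple_mul (w * s') hs
  have h4 := len_mul_simple (s * w) hs'
  rcases h1 with h1 | h1 <;> rcases h2 with h2 | h2
  · rw [rightOp_of_lt (w := w) (by omega), leftOp_of_lt (w := w) (by omega)]
    rcases h4 with h4 | h4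
    · rw [leftOp_of_lt (w := w * s') (by omega), rightOp_of_lt (w := s * w) (by omega), e]
    · have h5 := simple_mul_eq_mul_simple hs hs' h2 (by omega)
      rw [leftOp_of_gt (w := w * s') (by omega), rightOp_of_gt (w := s * w) (by omega), e, h5]
  · rw [rightOp_of_gt (w := w) (by omega), leftOp_of_lt (w := w) (by omega), map_add, map_smul,
      map_smul, leftOp_of_lt (w := w * s') (by omega), leftOp_of_lt (w := w) (by omega),
      rightOp_of_gt (w := s * w) (by omega), e]
  · rw [rightOp_of_lt (w := w) (by omega), leftOp_of_gt (w := w) (by omega), map_add, map_smul,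
      map_smul, rightOp_of_lt (w := s * w) (by omega), rightOp_of_lt (w := w) (by omega),
      leftOp_of_gt (w := w * s') (by omega), e]
  · rw [rightOp_of_gt (w := w) (by omega), leftOp_of_gt (w := w) (by omega), map_add, map_smul,
      map_smul, map_add, map_smul, map_smul, leftOp_of_gt (w := w) (by omega),
      rightOp_of_gt (w := w) (by omega)]
    -- If `s w s'` is longer than `s w`, exchange applied to `s w` gives `w = s w s'`, so the two
    -- lower elements `s w` and `w s'` coincide.
    rcases h4 with h4 | h4
    · have h5 : s * (s * w) = s * w * s' := simple_mul_eq_mul_simple hs hs' h4 (by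
        rw [simple_mul_simple_mul _ hs]; omega)
      rw [simple_mul_simple_mul _ hs] at h5
      have h6 : w * s' = s * w := by rw [h5, mul_simple_mul_simple _ hs', ← h5]
      rw [leftOp_of_lt (w := w * s') (by omega), rightOp_of_lt (w := s * w) (by omega), e, h6]
    · rw [leftOp_of_gt (w := w * s') (by omega), rightOp_of_gt (w := s * w) (by omega), e]
      module

theorem leftOp_comm_rightShift {s c : W r} (hs : s ∈ simples r) (hc : c ∈ Omega r) :
    leftOp s * rightShift c = rightShift c * leftOp s := by
  refine end_ext fun w => ?_
  rw [Module.End.mul_apply, Module.End.mul_apply, rightShift_single]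
  have h1 := len_simple_mul w hs
  have e : s * (w * c) = s * w * c := (mul_assoc _ _ _).symm
  have h2 := len_mul_Omega hc w
  have h3 := len_mul_Omega hc (s * w)
  rcases h1 with h1 | h1
  · rw [leftOp_of_lt (by rw [e]; omega), leftOp_of_lt (by omega), rightShift_single, e]
  · rw [leftOp_of_gt (by rw [e]; omega), leftOp_of_gt (by omega), map_add, map_smul, map_smul,
      rightShift_single, rightShift_single, e]

theorem leftShift_comm_rightOp {s c : W r} (hs : s ∈ simples r) (hc : c ∈ Omega r) :
    leftShift c * rightOp s = rightOp s * leftShift c := by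
  refine end_ext fun w => ?_
  rw [Module.End.mul_apply, Module.End.mul_apply, leftShift_single]
  have h1 := len_mul_simple w hs
  have e : c * w * s = c * (w * s) := mul_assoc _ _ _
  have h2 := len_Omega_mul hc w
  have h3 := len_Omega_mul hc (w * s)
  rcases h1 with h1 | h1
  · rw [rightOp_of_lt (w := c * w) (by rw [e]; omega), rightOp_of_lt (by omega), leftShift_single,
      e]
  · rw [rightOp_of_gt (w := c * w) (by rw [e]; omega), rightOp_of_gt (by omega), map_add, map_smul,
      map_smul, leftShift_single, leftShift_single, e]

end NeZero

/-- The operators that commute with the right regular representation. -/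
def leftAlg (r : ℕ) : Subalgebra Laurent (Module.End Laurent (W r →₀ Laurent)) :=
  Subalgebra.centralizer Laurent (rightOp '' simples r ∪ rightShift '' (Omega r : Set (W r)))

theorem mem_leftAlg {f : Module.End Laurent (W r →₀ Laurent)} :
    f ∈ leftAlg r ↔ (∀ s ∈ simples r, f * rightOp s = rightOp s * f) ∧
      ∀ c ∈ Omega r, f * rightShift c = rightShift c * f := by
  rw [leftAlg, Subalgebra.mem_centralizer_iff]
  constructor
  · intro h
    exact ⟨fun s hs => (h _ (Or.inl ⟨s, hs, rfl⟩)).symm,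
      fun c hc => (h _ (Or.inr ⟨c, hc, rfl⟩)).symm⟩
  · rintro ⟨h1, h2⟩ _ (⟨s, hs, rfl⟩ | ⟨c, hc, rfl⟩)
    · exact (h1 s hs).symm
    · exact (h2 c hc).symm

theorem leftAlg_apply_mul_simple {f : Module.End Laurent (W r →₀ Laurent)} (hf : f ∈ leftAlg r)
    {w s : W r} (hs : s ∈ simples r) (h : len w < len (w * s)) :
    f (Finsupp.single (w * s) 1) = rightOp s (f (Finsupp.single w 1)) := by
  rw [← rightOp_of_lt h]
  exact DFunLike.congr_fun ((mem_leftAlg.1 hf).1 s hs) _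

variable [NeZero r]

/-- The right operators generate the whole module from the basis vector at `1`, so an operator
commuting with them is determined by its value there. Relations between the `opT w` need only be
checked at that vector. -/
theorem leftAlg_ext {f g : Module.End Laurent (W r →₀ Laurent)} (hf : f ∈ leftAlg r)
    (hg : g ∈ leftAlg r) (h : f (Finsupp.single 1 1) = g (Finsupp.single 1 1)) : f = g := by
  refine end_ext fun w => ?_
  obtain ⟨k, hk⟩ : ∃ k, len w = k := ⟨_, rfl⟩
  induction k generalizing w with
  | zero =>
    have hc := mem_Omega_of_len_eq_zero hk
    have e : rightShift w (Finsupp.single 1 1) = Finsupp.single w 1 := by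
      rw [rightShift_single, one_mul]
    have h1 := DFunLike.congr_fun ((mem_leftAlg.1 hf).2 w hc) (Finsupp.single 1 1)
    have h2 := DFunLike.congr_fun ((mem_leftAlg.1 hg).2 w hc) (Finsupp.single 1 1)
    rw [Module.End.mul_apply, Module.End.mul_apply, e] at h1 h2
    rw [h1, h2, h]
  | succ k ih =>
    obtain ⟨v, s, hs, rfl, hv⟩ := exists_descent hk
    rw [leftAlg_apply_mul_simple hf hs (by omega), leftAlg_apply_mul_simple hg hs (by omega),
      ih v hv]

theorem exists_leftAlg (w : W r) :
    ∃ f ∈ leftAlg r, f (Finsupp.single 1 1) = Finsupp.single w 1 := by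
  obtain ⟨k, hk⟩ : ∃ k, len w = k := ⟨_, rfl⟩
  induction k generalizing w with
  | zero =>
    have hc := mem_Omega_of_len_eq_zero hk
    exact ⟨leftShift w, mem_leftAlg.2 ⟨fun s hs => leftShift_comm_rightOp hs hc,
      fun c _ => leftShift_comm_rightShift w c⟩, by rw [leftShift_single, mul_one]⟩
  | succ k ih =>
    obtain ⟨v, s, hs, rfl, hv⟩ := exists_left_descent hk
    obtain ⟨f, hf, e⟩ := ih v hv
    refine ⟨leftOp s * f, mul_mem (mem_leftAlg.2 ⟨fun s' hs' => leftOp_comm_rightOp hs hs',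
      fun c hc => leftOp_comm_rightShift hs hc⟩) hf, ?_⟩
    rw [Module.End.mul_apply, e, leftOp_of_lt (by omega)]

/-- The operator `T_w ·` of the left regular representation. -/
def opT (w : W r) : Module.End Laurent (W r →₀ Laurent) := (exists_leftAlg w).choose

theorem opT_mem (w : W r) : opT w ∈ leftAlg r := (exists_leftAlg w).choose_spec.1

theorem opT_one_apply (w : W r) : opT w (Finsupp.single 1 1) = Finsupp.single w 1 :=
  (exists_leftAlg w).choose_spec.2

theorem len_mul_le (w v : W r) : len (w * v) ≤ len w + len v := by
  obtain ⟨k, hk⟩ : ∃ k, len v = k := ⟨_, rfl⟩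
  induction k generalizing v with
  | zero =>
    rw [len_mul_Omega (mem_Omega_of_len_eq_zero hk)]
    omega
  | succ k ih =>
    obtain ⟨v', s, hs, rfl, hv⟩ := exists_descent hk
    have h1 := ih v' hv
    have h2 := len_mul_simple (w * v') hs
    rw [← mul_assoc]
    omega

theorem opT_apply (w v : W r) (h : len (w * v) = len w + len v) :
    opT w (Finsupp.single v 1) = Finsupp.single (w * v) 1 := by
  obtain ⟨k, hk⟩ : ∃ k, len v = k := ⟨_, rfl⟩
  induction k generalizing v with
  | zero =>
    have hc := mem_Omega_of_len_eq_zero hk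
    have h1 := DFunLike.congr_fun ((mem_leftAlg.1 (opT_mem w)).2 v hc) (Finsupp.single 1 1)
    rwa [Module.End.mul_apply, Module.End.mul_apply, opT_one_apply, rightShift_single,
      rightShift_single, one_mul] at h1
  | succ k ih =>
    obtain ⟨v', s, hs, rfl, hv⟩ := exists_descent hk
    have h1 := len_mul_le w v'
    have h2 := len_mul_simple (w * v') hs
    rw [← mul_assoc] at h
    rw [leftAlg_apply_mul_simple (opT_mem w) hs (by omega), ih v' (by omega) hv,
      rightOp_of_lt (by omega), mul_assoc]

theorem leftOp_mem {s : W r} (hs : s ∈ simples r) : leftOp s ∈ leftAlg r :=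
  mem_leftAlg.2 ⟨fun _ hs' => leftOp_comm_rightOp hs hs', fun _ hc => leftOp_comm_rightShift hs hc⟩

theorem opT_simple {s : W r} (hs : s ∈ simples r) : opT s = leftOp s := by
  refine leftAlg_ext (opT_mem s) (leftOp_mem hs) ?_
  rw [opT_one_apply, leftOp_of_lt, mul_one]
  rw [mul_one, len_one, len_simple hs]
  exact one_pos

theorem opT_quad {s : W r} (hs : s ∈ simples r) :
    (opT s + 1) * (opT s - algebraMap Laurent _ q) = 0 := by
  rw [opT_simple hs]
  refine end_ext fun w => ?_
  have e : ∀ f : W r →₀ Laurent,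
      ((leftOp s + 1) * (leftOp s - algebraMap Laurent (Module.End Laurent (W r →₀ Laurent)) q)) f =
        leftOp s (leftOp s f) - q • leftOp s f + (leftOp s f - q • f) := fun f => by
    rw [Module.End.mul_apply, LinearMap.sub_apply, LinearMap.add_apply,
      Module.algebraMap_end_apply, map_sub, map_smul]
    rfl
  rw [e, LinearMap.zero_apply]
  rcases len_simple_mul w hs with h | h
  · rw [leftOp_of_lt (w := w) (by omega),
      leftOp_of_gt (w := s * w) (by rw [simple_mul_simple_mul _ hs]; omega),
      simple_mul_simple_mul _ hs]
    module
  · rw [leftOp_of_gt (w := w) (by omega), map_add, map_smul, map_smul,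
      leftOp_of_lt (w := s * w) (by rw [simple_mul_simple_mul _ hs]; omega),
      leftOp_of_gt (w := w) (by omega), simple_mul_simple_mul _ hs]
    module

/-- The left regular representation of the Hecke algebra. -/
def regular (r : ℕ) [NeZero r] : Hecke r →ₐ[Laurent] Module.End Laurent (W r →₀ Laurent) :=
  RingQuot.liftAlgHom (s := HeckeRel r) Laurent ⟨FreeAlgebra.lift Laurent opT, by
    intro x y h
    cases h with
    | one =>
      rw [FreeAlgebra.lift_ι_apply, map_one]
      exact leftAlg_ext (opT_mem 1) (one_mem _) (opT_one_apply 1)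
    | mul w w' h =>
      rw [map_mul, FreeAlgebra.lift_ι_apply, FreeAlgebra.lift_ι_apply, FreeAlgebra.lift_ι_apply]
      refine leftAlg_ext (mul_mem (opT_mem w) (opT_mem w')) (opT_mem _) ?_
      rw [Module.End.mul_apply, opT_one_apply, opT_one_apply, opT_apply w w' h]
    | quad s hs =>
      rw [map_mul, map_add, map_sub, FreeAlgebra.lift_ι_apply, AlgHom.commutes, map_one, map_zero]
      exact opT_quad hs⟩

theorem regular_T (w : W r) : regular r (T w) = opT w := by
  unfold regular T toHecke
  refine (RingQuot.liftAlgHom_mkAlgHom_apply Laurent _ _ _).trans ?_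
  exact FreeAlgebra.lift_ι_apply _ _

/-- Acting on the basis vector at `1` sends `T w` to the basis vector at `w`. -/
theorem linearIndependent_T : LinearIndependent Laurent (T : W r → Hecke r) := by
  let f : Hecke r →ₗ[Laurent] (W r →₀ Laurent) :=
    (LinearMap.applyₗ (Finsupp.single 1 1)).comp (regular r).toLinearMap
  refine LinearIndependent.of_comp f ?_
  have : f ∘ T = fun w => Finsupp.single w (1 : Laurent) := by
    funext w
    exact (congrArg (fun g => g (Finsupp.single 1 1)) (regular_T w)).trans (opT_one_apply w)
  rw [this]
  exact Finsupp.linearIndependent_single_one _ _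

theorem T_mul_simple_of_lt {w s : W r} (hs : s ∈ simples r) (h : len w < len (w * s)) :
    T w * T s = T (w * s) := by
  refine T_mul _ _ ?_
  rw [len_simple hs]
  have := len_mul_simple w hs
  omega

theorem T_mul_simple_of_gt {w s : W r} (hs : s ∈ simples r) (h : len (w * s) < len w) :
    T w * T s = q • T (w * s) + (q - 1) • T w := by
  have h1 : T (w * s) * T s = T w := by
    have := T_mul_simple_of_lt (w := w * s) hs (by rwa [mul_simple_mul_simple _ hs])
    rwa [mul_simple_mul_simple _ hs] at this
  rw [← h1, mul_assoc, T_simple_sq hs, mul_add, mul_sub, mul_smul_comm, mul_smul_comm, mul_one]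
  module

/-- The span of the `T w` is stable under right multiplication by each `T s` and by each `T c` with
`l(c) = 0`, hence is a subalgebra; it contains the generators. -/
theorem span_range_T : Submodule.span Laurent (Set.range (T : W r → Hecke r)) = ⊤ := by
  set M := Submodule.span Laurent (Set.range (T : W r → Hecke r)) with hM
  have hT : ∀ w, T w ∈ M := fun w => Submodule.subset_span ⟨w, rfl⟩
  have h1 : ∀ w : W r, ∀ x ∈ M, x * T w ∈ M := by
    intro w
    have hlin : ∀ v : W r, (∀ y, T y * T v ∈ M) → ∀ x ∈ M, x * T v ∈ M := by
      intro v hv x hx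
      induction hx using Submodule.span_induction with
      | mem x hx => obtain ⟨y, rfl⟩ := hx; exact hv y
      | zero => rw [zero_mul]; exact zero_mem _
      | add a b _ _ ha hb => rw [add_mul]; exact add_mem ha hb
      | smul c a _ ha => rw [smul_mul_assoc]; exact M.smul_mem c ha
    obtain ⟨k, hk⟩ : ∃ k, len w = k := ⟨_, rfl⟩
    induction k generalizing w with
    | zero =>
      refine hlin w fun y => ?_
      rw [T_mul _ _ (by rw [len_mul_Omega (mem_Omega_of_len_eq_zero hk), hk, add_zero])]
      exact hT _
    | succ k ih =>
      obtain ⟨v, s, hs, rfl, hv⟩ := exists_descent hk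
      intro x hx
      rw [← T_mul_simple_of_lt hs (by omega), ← mul_assoc]
      refine hlin s (fun y => ?_) _ (ih v hv x hx)
      rcases len_mul_simple y hs with h | h
      · rw [T_mul_simple_of_lt hs (by omega)]
        exact hT _
      · rw [T_mul_simple_of_gt hs (by omega)]
        exact add_mem (M.smul_mem _ (hT _)) (M.smul_mem _ (hT _))
  have h2 : ∀ x ∈ M, ∀ y ∈ M, x * y ∈ M := by
    intro x hx y hy
    induction hy using Submodule.span_induction with
    | mem y hy => obtain ⟨w, rfl⟩ := hy; exact h1 w x hx
    | zero => rw [mul_zero]; exact zero_mem _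
    | add a b _ _ ha hb => rw [mul_add]; exact add_mem ha hb
    | smul c a _ ha => rw [mul_smul_comm]; exact M.smul_mem c ha
  rw [eq_top_iff]
  rintro x -
  obtain ⟨a, rfl⟩ := RingQuot.mkAlgHom_surjective Laurent (HeckeRel r) x
  change toHecke r a ∈ M
  induction a using FreeAlgebra.induction with
  | grade0 c =>
    rw [AlgHom.commutes, Algebra.algebraMap_eq_smul_one, ← T_one]
    exact M.smul_mem c (hT 1)
  | grade1 w => exact hT w
  | mul a b ha hb => rw [map_mul]; exact h2 _ ha _ hb
  | add a b ha hb => rw [map_add]; exact add_mem ha hb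

/-- The standard basis of the Hecke algebra. -/
def basisT (r : ℕ) [NeZero r] : Module.Basis (W r) Laurent (Hecke r) :=
  Module.Basis.mk linearIndependent_T span_range_T.ge

theorem basisT_apply (w : W r) : basisT r w = T w := Module.Basis.mk_apply _ _ _

/-- The coefficients of an element of the Hecke algebra in the standard basis. -/
def coeffs (r : ℕ) [NeZero r] : Hecke r ≃ₗ[Laurent] (W r →₀ Laurent) := (basisT r).repr

theorem coeffs_T (w : W r) : coeffs r (T w) = Finsupp.single w 1 := by
  rw [coeffs, ← basisT_apply, Module.Basis.repr_self]

theorem eq_sum_coeffs (h : Hecke r) : h = (coeffs r h).sum fun w c => c • T w := by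
  have := (basisT r).linearCombination_repr h
  conv_lhs => rw [← this]
  simp only [Finsupp.linearCombination_apply, basisT_apply]
  rfl

theorem hecke_induction {p : Hecke r → Prop} (h0 : p 0) (hadd : ∀ x y, p x → p y → p (x + y))
    (hT : ∀ (c : Laurent) w, p (c • T w)) (h : Hecke r) : p h := by
  rw [eq_sum_coeffs h, Finsupp.sum]
  exact Finset.sum_induction _ p hadd h0 fun w _ => hT _ _

theorem hecke_ext {h h' : Hecke r} (e : ∀ w, coeffs r h w = coeffs r h' w) : h = h' :=
  (coeffs r).injective (Finsupp.ext e)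

theorem coeffs_mul_simple_of_lt {w s : W r} (hs : s ∈ simples r) (hw : len w < len (w * s))
    (h : Hecke r) : coeffs r (h * T s) w = q * coeffs r h (w * s) := by
  induction h using hecke_induction with
  | h0 => simp
  | hadd x y hx hy =>
    rw [add_mul, map_add, map_add, Finsupp.add_apply, Finsupp.add_apply, hx, hy, mul_add]
  | hT c v =>
    rw [smul_mul_assoc, map_smul, map_smul, Finsupp.smul_apply, Finsupp.smul_apply, coeffs_T,
      smul_eq_mul, smul_eq_mul]
    rcases len_mul_simple v hs with h1 | h1
    · rw [T_mul_simple_of_lt hs (by omega), coeffs_T, Finsupp.single_eq_of_ne,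
        Finsupp.single_eq_of_ne]
      · ring
      · rintro rfl
        rw [mul_simple_mul_simple _ hs] at h1
        omega
      · rintro rfl
        rw [mul_simple_mul_simple _ hs] at hw
        omega
    · have h2 : w ≠ v := by
        rintro rfl
        omega
      rw [T_mul_simple_of_gt hs (by omega), map_add, map_smul, map_smul, coeffs_T, coeffs_T,
        Finsupp.add_apply, Finsupp.smul_apply, Finsupp.smul_apply, Finsupp.single_eq_of_ne h2]
      by_cases e : w = v * s
      · subst e
        rw [mul_simple_mul_simple _ hs]
        simp [mul_comm]
      · rw [Finsupp.single_eq_of_ne e, Finsupp.single_eq_of_ne]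
        · simp
        · rintro rfl
          exact e (mul_simple_mul_simple _ hs).symm

theorem coeffs_mul_simple_of_gt {w s : W r} (hs : s ∈ simples r) (hw : len (w * s) < len w)
    (h : Hecke r) :
    coeffs r (h * T s) w = coeffs r h (w * s) + (q - 1) * coeffs r h w := by
  induction h using hecke_induction with
  | h0 => simp
  | hadd x y hx hy =>
    rw [add_mul, map_add, map_add, Finsupp.add_apply, Finsupp.add_apply, Finsupp.add_apply, hx, hy]
    ring
  | hT c v =>
    rw [smul_mul_assoc, map_smul, map_smul, Finsupp.smul_apply, Finsupp.smul_apply,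
      Finsupp.smul_apply, coeffs_T, smul_eq_mul, smul_eq_mul, smul_eq_mul]
    rcases len_mul_simple v hs with h1 | h1
    · have h2 : w ≠ v := by
        rintro rfl
        omega
      rw [T_mul_simple_of_lt hs (by omega), coeffs_T, Finsupp.single_eq_of_ne h2]
      by_cases e : w = v * s
      · subst e
        rw [mul_simple_mul_simple _ hs]
        simp
      · rw [Finsupp.single_eq_of_ne e, Finsupp.single_eq_of_ne]
        · simp
        · rintro rfl
          exact e (mul_simple_mul_simple _ hs).symm
    · rw [T_mul_simple_of_gt hs (by omega), map_add, map_smul, map_smul, coeffs_T, coeffs_T,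
        Finsupp.add_apply, Finsupp.smul_apply, Finsupp.smul_apply]
      have h3 : w ≠ v * s := by
        rintro rfl
        rw [mul_simple_mul_simple _ hs] at hw
        omega
      have h4 : w * s ≠ v := by
        rintro rfl
        rw [mul_simple_mul_simple _ hs] at h1
        omega
      rw [Finsupp.single_eq_of_ne h3, Finsupp.single_eq_of_ne h4]
      simp only [smul_eq_mul]
      ring

end

section

variable {r : ℕ}

/-! ### Laurent polynomials with restricted exponents -/

theorem coeff_tpow_mul (m : ℤ) (a : Laurent) (k : ℤ) :
    (tpow m * a).coeff k = a.coeff (k - m) := by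
  have := AddMonoidAlgebra.coeff_single_mul_eq_mul_coeff (x := a) (r := (1 : ℤ)) (m := m)
    (m₁ := k) (k - m) (fun m' _ => by omega)
  rw [one_mul] at this
  exact this

theorem coeff_tpow (m k : ℤ) : (tpow m).coeff k = if m = k then 1 else 0 :=
  LaurentPolynomial.T_apply k m

theorem coeff_barA (a : Laurent) (k : ℤ) : (barA a).coeff k = a.coeff (-k) :=
  LaurentPolynomial.invert_apply a k

theorem laurent_eq_sum (a : Laurent) : a = ∑ k ∈ a.coeff.support, a.coeff k • tpow k := by
  refine LaurentPolynomial.ext fun k => ?_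
  rw [AddMonoidAlgebra.coeff_sum, Finsupp.finsetSum_apply]
  simp only [AddMonoidAlgebra.coeff_smul, Finsupp.smul_apply, coeff_tpow, smul_eq_mul, mul_ite,
    mul_one, mul_zero, Finset.sum_ite_eq']
  split_ifs with h
  · rfl
  · exact Finsupp.notMem_support_iff.1 h

/-- The Laurent polynomials in which only the powers `t ^ k` with `k ≡ m` modulo `2` and
`1 - l ≤ k ≤ m - 2 l` occur. -/
def klRange (m l : ℤ) : AddSubgroup Laurent where
  carrier := {a | ∀ k, a.coeff k ≠ 0 → (k - m) % 2 = 0 ∧ 1 - l ≤ k ∧ k ≤ m - 2 * l}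
  zero_mem' := by
    intro k hk
    simp at hk
  add_mem' := by
    intro a b ha hb k hk
    by_cases h : a.coeff k = 0
    · refine hb k fun h' => hk ?_
      rw [AddMonoidAlgebra.coeff_add, Finsupp.add_apply, h, h', add_zero]
    · exact ha k h
  neg_mem' := by
    intro a ha k hk
    refine ha k fun h => hk ?_
    rw [AddMonoidAlgebra.coeff_neg, Finsupp.neg_apply, h, neg_zero]

theorem tpow_mem_klRange {m l k : ℤ} (h : (k - m) % 2 = 0) (h1 : 1 - l ≤ k)
    (h2 : k ≤ m - 2 * l) : tpow k ∈ klRange m l := by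
  intro k' hk'
  rw [coeff_tpow] at hk'
  obtain rfl : k = k' := by
    by_contra hne
    exact hk' (if_neg hne)
  exact ⟨h, h1, h2⟩

theorem neg_one_pow_mul_mem {m l : ℤ} {a : Laurent} (ha : a ∈ klRange m l) (j : ℕ) :
    (-1 : Laurent) ^ j * a ∈ klRange m l := by
  rcases neg_one_pow_eq_or Laurent j with h | h
  · rwa [h, one_mul]
  · rw [h, neg_one_mul]
    exact neg_mem ha

/-- The exponents that occur are `m - 2l - 2i` with `i ≤ deg P`; the degree bound says exactly that
the smallest is at least `1 - l`. -/
theorem aeval_mem_klRange {m l : ℕ} {P : Polynomial ℤ} (hP : 2 * P.natDegree + 1 + l ≤ m) (j : ℕ) :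
    (-1 : Laurent) ^ j * tpow ((m : ℤ) - 2 * l) * Polynomial.aeval (tpow (-2)) P ∈
      klRange m l := by
  rw [mul_assoc]
  refine neg_one_pow_mul_mem ?_ j
  rw [Polynomial.aeval_eq_sum_range, Finset.mul_sum]
  refine sum_mem fun i hi => ?_
  rw [Finset.mem_range] at hi
  rw [mul_smul_comm, LaurentPolynomial.T_pow, ← LaurentPolynomial.T_add]
  refine zsmul_mem (tpow_mem_klRange ?_ ?_ ?_) _ <;> omega

theorem exists_aeval_of_mem_klRange {m l : ℕ} {a : Laurent} (ha : a ∈ klRange m l) (hl : l < m)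
    (j : ℕ) : ∃ P : Polynomial ℤ, 2 * P.natDegree + 1 + l ≤ m ∧
      a = (-1 : Laurent) ^ j * tpow ((m : ℤ) - 2 * l) * Polynomial.aeval (tpow (-2)) P := by
  -- The solution `i` of `k = m - 2l - 2i`; it is integral by parity and nonnegative by the upper
  -- bound on `k`.
  let e : ℤ → ℕ := fun k => (((m : ℤ) - 2 * l - k) / 2).toNat
  refine ⟨∑ k ∈ a.coeff.support, Polynomial.monomial (e k) ((-1) ^ j * a.coeff k), ?_, ?_⟩
  · have : (∑ k ∈ a.coeff.support, Polynomial.monomial (e k) ((-1) ^ j * a.coeff k)).natDegree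
        ≤ (m - l - 1) / 2 := by
      refine Polynomial.natDegree_sum_le_of_forall_le _ _ fun k hk => ?_
      have := ha k (Finsupp.mem_support_iff.1 hk)
      refine (Polynomial.natDegree_monomial_le _).trans ?_
      simp only [e]
      omega
    omega
  · rw [map_sum, Finset.mul_sum]
    conv_lhs => rw [laurent_eq_sum a]
    refine Finset.sum_congr rfl fun k hk => ?_
    have h1 := ha k (Finsupp.mem_support_iff.1 hk)
    have h2 : (-1 : Laurent) ^ j * (-1) ^ j = 1 := by
      rw [← mul_pow]
      simp
    have h3 : tpow ((m : ℤ) - 2 * l) * tpow (-2) ^ (e k) = tpow k := by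
      rw [LaurentPolynomial.T_pow, ← LaurentPolynomial.T_add]
      congr 1
      simp only [e]
      omega
    rw [Polynomial.aeval_monomial, map_mul, map_pow, map_neg, map_one, ← h3, zsmul_eq_mul]
    simp only [eq_intCast]
    linear_combination (-(a.coeff k : Laurent) * (tpow ((m : ℤ) - 2 * l) * tpow (-2) ^ (e k))) * h2

/-- For the correction terms in the Kazhdan–Lusztig induction. If `n ≠ 0`, the exponent `1 - l`
occurs in `a`, so `l ≡ m + 1` modulo `2` and `l ≤ m - 1`; the range of `b` then fits. -/
theorem zsmul_mem_klRange {m l l' : ℤ} {n : ℤ} {a b : Laurent} (ha : a ∈ klRange m l)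
    (hn : n = a.coeff (1 - l)) (hb : b ∈ klRange l l') :
    n • b ∈ klRange (m + 1) l' := by
  intro k hk
  rw [AddMonoidAlgebra.coeff_smul, Finsupp.smul_apply, smul_eq_mul] at hk
  have h1 := ha (1 - l) (hn ▸ left_ne_zero_of_mul hk)
  have h2 := hb k (right_ne_zero_of_mul hk)
  omega

/-! ### The bar involution is triangular -/

variable [NeZero r]

theorem coeffs_finsum {D : Set (W r)} (hD : D.Finite) (f : W r → Laurent) (y : W r) :
    coeffs r (∑ᶠ x ∈ D, f x • T x) y = open Classical in if y ∈ D then f y else 0 := by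
  classical
  rw [finsum_mem_eq_finite_toFinset_sum _ hD, map_sum, Finsupp.finsetSum_apply]
  simp only [map_smul, coeffs_T, Finsupp.smul_apply, smul_eq_mul, Finsupp.single_apply, mul_ite,
    mul_one, mul_zero, Finset.sum_ite_eq', Set.Finite.mem_toFinset]

omit [NeZero r] in
theorem Tinv_of_len_eq_zero {w : W r} (h : len w = 0) : Tinv w⁻¹ = T w := by
  refine Tinv_eq ?_
  rw [T_mul, inv_mul_cancel, T_one]
  rw [inv_mul_cancel, len_one, len_inv, h]

/-- Triangularity of the bar involution: `T_{w⁻¹}⁻¹` is `q^{-l(w)} T_w` plus terms of smaller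
length, by splitting off the last letter of `w`. -/
theorem coeffs_Tinv {w y : W r} (h : len w ≤ len y) :
    coeffs r (Tinv w⁻¹) y = open Classical in if y = w then tpow (-(2 * len w)) else 0 := by
  obtain ⟨k, hk⟩ : ∃ k, len w = k := ⟨_, rfl⟩
  induction k generalizing w y with
  | zero =>
    classical
    rw [Tinv_of_len_eq_zero hk, coeffs_T, Finsupp.single_apply, hk]
    simp [eq_comm]
  | succ k ih =>
    obtain ⟨v, s, hs, rfl, hv⟩ := exists_descent hk
    rw [← Tinv_inv_mul v s (by rw [len_simple hs]; omega), Tinv_simple hs, mul_smul_comm, mul_add,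
      mul_sub, mul_smul_comm, mul_one, map_smul, map_add, map_sub, map_smul, Finsupp.smul_apply,
      Finsupp.add_apply, Finsupp.sub_apply, Finsupp.smul_apply, ih (y := y) (by omega) hv,
      if_neg (by rintro rfl; omega), smul_zero, sub_zero, add_zero, smul_eq_mul]
    rcases len_mul_simple y hs with h1 | h1
    · rw [coeffs_mul_simple_of_lt hs (by omega), ih (by omega) hv, if_neg, if_neg]
      · simp
      · rintro rfl
        rw [mul_simple_mul_simple _ hs] at h1
        omega
      · rintro rfl
        omega
    · rw [coeffs_mul_simple_of_gt hs (by omega), ih (by omega) hv, ih (by omega) hv,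
        if_neg (by rintro rfl; omega : ¬ y = v), mul_zero, add_zero]
      by_cases e : y = v * s
      · subst e
        rw [mul_simple_mul_simple _ hs, if_pos rfl, if_pos rfl, ← LaurentPolynomial.T_add]
        congr 1
        rw [hk, hv]
        push_cast
        ring
      · rw [if_neg e, if_neg, mul_zero]
        rintro rfl
        exact e (mul_simple_mul_simple _ hs).symm

theorem coeffs_barH {h : Hecke r} {y : W r} (hy : ∀ x, coeffs r h x ≠ 0 → len x ≤ len y) :
    coeffs r (barH r h) y = barA (coeffs r h y) * tpow (-(2 * len y)) := by
  classical
  have h1 : barH r h = ∑ x ∈ (coeffs r h).support, barA (coeffs r h x) • Tinv x⁻¹ := by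
    conv_lhs => rw [eq_sum_coeffs h, Finsupp.sum, map_sum]
    exact Finset.sum_congr rfl fun x _ => barH_smul_T _ _
  rw [h1, map_sum, Finsupp.finsetSum_apply, Finset.sum_congr rfl fun x hx => by
    rw [map_smul, Finsupp.smul_apply, coeffs_Tinv (hy x (Finsupp.mem_support_iff.1 hx)),
      smul_eq_mul, mul_ite, mul_zero], Finset.sum_ite_eq]
  split_ifs with h2
  · rfl
  · rw [Finsupp.notMem_support_iff.1 h2, map_zero, zero_mul]

/-! ### Existence and uniqueness of the Kazhdan–Lusztig elements -/

/-- The defining properties of `C'_w`, in terms of coefficients. -/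
structure IsKLElement (w : W r) (h : Hecke r) : Prop where
  bar : barH r h = h
  lead : coeffs r h w = tpow (-len w)
  supp : ∀ y, coeffs r h y ≠ 0 → BruhatLE y w
  low : ∀ y, y ≠ w → coeffs r h y ∈ klRange (len w) (len y)

/-- At an element `y` of maximal length in the support of the difference, bar invariance reduces to
a symmetry of the coefficient of `T_y` alone. -/
theorem IsKLElement.unique {w : W r} {h h' : Hecke r} (H : IsKLElement w h)
    (H' : IsKLElement w h') : h = h' := by
  by_contra hne
  have hd : coeffs r (h - h') ≠ 0 := by
    intro e
    exact hne (sub_eq_zero.1 ((LinearEquiv.map_eq_zero_iff _).1 e))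
  obtain ⟨y, hy, hmax⟩ := Finset.exists_max_image (coeffs r (h - h')).support len
    (Finsupp.support_nonempty_iff.2 hd)
  have hb : barH r (h - h') = h - h' := by rw [map_sub, H.bar, H'.bar]
  have h1 := coeffs_barH (h := h - h') (y := y)
    fun x hx => hmax x (Finsupp.mem_support_iff.2 hx)
  rw [hb] at h1
  have hyw : y ≠ w := by
    rintro rfl
    rw [Finsupp.mem_support_iff, map_sub, Finsupp.sub_apply, H.lead, H'.lead, sub_self] at hy
    exact hy rfl
  have h2 : coeffs r (h - h') y ∈ klRange (len w) (len y) := by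
    rw [map_sub, Finsupp.sub_apply]
    exact sub_mem (H.low y hyw) (H'.low y hyw)
  obtain ⟨k, hk⟩ : ∃ k, (coeffs r (h - h') y).coeff k ≠ 0 := by
    by_contra! hk
    exact Finsupp.mem_support_iff.1 hy (LaurentPolynomial.ext fun k => by simpa using hk k)
  have h3 := h2 k hk
  rw [h1, mul_comm, coeff_tpow_mul, coeff_barA] at hk
  -- The symmetry sends the exponent `k` to `-k - 2 l(y)`, a reflection about `-l(y)`. All exponents
  -- are at least `1 - l(y)`, so none can have a mirror image.
  have h4 := h2 _ hk
  omega

theorem isKLElement_of_len_eq_zero {w : W r} (h : len w = 0) : IsKLElement w (T w) where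
  bar := by
    have := barH_smul_T 1 w
    rwa [one_smul, map_one, one_smul, Tinv_of_len_eq_zero h] at this
  lead := by simp [coeffs_T, h]
  supp := by
    intro y hy
    obtain rfl : w = y := by
      by_contra hne
      rw [coeffs_T, Finsupp.single_eq_of_ne (Ne.symm hne)] at hy
      exact hy rfl
    exact BruhatLE.refl _
  low := by
    intro y hy
    rw [coeffs_T, Finsupp.single_eq_of_ne hy]
    exact zero_mem _

/-- The Kazhdan–Lusztig element of a simple reflection. -/
def klSimple (s : W r) : Hecke r := tpow (-1) • (T s - q • 1)

omit [NeZero r] in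
theorem barH_klSimple {s : W r} (hs : s ∈ simples r) : barH r (klSimple s) = klSimple s := by
  have h1 : klSimple s = tpow (-1) • T s - (tpow (-1) * q) • T 1 := by
    rw [klSimple, T_one]
    module
  rw [h1, map_sub, barH_smul_T, barH_smul_T, Tinv_simple hs, inv_one, Tinv_one, map_mul,
    barA_tpow, barA_tpow, T_one]
  have hu : tpow 1 * tpow (-2) = tpow (-1) := by rw [← LaurentPolynomial.T_add]; rfl
  have hu' : tpow (- -1) = tpow 1 := rfl
  rw [hu']
  match_scalars
  · linear_combination hu
  · linear_combination (-q) * hu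

omit [NeZero r] in
theorem klSimple_mul_simple {s : W r} (hs : s ∈ simples r) :
    klSimple s * T s = -klSimple s := by
  rw [klSimple, smul_mul_assoc, sub_mul, T_simple_sq hs, smul_mul_assoc, one_mul]
  module

theorem coeffs_mul_klSimple (h : Hecke r) {s : W r} (y : W r) :
    coeffs r (h * klSimple s) y =
      tpow (-1) * (coeffs r (h * T s) y - q * coeffs r h y) := by
  rw [klSimple, mul_smul_comm, mul_sub, mul_smul_comm, mul_one, map_smul, map_sub, map_smul]
  rfl

theorem tpow_neg_one_mul_q : tpow (-1) * q = tpow 1 := by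
  rw [← LaurentPolynomial.T_add]; rfl

theorem coeffs_mul_klSimple_of_lt (h : Hecke r) {s y : W r} (hs : s ∈ simples r)
    (hy : len y < len (y * s)) :
    coeffs r (h * klSimple s) y = tpow 1 * coeffs r h (y * s) - tpow 1 * coeffs r h y := by
  rw [coeffs_mul_klSimple, coeffs_mul_simple_of_lt hs hy]
  linear_combination (coeffs r h (y * s) - coeffs r h y) * tpow_neg_one_mul_q

theorem coeffs_mul_klSimple_of_gt (h : Hecke r) {s y : W r} (hs : s ∈ simples r)
    (hy : len (y * s) < len y) :
    coeffs r (h * klSimple s) y = tpow (-1) * coeffs r h (y * s) - tpow (-1) * coeffs r h y := by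
  rw [coeffs_mul_klSimple, coeffs_mul_simple_of_gt hs hy]
  ring

theorem tpow_one_mul_mem {m l : ℤ} {a : Laurent} (ha : a ∈ klRange m l) :
    tpow 1 * a ∈ klRange (m + 1) l := by
  intro k hk
  rw [coeff_tpow_mul] at hk
  have := ha _ hk
  omega

theorem tpow_one_mul_mem' {m l : ℤ} {a : Laurent} (ha : a ∈ klRange m (l + 1)) :
    tpow 1 * a ∈ klRange (m + 1) l := by
  intro k hk
  rw [coeff_tpow_mul] at hk
  have := ha _ hk
  omega

theorem tpow_neg_one_mul_mem {m l : ℤ} {a : Laurent} (ha : a ∈ klRange m (l - 1)) :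
    tpow (-1) * a ∈ klRange (m + 1) l := by
  intro k hk
  rw [coeff_tpow_mul] at hk
  have := ha _ hk
  omega

/-- Multiplication by `t⁻¹` leaves the admissible range only at the exponent `-l`, so removing that
one term suffices. -/
theorem tpow_neg_one_mul_sub_mem {m l : ℤ} {a : Laurent} (ha : a ∈ klRange m l) :
    tpow (-1) * a - a.coeff (1 - l) • tpow (-l) ∈ klRange (m + 1) l := by
  intro k hk
  rw [AddMonoidAlgebra.coeff_sub, Finsupp.sub_apply, coeff_tpow_mul, AddMonoidAlgebra.coeff_smul,
    Finsupp.smul_apply, coeff_tpow] at hk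
  by_cases e : -l = k
  · subst e
    exact absurd (by simp [show -l - -1 = 1 - l by ring]) hk
  · rw [if_neg e, smul_zero, sub_zero] at hk
    have := ha _ hk
    omega

/-- The inductive construction of the Kazhdan–Lusztig elements. -/
theorem IsKLElement.mul_simple {w s : W r} {h : Hecke r} (H : IsKLElement w h)
    (hs : s ∈ simples r) (hw : len w < len (w * s)) {c : W r → Hecke r}
    (hc : ∀ z, len z ≤ len w → len (z * s) < len z →
      IsKLElement z (c z) ∧ c z * T s = -c z) :
    ∃ Z : Finset (W r), (∀ z ∈ Z, len z ≤ len w ∧ len (z * s) < len z) ∧ ∃ m : W r → ℤ,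
      IsKLElement (w * s) (h * klSimple s + ∑ z ∈ Z, m z • c z) := by
  classical
  have hws := len_mul_simple w hs
  let Z := (coeffs r h).support.filter fun z => len (z * s) < len z
  -- Up to sign the usual `μ`-coefficient. Multiplication by `klSimple s` turns this lowest term of
  -- the coefficient of `T_z` into the forbidden `-m z • t^{-l(z)}`, which the leading term of `m z
  -- • c z` cancels.
  let m : W r → ℤ := fun z => (coeffs r h z).coeff (1 - len z)
  have hZ : ∀ z ∈ Z, z ≠ w ∧ BruhatLE z w ∧ len (z * s) < len z := by
    intro z hz
    obtain ⟨h1, h2⟩ := Finset.mem_filter.1 hz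
    exact ⟨by rintro rfl; omega, H.supp z (Finsupp.mem_support_iff.1 h1), h2⟩
  have hcZ : ∀ z ∈ Z, IsKLElement z (c z) := fun z hz =>
    (hc z (hZ z hz).2.1.len_le (hZ z hz).2.2).1
  refine ⟨Z, fun z hz => ⟨(hZ z hz).2.1.len_le, (hZ z hz).2.2⟩, m, ?_⟩
  have hco : ∀ y, coeffs r (h * klSimple s + ∑ z ∈ Z, m z • c z) y =
      coeffs r (h * klSimple s) y + ∑ z ∈ Z, m z • coeffs r (c z) y := by
    intro y
    rw [map_add, map_sum, Finsupp.add_apply, Finsupp.finsetSum_apply]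
    congr 1
    refine Finset.sum_congr rfl fun z _ => ?_
    rw [map_zsmul]
    rfl
  refine ⟨?_, ?_, ?_, ?_⟩
  · rw [map_add, map_mul, H.bar, barH_klSimple hs, map_sum]
    congr 1
    refine Finset.sum_congr rfl fun z hz => ?_
    rw [map_zsmul, (hcZ z hz).bar]
  · rw [hco, Finset.sum_eq_zero, add_zero, coeffs_mul_klSimple_of_gt h hs
      (by rwa [mul_simple_mul_simple _ hs]), mul_simple_mul_simple _ hs, H.lead]
    · have : coeffs r h (w * s) = 0 := by
        by_contra hne
        have := (H.supp _ hne).len_le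
        omega
      rw [this, mul_zero, sub_zero, ← LaurentPolynomial.T_add]
      congr 1
      omega
    · intro z hz
      have : coeffs r (c z) (w * s) = 0 := by
        by_contra hne
        have h1 := ((hcZ z hz).supp _ hne).len_le
        have h2 := (hZ z hz).2.1.len_le
        omega
      rw [this, smul_zero]
  · intro y hy
    have hww := bruhatLE_mul_simple hs hw
    rw [hco] at hy
    by_contra hn
    refine hy ?_
    have h1 : coeffs r h y = 0 := by
      by_contra hne
      exact hn ((H.supp y hne).trans hww)
    have h2 : coeffs r h (y * s) = 0 := by
      by_contra hne
      have := (H.supp _ hne).mul_simple_of_lt hs hw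
      rw [mul_simple_mul_simple _ hs] at this
      exact hn this
    rw [Finset.sum_eq_zero, add_zero]
    · rcases len_mul_simple y hs with h3 | h3
      · rw [coeffs_mul_klSimple_of_lt h hs (by omega), h1, h2, mul_zero, sub_zero]
      · rw [coeffs_mul_klSimple_of_gt h hs (by omega), h1, h2, mul_zero, sub_zero]
    · intro z hz
      have : coeffs r (c z) y = 0 := by
        by_contra hne
        exact hn ((((hcZ z hz).supp y hne).trans (hZ z hz).2.1).trans hww)
      rw [this, smul_zero]
  · intro y hy
    have hm : ((len (w * s) : ℕ) : ℤ) = (len w : ℤ) + 1 := by omega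
    have hterm : ∀ z ∈ Z, z ≠ y →
        m z • coeffs r (c z) y ∈ klRange ((len w : ℤ) + 1) (len y) := by
      intro z hz hzy
      exact zsmul_mem_klRange (H.low z (hZ z hz).1) rfl ((hcZ z hz).low y hzy.symm)
    rw [hco, hm]
    rcases len_mul_simple y hs with h3 | h3
    · refine add_mem ?_ (sum_mem fun z hz => hterm z hz ?_)
      · rw [coeffs_mul_klSimple_of_lt h hs (by omega)]
        refine sub_mem ?_ ?_
        · have hne : y * s ≠ w := by
            rintro rfl
            rw [mul_simple_mul_simple _ hs] at hw
            omega
          have := H.low _ hne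
          rw [h3, Nat.cast_succ] at this
          exact tpow_one_mul_mem' this
        · by_cases e : y = w
          · subst e
            rw [H.lead, ← LaurentPolynomial.T_add]
            refine tpow_mem_klRange ?_ ?_ ?_ <;> omega
          · exact tpow_one_mul_mem (H.low y e)
      · rintro rfl
        have := (hZ z hz).2.2
        omega
    -- Modulo the admissible range the corrections contribute only the leading term of `c y`; for
    -- `y` outside `Z` the integer `m y` vanishes.
    · have hsum : ∑ z ∈ Z, m z • coeffs r (c z) y - m y • tpow (-len y) ∈
          klRange ((len w : ℤ) + 1) (len y) := by
        by_cases hyZ : y ∈ Z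
        · rw [← Finset.add_sum_erase _ _ hyZ, (hcZ y hyZ).lead, add_sub_cancel_left]
          exact sum_mem fun z hz =>
            hterm z (Finset.mem_of_mem_erase hz) (Finset.ne_of_mem_erase hz)
        · have h0 : coeffs r h y = 0 := by
            by_contra hne
            exact hyZ (Finset.mem_filter.2 ⟨Finsupp.mem_support_iff.2 hne, by omega⟩)
          have : m y = 0 := by
            simp only [m, h0]
            rfl
          rw [this, zero_smul, sub_zero]
          refine sum_mem fun z hz => hterm z hz ?_
          rintro rfl
          exact hyZ hz
      have hyw : y ≠ w := by
        rintro rfl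
        omega
      have hne : y * s ≠ w := by
        rintro rfl
        exact hy (mul_simple_mul_simple _ hs).symm
      rw [coeffs_mul_klSimple_of_gt h hs (by omega)]
      have h4 := H.low _ hne
      rw [show ((len (y * s) : ℕ) : ℤ) = (len y : ℤ) - 1 by omega] at h4
      have h5 := tpow_neg_one_mul_mem h4
      have h6 := tpow_neg_one_mul_sub_mem (H.low y hyw)
      have h7 := add_mem (sub_mem h5 h6) hsum
      convert h7 using 1
      simp only [m]
      abel

/-- The descent property is carried through the induction: `klSimple s * T s = -klSimple s`, and all
correction terms `c z` have `s` as a descent. -/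
theorem exists_isKLElement (w : W r) : ∃ h, IsKLElement w h ∧
    ∀ s ∈ simples r, len (w * s) < len w → h * T s = -h := by
  obtain ⟨k, hk⟩ : ∃ k, len w = k := ⟨_, rfl⟩
  induction k using Nat.strong_induction_on generalizing w with
  | _ k ih =>
    rcases k with - | k
    · exact ⟨T w, isKLElement_of_len_eq_zero hk, fun s _ h => by omega⟩
    -- Each descent `s` gives its own construction, with the property for that `s` only. Uniqueness
    -- identifies the results.
    have key : ∀ s ∈ simples r, len (w * s) < len w → ∃ h, IsKLElement w h ∧ h * T s = -h := by
      intro s hs hws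
      have h1 := len_mul_simple w hs
      have ih' : ∀ z : W r, len z ≤ k → ∃ h, IsKLElement z h ∧
          ∀ s ∈ simples r, len (z * s) < len z → h * T s = -h :=
        fun z hz => ih (len z) (by omega) z rfl
      choose! c hc1 hc2 using ih'
      obtain ⟨Z, hZ, m, H⟩ := (hc1 (w * s) (by omega)).mul_simple hs
        (by rw [mul_simple_mul_simple _ hs]; exact hws) (c := c)
        (fun z hz hzs => ⟨hc1 z (by omega), hc2 z (by omega) s hs hzs⟩)
      rw [mul_simple_mul_simple _ hs] at H
      refine ⟨_, H, ?_⟩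
      rw [add_mul, mul_assoc, klSimple_mul_simple hs, Finset.sum_mul, neg_add, mul_neg,
        ← Finset.sum_neg_distrib]
      congr 1
      refine Finset.sum_congr rfl fun z hz => ?_
      have := hZ z hz
      rw [smul_mul_assoc, hc2 z (by omega) s hs this.2, smul_neg]
    obtain ⟨v, s, hs, hw, hv⟩ := exists_descent hk
    obtain ⟨h, H, -⟩ := key s hs (by rw [hw, mul_simple_mul_simple _ hs, hv, ← hw]; omega)
    refine ⟨h, H, fun s' hs' hws' => ?_⟩
    obtain ⟨h', H', e⟩ := key s' hs' hws'
    rwa [H.unique H']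

end

/-! ### The elements `C'_w` and the sign action of their descents -/

section

variable {r : ℕ} [NeZero r]

/-- The definition by polynomials and the one by exponent ranges agree; the polynomials of elements
not below `w` play no role and are taken to be `0`. -/
theorem isKL'_iff {w : W r} {h : Hecke r} : IsKL' w h ↔ IsKLElement w h := by
  classical
  constructor
  · rintro ⟨hb, P, hP, hdeg, e⟩
    have hco : ∀ y, coeffs r h y = if BruhatLE y w then
        (-1 : Laurent) ^ (len w - len y) * tpow ((len w : ℤ) - 2 * len y) *
          Polynomial.aeval (tpow (-2)) (P y) else 0 := by
      intro y
      rw [e, coeffs_finsum (finite_bruhatLE w)]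
      exact if_congr Iff.rfl rfl rfl
    refine ⟨hb, ?_, ?_, ?_⟩
    · rw [hco, if_pos (BruhatLE.refl w), hP, Nat.sub_self, pow_zero, one_mul, map_one, mul_one]
      congr 1
      ring
    · intro y hy
      by_contra hn
      rw [hco, if_neg hn] at hy
      exact hy rfl
    · intro y hy
      rw [hco]
      split_ifs with h1
      · exact aeval_mem_klRange (hdeg y h1 hy) _
      · exact zero_mem _
  · intro H
    refine ⟨H.bar, ?_⟩
    have key : ∀ y, ∃ P : Polynomial ℤ, (y = w → P = 1) ∧
        (BruhatLE y w → y ≠ w → 2 * P.natDegree + 1 + len y ≤ len w) ∧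
        (BruhatLE y w → coeffs r h y = (-1 : Laurent) ^ (len w - len y) *
          tpow ((len w : ℤ) - 2 * len y) * Polynomial.aeval (tpow (-2)) P) := by
      intro y
      by_cases hy : y = w
      · subst hy
        refine ⟨1, fun _ => rfl, fun _ h => absurd rfl h, fun _ => ?_⟩
        rw [H.lead, Nat.sub_self, pow_zero, one_mul, map_one, mul_one]
        congr 1
        ring
      · by_cases hb : BruhatLE y w
        · obtain ⟨P, h1, h2⟩ := exists_aeval_of_mem_klRange (H.low y hy) (hb.len_lt hy)
            (len w - len y)
          exact ⟨P, fun h => absurd h hy, fun _ _ => h1, fun _ => h2⟩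
        · exact ⟨0, fun h => absurd h hy, fun h => absurd h hb, fun h => absurd h hb⟩
    choose P h1 h2 h3 using key
    refine ⟨P, h1 w rfl, h2, hecke_ext fun y => ?_⟩
    rw [coeffs_finsum (finite_bruhatLE w)]
    split_ifs with hy
    · exact h3 y hy
    · by_contra hne
      exact hy (H.supp y hne)

theorem theElement_spec {X : Type*} [Zero X] {p : X → Prop} (h : ∃ x, p x) : p (theElement p) := by
  unfold theElement
  rw [dif_pos h]
  exact h.choose_spec

theorem isKLElement_C' (w : W r) : IsKLElement w (C' w) := by
  obtain ⟨h, hh, -⟩ := exists_isKLElement w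
  exact isKL'_iff.1 (theElement_spec ⟨h, isKL'_iff.2 hh⟩)

theorem C'_mul_simple {w s : W r} (hs : s ∈ simples r) (h : len (w * s) < len w) :
    C' w * T s = -C' w := by
  obtain ⟨h', H, hh⟩ := exists_isKLElement w
  rw [(isKLElement_C' w).unique H]
  exact hh s hs h

/-! ### The anti-involution `T_w ↦ T_{w⁻¹}` -/

/-- The anti-involution `T_w ↦ T_{w⁻¹}`, as a homomorphism to the opposite algebra. -/
def antiOp (r : ℕ) [NeZero r] : Hecke r →ₐ[Laurent] (Hecke r)ᵐᵒᵖ :=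
  RingQuot.liftAlgHom (s := HeckeRel r) Laurent
    ⟨FreeAlgebra.lift Laurent fun w => MulOpposite.op (T w⁻¹), by
    intro x y h
    cases h with
    | one => rw [FreeAlgebra.lift_ι_apply, map_one, inv_one, T_one, MulOpposite.op_one]
    | mul w w' h =>
      rw [map_mul, FreeAlgebra.lift_ι_apply, FreeAlgebra.lift_ι_apply, FreeAlgebra.lift_ι_apply,
        ← MulOpposite.op_mul, mul_inv_rev, T_mul]
      rw [← mul_inv_rev, len_inv, len_inv, len_inv, h, add_comm]
    | quad s hs =>
      rw [map_mul, map_add, map_sub, FreeAlgebra.lift_ι_apply, AlgHom.commutes, map_one, map_zero,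
        simples_inv hs, MulOpposite.algebraMap_apply, ← MulOpposite.op_one, ← MulOpposite.op_add,
        ← MulOpposite.op_sub, ← MulOpposite.op_mul, MulOpposite.op_eq_zero_iff]
      refine Eq.trans ?_ (T_quad s hs)
      rw [mul_add, add_mul, one_mul, mul_one, sub_mul, mul_sub, Algebra.commutes]⟩

/-- The anti-involution `T_w ↦ T_{w⁻¹}`. -/
def anti (r : ℕ) [NeZero r] : Hecke r →ₗ[Laurent] Hecke r :=
  (MulOpposite.opLinearEquiv Laurent).symm.toLinearMap.comp (antiOp r).toLinearMap

theorem anti_T (w : W r) : anti r (T w) = T w⁻¹ := by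
  have : antiOp r (T w) = MulOpposite.op (T w⁻¹) := by
    unfold antiOp T toHecke
    refine (RingQuot.liftAlgHom_mkAlgHom_apply Laurent _ _ _).trans ?_
    exact FreeAlgebra.lift_ι_apply _ _
  exact congrArg MulOpposite.unop this

theorem anti_mul (x y : Hecke r) : anti r (x * y) = anti r y * anti r x :=
  congrArg MulOpposite.unop (map_mul (antiOp r) x y)

theorem anti_anti (x : Hecke r) : anti r (anti r x) = x := by
  induction x using hecke_induction with
  | h0 => simp
  | hadd x y hx hy => rw [map_add, map_add, hx, hy]
  | hT c w => rw [map_smul, map_smul, anti_T, anti_T, inv_inv]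

theorem coeffs_anti (x : Hecke r) (w : W r) : coeffs r (anti r x) w = coeffs r x w⁻¹ := by
  classical
  induction x using hecke_induction with
  | h0 => simp
  | hadd x y hx hy => rw [map_add, map_add, map_add, Finsupp.add_apply, hx, hy]; rfl
  | hT c v =>
    rw [map_smul, map_smul, map_smul, anti_T, coeffs_T, coeffs_T, Finsupp.smul_apply,
      Finsupp.smul_apply, Finsupp.single_apply, Finsupp.single_apply]
    simp only [inv_eq_iff_eq_inv]

theorem anti_Tinv (w : W r) : anti r (Tinv w) = Tinv w⁻¹ := by
  have h : T w⁻¹ * anti r (Tinv w) = 1 := by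
    rw [← anti_T, ← anti_mul, Tinv_mul, ← T_one, anti_T, inv_one]
  exact (Tinv_eq h).symm

theorem barH_anti (x : Hecke r) : barH r (anti r x) = anti r (barH r x) := by
  induction x using hecke_induction with
  | h0 => simp
  | hadd x y hx hy => rw [map_add, map_add, map_add, map_add, hx, hy]
  | hT c w => rw [map_smul, anti_T, barH_smul_T, barH_smul_T, map_smul, anti_Tinv]

theorem IsKLElement.anti {w : W r} {h : Hecke r} (H : IsKLElement w h) :
    IsKLElement w⁻¹ (anti r h) where
  bar := by rw [barH_anti, H.bar]
  lead := by rw [coeffs_anti, inv_inv, H.lead, len_inv]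
  supp := by
    intro y hy
    rw [coeffs_anti] at hy
    simpa using (H.supp _ hy).inv
  low := by
    intro y hy
    rw [coeffs_anti, len_inv, ← len_inv y]
    exact H.low _ fun e => hy (by rw [← e, inv_inv])

/-- The anti-involution commutes with bar and preserves length and Bruhat order, so by uniqueness it
sends `C'_{w⁻¹}` to `C'_w`; left descents become right descents. -/
theorem simple_mul_C' {w s : W r} (hs : s ∈ simples r) (h : len (s * w) < len w) :
    T s * C' w = -C' w := by
  have h1 : C' w = anti r (C' w⁻¹) := by
    refine (isKLElement_C' w).unique ?_
    simpa using (isKLElement_C' w⁻¹).anti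
  have h2 : T s = anti r (T s) := by rw [anti_T, simples_inv hs]
  rw [h1, h2, ← anti_mul, C'_mul_simple hs, map_neg]
  rwa [← simples_inv hs, ← mul_inv_rev, len_inv, len_inv]

/-! ### Elements on which `T_s` acts by `-1` -/

/-- The coefficient of `(-q)^{-l(x)} T_x`. -/
def signedCoeff (h : Hecke r) (x : W r) : Laurent := negqpow (len x) * coeffs r h x

theorem negqpow_mul_neg (k : ℤ) : negqpow k * negqpow (-k) = 1 := by
  rw [← negqpow_add, add_neg_cancel, negqpow_zero]

theorem coeffs_eq_signedCoeff (h : Hecke r) (x : W r) :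
    coeffs r h x = negqpow (-len x) * signedCoeff h x := by
  rw [signedCoeff, ← mul_assoc, mul_comm (negqpow (-len x)), negqpow_mul_neg, one_mul]

theorem signedCoeff_ext {h h' : Hecke r} (e : ∀ x, signedCoeff h x = signedCoeff h' x) :
    h = h' :=
  hecke_ext fun x => by rw [coeffs_eq_signedCoeff, coeffs_eq_signedCoeff, e]

theorem signedCoeff_sub (h h' : Hecke r) (x : W r) :
    signedCoeff (h - h') x = signedCoeff h x - signedCoeff h' x := by
  rw [signedCoeff, map_sub, Finsupp.sub_apply, mul_sub]; rfl

theorem signedCoeff_smul (c : Laurent) (h : Hecke r) (x : W r) :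
    signedCoeff (c • h) x = c * signedCoeff h x := by
  rw [signedCoeff, map_smul, Finsupp.smul_apply, smul_eq_mul, mul_left_comm]; rfl

theorem signedCoeff_ne_zero {h : Hecke r} {x : W r} :
    signedCoeff h x ≠ 0 ↔ coeffs r h x ≠ 0 := by
  constructor
  · rintro h1 h2
    exact h1 (by rw [signedCoeff, h2, mul_zero])
  · rintro h1 h2
    exact h1 (by rw [coeffs_eq_signedCoeff, h2, mul_zero])

theorem signedCoeff_finsum {D : Set (W r)} (hD : D.Finite) (x : W r) :
    signedCoeff (∑ᶠ x ∈ D, negqpow (-(len x : ℤ)) • T x) x =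
      open Classical in if x ∈ D then 1 else 0 := by
  rw [signedCoeff, coeffs_finsum hD fun x => negqpow (-(len x : ℤ))]
  split_ifs
  · exact negqpow_mul_neg _
  · exact mul_zero _

theorem signedCoeff_anti (h : Hecke r) (x : W r) :
    signedCoeff (anti r h) x = signedCoeff h x⁻¹ := by
  rw [signedCoeff, signedCoeff, coeffs_anti, len_inv]

/-- For `x < x s`, the equation `h * T s = -h` says that the coefficient at `x` is `-q` times the
one at `x s`. Weighting by `(-q)^{l(x)}` makes this invariance under `x ↦ x s`. -/
theorem mul_simple_eq_neg_iff {h : Hecke r} {s : W r} (hs : s ∈ simples r) :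
    h * T s = -h ↔ ∀ x, signedCoeff h (x * s) = signedCoeff h x := by
  have hq : ∀ k : ℕ, negqpow ((k + 1 : ℕ) : ℤ) = negqpow k * -q := fun k => by
    rw [Nat.cast_succ, negqpow_add, negqpow_one]
  constructor
  · intro e
    have key : ∀ x, len x < len (x * s) → signedCoeff h (x * s) = signedCoeff h x := by
      intro x hx
      have h1 := coeffs_mul_simple_of_lt hs hx h
      rw [e, map_neg, Finsupp.neg_apply] at h1
      have h2 : len (x * s) = len x + 1 := by
        have := len_mul_simple x hs
        omega
      rw [signedCoeff, signedCoeff, h2, hq]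
      linear_combination negqpow (len x) * h1
    intro x
    rcases len_mul_simple x hs with hx | hx
    · exact key x (by omega)
    · have := key (x * s) (by rw [mul_simple_mul_simple _ hs]; omega)
      rw [mul_simple_mul_simple _ hs] at this
      exact this.symm
  · intro hc
    refine signedCoeff_ext fun x => ?_
    have h1 := hc x
    have hneg : signedCoeff (-h) x = -signedCoeff h x := by
      rw [signedCoeff, map_neg, Finsupp.neg_apply, mul_neg]; rfl
    rw [hneg]
    rcases len_mul_simple x hs with hx | hx
    · rw [signedCoeff, coeffs_mul_simple_of_lt hs (by omega), ← h1, signedCoeff, hx, hq]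
      ring
    · rw [signedCoeff, signedCoeff] at h1
      rw [signedCoeff, coeffs_mul_simple_of_gt hs (by omega), signedCoeff, mul_add, hx, hq,
        mul_assoc, mul_comm (-q), ← mul_assoc, h1, hx, hq]
      ring

theorem simple_mul_eq_neg_iff {h : Hecke r} {s : W r} (hs : s ∈ simples r) :
    T s * h = -h ↔ ∀ x, signedCoeff h (s * x) = signedCoeff h x := by
  have h2 : anti r (T s) = T s := by rw [anti_T, simples_inv hs]
  have h1 : T s * h = -h ↔ anti r h * T s = -anti r h := by
    constructor
    · intro e
      rw [← h2, ← anti_mul, e, map_neg]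
    · intro e
      have := congrArg (anti r) e
      rwa [anti_mul, h2, anti_anti, map_neg, anti_anti] at this
  rw [h1, mul_simple_eq_neg_iff hs]
  simp only [signedCoeff_anti, mul_inv_rev, simples_inv hs]
  exact ⟨fun h x => by simpa using h x⁻¹, fun h x => h x⁻¹⟩

end

section

variable {r n : ℕ} [NeZero r]

/-! ### The spaces `y_λ H ∩ H y_μ` -/

/-- The elements on which `T_s` acts by `-1` from the left for `s ∈ W_λ` and from the right for
`s ∈ W_μ`. -/
def signSpace (lam mu : Comp n r) : Submodule Laurent (Hecke r) where
  carrier := {d | (∀ s ∈ youngGens lam, T s * d = -d) ∧ ∀ s ∈ youngGens mu, d * T s = -d}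
  zero_mem' := by simp
  add_mem' := by
    rintro a b ⟨h1, h2⟩ ⟨h3, h4⟩
    refine ⟨fun s hs => ?_, fun s hs => ?_⟩
    · rw [mul_add, h1 s hs, h3 s hs, neg_add]
    · rw [add_mul, h2 s hs, h4 s hs, neg_add]
  smul_mem' := by
    rintro c a ⟨h1, h2⟩
    refine ⟨fun s hs => ?_, fun s hs => ?_⟩
    · rw [mul_smul_comm, h1 s hs, smul_neg]
    · rw [smul_mul_assoc, h2 s hs, smul_neg]

variable {lam mu : Comp n r}

theorem signedCoeff_mul_of_mem_young {d : Hecke r} (hd : ∀ s ∈ youngGens mu, d * T s = -d)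
    {v : W r} (hv : v ∈ young mu) (x : W r) : signedCoeff d (x * v) = signedCoeff d x := by
  have hs : ∀ s ∈ youngGens mu, ∀ x, signedCoeff d (x * s) = signedCoeff d x := fun s h =>
    (mul_simple_eq_neg_iff (youngGens_subset mu h)).1 (hd s h)
  induction hv using Subgroup.closure_induction'' generalizing x with
  | mem s h => exact hs s h x
  | inv_mem s h => rw [simples_inv (youngGens_subset mu h)]; exact hs s h x
  | one => rw [mul_one]
  | mul a b _ _ ha hb => rw [← mul_assoc, hb, ha]

theorem signedCoeff_young_mul {d : Hecke r} (hd : ∀ s ∈ youngGens lam, T s * d = -d)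
    {u : W r} (hu : u ∈ young lam) (x : W r) : signedCoeff d (u * x) = signedCoeff d x := by
  have hs : ∀ s ∈ youngGens lam, ∀ x, signedCoeff d (s * x) = signedCoeff d x := fun s h =>
    (simple_mul_eq_neg_iff (youngGens_subset lam h)).1 (hd s h)
  induction hu using Subgroup.closure_induction'' generalizing x with
  | mem s h => exact hs s h x
  | inv_mem s h => rw [simples_inv (youngGens_subset lam h)]; exact hs s h x
  | one => rw [one_mul]
  | mul a b _ _ ha hb => rw [mul_assoc, ha, hb]

theorem signedCoeff_eq_of_mem_dcoset {d : Hecke r} (hd : d ∈ signSpace lam mu) {x w : W r}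
    (hx : x ∈ dcoset lam w mu) : signedCoeff d x = signedCoeff d w := by
  obtain ⟨u, hu, v, hv, rfl⟩ := mem_dcoset.1 hx
  rw [signedCoeff_mul_of_mem_young hd.2 hv, signedCoeff_young_mul hd.1 hu]

theorem signedCoeff_TDtilde (w x : W r) : signedCoeff (TDtilde lam w mu) x =
    open Classical in if x ∈ dcoset lam w mu then 1 else 0 :=
  signedCoeff_finsum (finite_dcoset lam w mu) x

omit [NeZero r] in
theorem mem_young_of_mem_gens {s : W r} (hs : s ∈ youngGens lam) : s ∈ young lam :=
  Subgroup.subset_closure hs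

theorem TDtilde_mem_signSpace (w : W r) : TDtilde lam w mu ∈ signSpace lam mu := by
  classical
  constructor
  · intro s hs
    have hss := youngGens_subset lam hs
    rw [simple_mul_eq_neg_iff hss]
    intro x
    rw [signedCoeff_TDtilde, signedCoeff_TDtilde]
    refine if_congr ⟨fun h => ?_, fun h => mem_dcoset_mul h (mem_young_of_mem_gens hs)⟩ rfl rfl
    have := mem_dcoset_mul h (mem_young_of_mem_gens hs)
    rwa [simple_mul_simple_mul _ hss] at this
  · intro s hs
    have hss := youngGens_subset mu hs
    rw [mul_simple_eq_neg_iff hss]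
    intro x
    rw [signedCoeff_TDtilde, signedCoeff_TDtilde]
    refine if_congr ⟨fun h => ?_, fun h => mul_mem_dcoset h (mem_young_of_mem_gens hs)⟩ rfl rfl
    have := mul_mem_dcoset h (mem_young_of_mem_gens hs)
    rwa [mul_simple_mul_simple _ hss] at this

/-- The expansion of an element of `y_λ H ∩ H y_μ` in the sums over double cosets. -/
theorem exists_eq_sum_TDtilde {d : Hecke r} (hd : d ∈ signSpace lam mu) :
    ∃ a : W r →₀ Laurent, (∀ z ∈ a.support, IsMin lam z mu) ∧
      (∀ z, IsMin lam z mu → a z = signedCoeff d z) ∧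
      d = a.sum fun z c => c • TDtilde lam z mu := by
  classical
  let a : W r →₀ Laurent := Finsupp.onFinset (coeffs r d).support
    (fun z => if IsMin lam z mu then signedCoeff d z else 0) (by
      intro z hz
      rw [Finsupp.mem_support_iff, ← signedCoeff_ne_zero]
      exact fun h => hz (by simp [h]))
  have ha : ∀ z, a z = if IsMin lam z mu then signedCoeff d z else 0 := fun z => rfl
  have ha1 : ∀ z ∈ a.support, IsMin lam z mu := by
    intro z hz
    by_contra h
    rw [Finsupp.mem_support_iff, ha, if_neg h] at hz
    exact hz rfl
  refine ⟨a, ha1, fun z hz => by rw [ha, if_pos hz], signedCoeff_ext fun x => ?_⟩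
  obtain ⟨z, hz, hmin⟩ := exists_isMin lam x mu
  have hxz : x ∈ dcoset lam z mu := by
    rw [dcoset_eq hz]
    exact self_mem_dcoset x
  have hsum : signedCoeff (a.sum fun z c => c • TDtilde lam z mu) x =
      ∑ z' ∈ a.support, a z' * signedCoeff (TDtilde lam z' mu) x := by
    rw [Finsupp.sum, signedCoeff, map_sum, Finsupp.finsetSum_apply, Finset.mul_sum]
    exact Finset.sum_congr rfl fun z' _ => signedCoeff_smul _ _ _
  rw [hsum, Finset.sum_eq_single z]
  · rw [signedCoeff_TDtilde, if_pos hxz, mul_one, ha, if_pos hmin,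
      signedCoeff_eq_of_mem_dcoset hd hxz]
  · intro z' hz' hne
    rw [signedCoeff_TDtilde, if_neg, mul_zero]
    intro hx
    refine hne (hmin.unique (ha1 z' hz') ?_)
    rw [dcoset_eq hz, ← dcoset_eq (self_mem_dcoset x), dcoset_eq hx]
    exact self_mem_dcoset z'
  · intro hz
    rw [Finsupp.notMem_support_iff.1 hz, zero_mul]

omit [NeZero r] in
theorem jH_smul (c : Laurent) (h : Hecke r) : jH r (c • h) = barA c • jH r h :=
  heckeLift_smul _ _ _ _ _ _ _

theorem barA_barA (a : Laurent) : barA (barA a) = a :=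
  LaurentPolynomial.involutive_invert a

theorem barA_negqpow (k : ℤ) : barA (negqpow k) = negqpow (-k) := by
  rw [negqpow, map_zsmul, barA_tpow, negqpow, Int.negOnePow_neg, mul_neg]

omit [NeZero r] in
theorem jH_T (w : W r) : jH r (T w) = negqpow (-(len w : ℤ)) • T w := by
  have := jH_smul_T 1 w
  rwa [one_smul, map_one, one_smul] at this

theorem jH_jH (h : Hecke r) : jH r (jH r h) = h := by
  induction h using hecke_induction with
  | h0 => simp
  | hadd x y hx hy => rw [map_add, map_add, hx, hy]
  | hT c w =>
    rw [jH_smul_T, jH_smul, jH_smul_T, barA_barA, barA_negqpow, smul_smul (negqpow _),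
      neg_neg, negqpow_mul_neg, one_smul]

omit [NeZero r] in
theorem jH_finsum {D : Set (W r)} (hD : D.Finite) :
    jH r (∑ᶠ x ∈ D, T x) = ∑ᶠ x ∈ D, negqpow (-(len x : ℤ)) • T x := by
  rw [finsum_mem_eq_finite_toFinset_sum _ hD, finsum_mem_eq_finite_toFinset_sum _ hD, map_sum]
  exact Finset.sum_congr rfl fun x _ => jH_T x

theorem jH_TD (w : W r) : jH r (TD lam w mu) = TDtilde lam w mu :=
  jH_finsum (finite_dcoset lam w mu)

theorem signedCoeff_yElt (x : W r) : signedCoeff (yElt lam) x =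
    open Classical in if x ∈ young lam then 1 else 0 := by
  rw [yElt, xElt, jH_finsum (finite_young lam), signedCoeff_finsum (finite_young lam)]
  rfl

theorem yElt_mem_signSpace : yElt lam ∈ signSpace lam lam := by
  classical
  constructor
  · intro s hs
    rw [simple_mul_eq_neg_iff (youngGens_subset lam hs)]
    intro x
    rw [signedCoeff_yElt, signedCoeff_yElt]
    exact if_congr (Subgroup.mul_mem_cancel_left _ (mem_young_of_mem_gens hs)) rfl rfl
  · intro s hs
    rw [mul_simple_eq_neg_iff (youngGens_subset lam hs)]
    intro x
    rw [signedCoeff_yElt, signedCoeff_yElt]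
    exact if_congr (Subgroup.mul_mem_cancel_right _ (mem_young_of_mem_gens hs)) rfl rfl

theorem signedCoeff_yElt_mul_T {z : W r} (hz : ∀ u ∈ young lam, len (u * z) = len u + len z)
    (x : W r) : signedCoeff (yElt lam * T z) x =
      open Classical in if x * z⁻¹ ∈ young lam then negqpow (len z) else 0 := by
  classical
  rw [yElt, xElt, jH_finsum (finite_young lam),
    finsum_mem_eq_finite_toFinset_sum _ (finite_young lam), Finset.sum_mul, signedCoeff, map_sum,
    Finsupp.finsetSum_apply]
  have : ∀ u ∈ (finite_young lam).toFinset,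
      coeffs r (negqpow (-(len u : ℤ)) • T u * T z) x =
        if u = x * z⁻¹ then negqpow (-(len u : ℤ)) else 0 := by
    intro u hu
    rw [Set.Finite.mem_toFinset] at hu
    rw [smul_mul_assoc, T_mul _ _ (hz u hu), map_smul, Finsupp.smul_apply, coeffs_T,
      Finsupp.single_apply, smul_eq_mul, mul_ite, mul_one, mul_zero]
    exact if_congr eq_mul_inv_iff_mul_eq.symm rfl rfl
  rw [Finset.sum_congr rfl this, Finset.sum_ite_eq']
  simp only [Set.Finite.mem_toFinset, SetLike.mem_coe, mul_ite, mul_zero]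
  split_ifs with h
  · have h1 := hz _ h
    rw [inv_mul_cancel_right] at h1
    rw [← negqpow_add, h1]
    congr 1
    push_cast
    ring
  · rfl

/-- The signed coefficients of `d` are constant on cosets `W_λ z`, and so are those of `y_λ T_z` for
minimal `z`. The cosets in the support are removed one at a time. -/
theorem exists_eq_yElt_mul {d : Hecke r} (hd : ∀ s ∈ youngGens lam, T s * d = -d) :
    ∃ g, d = yElt lam * g := by
  classical
  obtain ⟨k, hk⟩ : ∃ k, (coeffs r d).support.card = k := ⟨_, rfl⟩
  induction k using Nat.strong_induction_on generalizing d with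
  | _ k ih =>
    by_cases h0 : d = 0
    · exact ⟨0, by rw [h0, mul_zero]⟩
    have hne : coeffs r d ≠ 0 := fun e => h0 ((LinearEquiv.map_eq_zero_iff _).1 e)
    obtain ⟨z, hz, hmin⟩ := Finset.exists_min_image (coeffs r d).support len
      (Finsupp.support_nonempty_iff.2 hne)
    rw [Finsupp.mem_support_iff, ← signedCoeff_ne_zero] at hz
    -- The support of `d` is stable under `W_λ`, so a shortest element of the support is also
    -- shortest in its coset.
    have hlen : ∀ u ∈ young lam, len (u * z) = len u + len z := by
      intro u hu
      refine len_mul_of_disjoint' (youngGens_subset lam) (fun t ht ht' => ?_) hu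
      have h1 := len_mul_lt_of_mem ht
      have h2 : t⁻¹ * z ∈ (coeffs r d).support := by
        rw [Finsupp.mem_support_iff, ← signedCoeff_ne_zero,
          signedCoeff_young_mul hd (inv_mem ht')]
        exact hz
      have h3 := hmin _ h2
      rw [← len_inv, mul_inv_rev, inv_inv, len_inv z] at h1
      omega
    -- `y_λ T_z` has the signed coefficient `(-q)^{l(z)}` throughout `W_λ z`, so this multiple
    -- cancels `d` on that coset and changes nothing elsewhere.
    let c := signedCoeff d z * negqpow (-(len z : ℤ))
    let d' := d - c • (yElt lam * T z)
    have hsc : ∀ x, signedCoeff d' x = if x * z⁻¹ ∈ young lam then 0 else signedCoeff d x := by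
      intro x
      rw [signedCoeff_sub, signedCoeff_smul, signedCoeff_yElt_mul_T hlen]
      split_ifs with h
      · have h1 := signedCoeff_young_mul hd h z
        rw [inv_mul_cancel_right] at h1
        rw [h1, mul_assoc, mul_comm (negqpow _), negqpow_mul_neg, mul_one, sub_self]
      · rw [mul_zero, sub_zero]
    have hd' : ∀ s ∈ youngGens lam, T s * d' = -d' := by
      intro s hs
      rw [mul_sub, hd s hs, mul_smul_comm, ← mul_assoc, yElt_mem_signSpace.1 s hs, neg_mul,
        smul_neg]
      change _ = -(d - c • (yElt lam * T z))
      abel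
    have hlt : (coeffs r d').support.card < k := by
      rw [← hk]
      refine Finset.card_lt_card (Finset.ssubset_iff_subset_ne.2 ⟨fun x hx => ?_, fun e => ?_⟩)
      · rw [Finsupp.mem_support_iff, ← signedCoeff_ne_zero, hsc] at hx
        rw [Finsupp.mem_support_iff, ← signedCoeff_ne_zero]
        intro h
        rw [h, ite_self] at hx
        exact hx rfl
      · have h1 : z ∈ (coeffs r d).support := by
          rwa [Finsupp.mem_support_iff, ← signedCoeff_ne_zero]
        rw [← e, Finsupp.mem_support_iff, ← signedCoeff_ne_zero, hsc, mul_inv_cancel,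
          if_pos (one_mem _)] at h1
        exact h1 rfl
    obtain ⟨g, hg⟩ := ih _ hlt hd' rfl
    refine ⟨g + c • T z, ?_⟩
    rw [mul_add, ← hg, mul_smul_comm, sub_add_cancel]

theorem anti_yElt : anti r (yElt lam) = yElt lam := by
  classical
  refine signedCoeff_ext fun x => ?_
  rw [signedCoeff_anti, signedCoeff_yElt, signedCoeff_yElt]
  exact if_congr inv_mem_iff rfl rfl

theorem exists_eq_mul_yElt {d : Hecke r} (hd : ∀ s ∈ youngGens mu, d * T s = -d) :
    ∃ g, d = g * yElt mu := by
  obtain ⟨g, hg⟩ := exists_eq_yElt_mul (lam := mu) (d := anti r d) (by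
    intro s hs
    have : anti r (T s) = T s := by rw [anti_T, simples_inv (youngGens_subset mu hs)]
    rw [← this, ← anti_mul, hd s hs, map_neg])
  refine ⟨anti r g, ?_⟩
  rw [← anti_anti d, hg, anti_mul, anti_yElt]

/-! ### Kazhdan–Lusztig elements of double cosets -/

/-- At an element of maximal length in its double coset, all generators of `W_λ` are left descents
and all generators of `W_μ` right descents. -/
theorem C'_mem_signSpace {x : W r} (hx : ∀ y ∈ dcoset lam x mu, len y ≤ len x) :
    C' x ∈ signSpace lam mu := by
  constructor
  · intro s hs
    have hss := youngGens_subset lam hs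
    have h1 := hx _ (mem_dcoset_mul (self_mem_dcoset x) (mem_young_of_mem_gens hs))
    have h2 := len_simple_mul x hss
    exact simple_mul_C' hss (by omega)
  · intro s hs
    have hss := youngGens_subset mu hs
    have h1 := hx _ (mul_mem_dcoset (self_mem_dcoset x) (mem_young_of_mem_gens hs))
    have h2 := len_mul_simple x hss
    exact C'_mul_simple hss (by omega)

theorem C'_wplus_mem_signSpace (B : Triple n r) : C' B.wplus ∈ signSpace B.lam B.mu :=
  C'_mem_signSpace fun y hy => B.len_le_wplus (by rwa [dcoset_eq B.wplus_mem] at hy)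

theorem negqpow_mul_tpow (l : ℕ) : negqpow l * tpow (-l) = negtpow l := by
  rw [negqpow, negtpow, smul_mul_assoc, ← LaurentPolynomial.T_add]
  congr 2
  ring

theorem signedCoeff_C'_self (w : W r) : signedCoeff (C' w) w = negtpow (len w) := by
  rw [signedCoeff, (isKLElement_C' w).lead, negqpow_mul_tpow]

/-- The Bruhat support of `C'_{w_{0,λ}}` stays inside `W_λ`, where the signed coefficients are
constant; the leading one is `(-t)^{l(w_{0,λ})}`. -/
theorem C'_wzero (lam : Comp n r) : C' (wzero lam) = negtpow (len (wzero lam)) • yElt lam := by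
  classical
  have hs : C' (wzero lam) ∈ signSpace lam lam := by
    refine C'_mem_signSpace fun y hy => len_le_wzero ?_
    obtain ⟨u, hu, v, hv, rfl⟩ := mem_dcoset.1 hy
    exact mul_mem (mul_mem hu (wzero_mem lam)) hv
  refine signedCoeff_ext fun x => ?_
  rw [signedCoeff_smul, signedCoeff_yElt]
  split_ifs with h
  · have := signedCoeff_mul_of_mem_young hs.2 (mul_mem (inv_mem (wzero_mem lam)) h) (wzero lam)
    rw [mul_inv_cancel_left] at this
    rw [this, signedCoeff_C'_self, mul_one]
  · rw [mul_zero]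
    by_contra hne
    exact h (((isKLElement_C' _).supp x (signedCoeff_ne_zero.1 hne)).mem_closure
      (youngGens_subset lam) (wzero_mem lam))

theorem alphaTilde_spec (B : Triple n r) : (∀ z ∈ (alphaTilde B).support, IsMin B.lam z B.mu) ∧
    C' B.wplus = (alphaTilde B).sum fun z c => c • TDtilde B.lam z B.mu := by
  obtain ⟨a, h1, -, h2⟩ := exists_eq_sum_TDtilde (C'_wplus_mem_signSpace B)
  exact theElement_spec (p := fun a : W r →₀ Laurent => (∀ z ∈ a.support, IsMin B.lam z B.mu) ∧
    C' B.wplus = a.sum fun z c => c • TDtilde B.lam z B.mu) ⟨a, h1, h2⟩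

/-- Since `j` is semilinear over `t ↦ t⁻¹` and carries `T̃_D` to `T_D`, the coefficients can be
taken as the bar conjugates of those in `alphaTilde`, times `(-1)^{l(w⁺)}`. -/
theorem alpha_spec (B : Triple n r) : (∀ z ∈ (alpha B).support, IsMin B.lam z B.mu) ∧
    C B.wplus = (alpha B).sum fun z c => c • TD B.lam z B.mu := by
  obtain ⟨h1, h2⟩ := alphaTilde_spec B
  let a : W r →₀ Laurent := (-1 : Laurent) ^ len B.wplus • (alphaTilde B).mapRange barA (map_zero _)
  have hsupp : a.support ⊆ (alphaTilde B).support :=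
    Finsupp.support_smul.trans Finsupp.support_mapRange
  refine theElement_spec (p := fun a : W r →₀ Laurent => (∀ z ∈ a.support, IsMin B.lam z B.mu) ∧
    C B.wplus = a.sum fun z c => c • TD B.lam z B.mu) ⟨a, fun z hz => h1 z (hsupp hz), ?_⟩
  have h3 : (-1 : Hecke r) ^ len B.wplus = (-1 : Laurent) ^ len B.wplus • 1 := by
    rw [← Algebra.algebraMap_eq_smul_one, map_pow, map_neg, map_one]
  have h4 : (a.sum fun z c => c • TD B.lam z B.mu) =
      ∑ z ∈ (alphaTilde B).support, a z • TD B.lam z B.mu :=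
    Finsupp.sum_of_support_subset _ hsupp _ fun z _ => zero_smul _ _
  rw [h4, C, h2, Finsupp.sum, map_sum, Finset.mul_sum]
  refine Finset.sum_congr rfl fun z _ => ?_
  rw [jH_smul, ← jH_TD, jH_jH, h3, smul_mul_assoc, one_mul, smul_smul]
  rfl

end

/-! ### The basis `C'_{w⁺}` of the sign spaces -/

section

variable {r n : ℕ} [NeZero r]

/-- In a relation, at a longest `w` that occurs, only `C'_w` contributes to `T_w`, with the unit
`t^{-l(w)}`. -/
theorem linearIndependent_C' : LinearIndependent Laurent (C' : W r → Hecke r) := by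
  rw [linearIndependent_iff]
  intro c hc
  by_contra hne
  obtain ⟨w, hw, hmax⟩ := Finset.exists_max_image c.support len
    (Finsupp.support_nonempty_iff.2 hne)
  have h1 := congrArg (fun h => coeffs r h w) hc
  simp only [Finsupp.linearCombination_apply, Finsupp.sum, map_sum, Finsupp.finsetSum_apply,
    map_smul, Finsupp.smul_apply, map_zero, Finsupp.zero_apply] at h1
  rw [Finset.sum_eq_single w] at h1
  · rw [(isKLElement_C' w).lead, smul_eq_mul] at h1
    exact Finsupp.mem_support_iff.1 hw
      (((LaurentPolynomial.isUnit_T (-(len w : ℤ))).mul_left_eq_zero).1 h1)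
  · intro y hy hyw
    have : coeffs r (C' y) w = 0 := by
      by_contra h
      have h2 := ((isKLElement_C' y).supp w h).len_lt hyw.symm
      have h3 := hmax y hy
      omega
    rw [this, smul_zero]
  · exact fun h => absurd hw h

theorem isUnit_negtpow (k : ℤ) : IsUnit (negtpow k) := by
  rw [← signA_tpow]
  exact (LaurentPolynomial.isUnit_T k).map signA

variable {lam mu : Comp n r}

theorem wplus_injective : Function.Injective
    fun z : {z : W r // IsMin lam z mu} => (Triple.mk lam z.1 mu z.2).wplus := by
  intro z z' e
  have h1 := (Triple.mk lam z.1 mu z.2).wplus_mem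
  have h2 := (Triple.mk lam z'.1 mu z'.2).wplus_mem
  simp only at e h1 h2
  rw [← e] at h2
  refine Subtype.ext (IsMin.unique z'.2 z.2 ?_)
  rw [← dcoset_eq h2, dcoset_eq h1]
  exact self_mem_dcoset _

/-- Inverts a triangular system: `C'_{z⁺}` is the unit `(-t)^{l(z⁺)}` times `T̃` of the double coset
of `z`, plus terms from double cosets with shorter longest elements. -/
theorem TDtilde_mem_span (z : W r) (hz : IsMin lam z mu) :
    TDtilde lam z mu ∈ Submodule.span Laurent
      (Set.range fun z : {z : W r // IsMin lam z mu} => C' (Triple.mk lam z.1 mu z.2).wplus) := by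
  classical
  obtain ⟨k, hk⟩ : ∃ k, len (Triple.mk lam z mu hz).wplus = k := ⟨_, rfl⟩
  induction k using Nat.strong_induction_on generalizing z with
  | _ k ih =>
    set B := Triple.mk lam z mu hz with hB
    set M := Submodule.span Laurent
      (Set.range fun z : {z : W r // IsMin lam z mu} => C' (Triple.mk lam z.1 mu z.2).wplus)
    obtain ⟨a, h1, h2, h3⟩ := exists_eq_sum_TDtilde (C'_wplus_mem_signSpace B)
    have haz : a z = negtpow (len B.wplus) := by
      rw [h2 z hz, ← signedCoeff_eq_of_mem_dcoset (C'_wplus_mem_signSpace B) B.wplus_mem,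
        signedCoeff_C'_self]
    have hzs : z ∈ a.support := by
      rw [Finsupp.mem_support_iff, haz]
      exact (isUnit_negtpow _).ne_zero
    have h4 : C' B.wplus ∈ M := Submodule.subset_span ⟨⟨z, hz⟩, rfl⟩
    rw [h3, Finsupp.sum, ← Finset.add_sum_erase _ _ hzs, haz] at h4
    have h5 : ∑ x ∈ a.support.erase z, a x • TDtilde lam x mu ∈ M := by
      refine sum_mem fun x hx => M.smul_mem _ ?_
      have hxs := Finset.mem_of_mem_erase hx
      have hxm := h1 x hxs
      refine ih _ ?_ x hxm rfl
      set B' := Triple.mk lam x mu hxm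
      -- Constancy on the double coset of `x` moves the nonvanishing from `x` to `x⁺`, so `x⁺` lies
      -- below `z⁺`; they differ because `x ≠ z`.
      have h6 : signedCoeff (C' B.wplus) B'.wplus ≠ 0 := by
        rw [signedCoeff_eq_of_mem_dcoset (C'_wplus_mem_signSpace B) B'.wplus_mem]
        have := h2 x hxm
        exact this ▸ Finsupp.mem_support_iff.1 hxs
      rw [← hk]
      refine ((isKLElement_C' _).supp _ (signedCoeff_ne_zero.1 h6)).len_lt fun e => ?_
      have := wplus_injective (lam := lam) (mu := mu) (a₁ := ⟨x, hxm⟩) (a₂ := ⟨z, hz⟩) e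
      exact Finset.ne_of_mem_erase hx (congrArg Subtype.val this)
    have h7 := (Submodule.add_mem_iff_left M h5).1 h4
    obtain ⟨u, hu⟩ := isUnit_negtpow (len B.wplus)
    rw [← hu] at h7
    have h8 := M.smul_mem (↑u⁻¹ : Laurent) h7
    rwa [smul_smul, Units.inv_mul, one_smul] at h8

theorem signSpace_le_span : signSpace lam mu ≤ Submodule.span Laurent
    (Set.range fun z : {z : W r // IsMin lam z mu} => C' (Triple.mk lam z.1 mu z.2).wplus) := by
  intro d hd
  obtain ⟨a, h1, -, h2⟩ := exists_eq_sum_TDtilde hd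
  rw [h2]
  exact sum_mem fun z hz => Submodule.smul_mem _ _ (TDtilde_mem_span z (h1 z hz))

/-! ### The involution `Ψ` -/

omit [NeZero r] in
theorem Psi_smul (c : Laurent) (h : Hecke r) : Psi r (c • h) = signA c • Psi r h :=
  heckeLift_smul _ _ _ _ _ _ _

/-- The ring homomorphism with `t ↦ -t` and `T_w ↦ T_w`. -/
def signH (r : ℕ) : Hecke r →+* Hecke r :=
  heckeLift signA T T_one T_mul (by
    intro s hs
    rw [signA_tpow, show negtpow 2 = q by simp [negtpow]]
    exact T_quad s hs)

omit [NeZero r] in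
theorem signH_T (w : W r) : signH r (T w) = T w := heckeLift_T _ _ _ _ _ _

omit [NeZero r] in
theorem signH_smul (c : Laurent) (h : Hecke r) : signH r (c • h) = signA c • signH r h :=
  heckeLift_smul _ _ _ _ _ _ _

omit [NeZero r] in
theorem signH_Tinv (w : W r) : signH r (Tinv w) = Tinv w := by
  refine (Tinv_eq ?_).symm
  rw [← signH_T, ← map_mul, mul_Tinv, map_one]

theorem signA_negqpow (k : ℤ) : signA (negqpow k) = negqpow k := by
  rw [negqpow, map_zsmul, signA_tpow, negtpow, Int.negOnePow_two_mul, Units.val_one, one_smul]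

theorem signA_eq_of_parity {a : Laurent} {m : ℤ} (h : ∀ k, a.coeff k ≠ 0 → (k - m) % 2 = 0) :
    signA a = (m.negOnePow : ℤ) • a := by
  conv_lhs => rw [laurent_eq_sum a]
  conv_rhs => rw [laurent_eq_sum a]
  rw [map_sum, Finset.smul_sum]
  refine Finset.sum_congr rfl fun k hk => ?_
  have hk' := h k (Finsupp.mem_support_iff.1 hk)
  rw [map_zsmul, signA_tpow, negtpow, (Int.negOnePow_eq_iff k m).2 (Int.even_iff.2 hk'),
    smul_comm]

theorem signA_signA (a : Laurent) : signA (signA a) = a := by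
  conv_lhs => rw [laurent_eq_sum a]
  conv_rhs => rw [laurent_eq_sum a]
  rw [map_sum, map_sum]
  refine Finset.sum_congr rfl fun k _ => ?_
  rw [map_zsmul, map_zsmul, signA_tpow, negtpow, map_zsmul, signA_tpow, negtpow,
    smul_smul ((k.negOnePow : ℤˣ) : ℤ) ((k.negOnePow : ℤˣ) : ℤ), ← Units.val_mul,
    Int.units_mul_self, Units.val_one, one_smul]

/-- On `T_w` the factors `(-q)^{-l(w)}` from `j` and `(-q)^{l(w)}` from `Ψ` cancel, and on scalars
`t ↦ t⁻¹` is followed by `t ↦ -t`. -/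
theorem Psi_jH (h : Hecke r) : Psi r (jH r h) = signH r (barH r h) := by
  induction h using hecke_induction with
  | h0 => simp
  | hadd x y hx hy => rw [map_add, map_add, map_add, map_add, hx, hy]
  | hT c w =>
    rw [jH_smul_T, barH_smul_T, signH_smul, signH_Tinv, Psi_smul, Psi_smul_T, signA_negqpow,
      smul_smul (negqpow _), mul_comm (negqpow _), negqpow_mul_neg, one_smul]

theorem coeffs_signH (h : Hecke r) (w : W r) : coeffs r (signH r h) w = signA (coeffs r h w) := by
  classical
  induction h using hecke_induction with
  | h0 => simp
  | hadd x y hx hy =>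
    rw [map_add, map_add, map_add, Finsupp.add_apply, Finsupp.add_apply, map_add, hx, hy]
  | hT c v =>
    rw [signH_smul, signH_T, map_smul, map_smul, coeffs_T, Finsupp.smul_apply, Finsupp.smul_apply,
      Finsupp.single_apply]
    split_ifs <;> simp

/-- All exponents of `t` in the coefficients of `C'_w` are congruent to `l(w)` modulo `2`. -/
theorem signH_C' (w : W r) : signH r (C' w) = ((len w : ℤ).negOnePow : ℤ) • C' w := by
  refine hecke_ext fun y => ?_
  have : coeffs r (((len w : ℤ).negOnePow : ℤ) • C' w) y =
      ((len w : ℤ).negOnePow : ℤ) • coeffs r (C' w) y := by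
    rw [map_zsmul]; rfl
  rw [coeffs_signH, this]
  refine signA_eq_of_parity fun k hk => ?_
  by_cases h : y = w
  · subst h
    rw [(isKLElement_C' y).lead, coeff_tpow] at hk
    obtain rfl : -(len y : ℤ) = k := by
      by_contra h
      exact hk (if_neg h)
    omega
  · exact ((isKLElement_C' w).low y h k hk).1

omit [NeZero r] in
theorem C_eq (w : W r) : C w = ((len w : ℤ).negOnePow : ℤ) • jH r (C' w) := by
  rw [C, zsmul_eq_mul]
  congr 1
  rw [Int.negOnePow_def]
  simp

theorem Psi_C (w : W r) : Psi r (C w) = C' w := by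
  rw [C_eq, map_zsmul, Psi_jH, (isKLElement_C' w).bar, signH_C', smul_smul, ← Units.val_mul,
    Int.units_mul_self, Units.val_one, one_smul]

theorem negtpow_add (a b : ℤ) : negtpow (a + b) = negtpow a * negtpow b := by
  rw [← signA_tpow, show tpow (a + b) = tpow a * tpow b from LaurentPolynomial.T_add a b, map_mul,
    signA_tpow, signA_tpow]

theorem negtpow_neg_mul (k : ℤ) : negtpow (-k) * negtpow k = 1 := by
  rw [← negtpow_add, neg_add_cancel]
  simp [negtpow]

theorem negtpow_mul_self (k : ℤ) : negtpow k * negtpow k = tpow (2 * k) := by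
  rw [← negtpow_add, ← two_mul, negtpow, Int.negOnePow_two_mul, Units.val_one, one_smul]

theorem C_wzero (lam : Comp n r) : C (wzero lam) = tpow (-len (wzero lam)) • xElt lam := by
  rw [C_eq, C'_wzero, jH_smul, yElt, jH_jH, negtpow, map_zsmul, barA_tpow, smul_assoc, smul_smul,
    ← Units.val_mul, Int.units_mul_self, Units.val_one, one_smul]

/-- Follows from `Psi_C` at `w_{0,λ}`, where `C` and `C'` are explicit multiples of `x_λ` and `y_λ`.
-/
theorem Psi_xElt (lam : Comp n r) : Psi r (xElt lam) = tpow (2 * len (wzero lam)) • yElt lam := by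
  have h : xElt lam = tpow (len (wzero lam)) • C (wzero lam) := by
    rw [C_wzero, smul_smul, ← LaurentPolynomial.T_add]
    simp
  rw [h, Psi_smul, Psi_C, signA_tpow, C'_wzero, smul_smul, negtpow_mul_self]

omit [NeZero r] in
theorem Psi_Tinv_inv (w : W r) : Psi r (Tinv w⁻¹) = negqpow (-len w) • T w := by
  have h1 : Psi r (T w⁻¹) * Psi r (Tinv w⁻¹) = 1 := by rw [← map_mul, mul_Tinv, map_one]
  have h2 : Psi r (T w⁻¹) = negqpow (len w) • Tinv w := by
    have := Psi_smul_T 1 w⁻¹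
    rwa [one_smul, map_one, one_smul, inv_inv, len_inv] at this
  have h3 : (negqpow (-len w) • T w) * Psi r (T w⁻¹) = 1 := by
    rw [h2, smul_mul_smul_comm, mul_comm (negqpow _), negqpow_mul_neg, mul_Tinv, one_smul]
  calc Psi r (Tinv w⁻¹) = (negqpow (-len w) • T w) * Psi r (T w⁻¹) * Psi r (Tinv w⁻¹) := by
        rw [h3, one_mul]
    _ = _ := by rw [mul_assoc, h1, mul_one]

theorem Psi_Psi (h : Hecke r) : Psi r (Psi r h) = h := by
  induction h using hecke_induction with
  | h0 => simp
  | hadd x y hx hy => rw [map_add, map_add, hx, hy]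
  | hT c w =>
    rw [Psi_smul_T, Psi_smul, Psi_smul, signA_signA, signA_negqpow, Psi_Tinv_inv,
      smul_smul (negqpow _), negqpow_mul_neg, one_smul]

end

section

variable {r n : ℕ}

/-! ### Endomorphisms of sums of right ideals -/

theorem mem_rightIdeal {v x : Hecke r} : x ∈ rightIdeal v ↔ ∃ h, x = v * h := by
  rw [Submodule.mem_span_singleton]
  constructor
  · rintro ⟨a, rfl⟩
    exact ⟨a.unop, rfl⟩
  · rintro ⟨h, rfl⟩
    exact ⟨MulOpposite.op h, rfl⟩

/-- Left multiplication, as an endomorphism of the right regular module. -/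
def leftMul (g : Hecke r) : Hecke r →ₗ[(Hecke r)ᵐᵒᵖ] Hecke r where
  toFun x := g * x
  map_add' := mul_add g
  map_smul' a x := (mul_assoc g x a.unop).symm

variable {v : Comp n r → Hecke r}

theorem genMul_val (nu : Comp n r) (h : Hecke r) : (genMul v nu h : Hecke r) = v nu * h := rfl

theorem exists_eq_genMul {nu : Comp n r} (x : rightIdeal (v nu)) : ∃ h, x = genMul v nu h := by
  obtain ⟨h, hh⟩ := mem_rightIdeal.1 x.2
  exact ⟨h, Subtype.ext hh⟩

theorem incl_apply (nu kappa : Comp n r) (x : rightIdeal (v nu)) :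
    ((incl v nu x) kappa : Hecke r) = if kappa = nu then (x : Hecke r) else 0 := by
  by_cases h : kappa = nu
  · subst h
    rw [if_pos rfl]
    exact congrArg Subtype.val (DirectSum.of_eq_same (β := fun lam => rightIdeal (v lam)) kappa x)
  · rw [if_neg h]
    exact congrArg Subtype.val
      (DirectSum.of_eq_of_ne (β := fun lam => rightIdeal (v lam)) nu kappa x h)

theorem idealSum_ext {m m' : IdealSum v} (h : ∀ kappa, (m kappa : Hecke r) = m' kappa) :
    m = m' :=
  DFinsupp.ext fun kappa => Subtype.ext (h kappa)

/-- The component in `v_κ H` of the image of the generator `v_ν`. -/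
def entry (kappa nu : Comp n r) : EndAlg v →ₗ[Laurent] Hecke r where
  toFun f := (f (incl v nu (genMul v nu 1)) kappa : Hecke r)
  map_add' _ _ := rfl
  map_smul' _ _ := rfl

theorem apply_genMul (f : EndAlg v) (kappa nu : Comp n r) (h : Hecke r) :
    (f (incl v nu (genMul v nu h)) kappa : Hecke r) = entry kappa nu f * h := by
  have h1 : genMul v nu h = MulOpposite.op h • genMul v nu 1 := Subtype.ext (by
    rw [genMul_val, Submodule.coe_smul, genMul_val, mul_one]; rfl)
  rw [h1, map_smul, map_smul]
  rfl

theorem entry_ext {f g : EndAlg v} (h : ∀ kappa nu, entry kappa nu f = entry kappa nu g) :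
    f = g := by
  refine DirectSum.linearMap_ext _ fun nu => LinearMap.ext fun x => ?_
  obtain ⟨a, rfl⟩ := exists_eq_genMul x
  refine idealSum_ext fun kappa => ?_
  change (f (incl v nu _) kappa : Hecke r) = g (incl v nu _) kappa
  rw [apply_genMul, apply_genMul, h]

/-- The two factorizations make the map exist: with `d = v_λ g1 = g2 v_μ`, left multiplication by
`g2` sends `v_μ h` to `d h = v_λ (g1 h)`. Hence `stdMap` does not take its default value `0`. -/
theorem stdMap_apply {lam mu : Comp n r} {d : Hecke r} (h1 : ∃ g, d = v lam * g)
    (h2 : ∃ g, d = g * v mu) (nu : Comp n r) (h : Hecke r) (kappa : Comp n r) :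
    (stdMap v lam mu d (incl v nu (genMul v nu h)) kappa : Hecke r) =
      if nu = mu ∧ kappa = lam then d * h else 0 := by
  obtain ⟨g1, hg1⟩ := h1
  obtain ⟨g2, hg2⟩ := h2
  have hmaps : ∀ x ∈ rightIdeal (v mu), leftMul g2 x ∈ rightIdeal (v lam) := by
    intro x hx
    obtain ⟨h, rfl⟩ := mem_rightIdeal.1 hx
    refine mem_rightIdeal.2 ⟨g1 * h, ?_⟩
    rw [← mul_assoc, ← hg1, hg2, mul_assoc]
    rfl
  let f : EndAlg v := (incl v lam).comp (((leftMul g2).restrict hmaps).comp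
    (DirectSum.component (Hecke r)ᵐᵒᵖ (Comp n r) (fun lam => rightIdeal (v lam)) mu))
  refine theElement_spec (p := fun f : EndAlg v => ∀ (nu : Comp n r) (h : Hecke r)
    (kappa : Comp n r), (f (incl v nu (genMul v nu h)) kappa : Hecke r) =
      if nu = mu ∧ kappa = lam then d * h else 0) ⟨f, fun nu h kappa => ?_⟩ nu h kappa
  have e : (f (incl v nu (genMul v nu h)) kappa : Hecke r) =
      if kappa = lam then g2 * ((incl v nu (genMul v nu h)) mu : Hecke r) else 0 :=
    incl_apply lam kappa _
  rw [e, incl_apply, genMul_val, hg2]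
  by_cases h3 : nu = mu
  · subst h3
    simp [mul_assoc]
  · simp [h3, Ne.symm h3]

theorem entry_stdMap {lam mu : Comp n r} {d : Hecke r} (h1 : ∃ g, d = v lam * g)
    (h2 : ∃ g, d = g * v mu) (kappa nu : Comp n r) :
    entry kappa nu (stdMap v lam mu d) = if nu = mu ∧ kappa = lam then d else 0 := by
  have := stdMap_apply h1 h2 nu 1 kappa
  rwa [mul_one] at this

section NeZero

variable [NeZero r]

theorem entry_mem_signSpace (f : SchurTilde n r) (kappa nu : Comp n r) :
    entry kappa nu f ∈ signSpace kappa nu := by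
  constructor
  · intro s hs
    obtain ⟨h, hh⟩ := mem_rightIdeal.1 (f (incl yElt nu (genMul yElt nu 1)) kappa).2
    change T s * (f (incl yElt nu (genMul yElt nu 1)) kappa : Hecke r) = -_
    rw [show entry kappa nu f = yElt kappa * h from hh, hh, ← mul_assoc,
      yElt_mem_signSpace.1 s hs, neg_mul]
  · intro s hs
    rw [← apply_genMul]
    have h1 : genMul yElt nu (T s) = -genMul yElt nu 1 := Subtype.ext (by
      rw [Submodule.coe_neg, genMul_val, genMul_val, mul_one]
      exact yElt_mem_signSpace.2 s hs)
    rw [h1, map_neg, map_neg]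
    rfl

theorem entry_psi (lam : Comp n r) (w : W r) (mu kappa nu : Comp n r) :
    entry kappa nu (psi lam w mu) = if nu = mu ∧ kappa = lam then TDtilde lam w mu else 0 :=
  entry_stdMap (exists_eq_yElt_mul (TDtilde_mem_signSpace w).1)
    (exists_eq_mul_yElt (TDtilde_mem_signSpace w).2) kappa nu

/-- The factorizations of `T_D` through `x_λ` and `x_μ` are the images under `j` of those of `T̃_D`.
-/
theorem entry_phi (lam : Comp n r) (w : W r) (mu kappa nu : Comp n r) :
    entry kappa nu (phi lam w mu) = if nu = mu ∧ kappa = lam then TD lam w mu else 0 := by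
  have h : TD lam w mu = jH r (TDtilde lam w mu) := by rw [← jH_TD, jH_jH]
  have hx : ∀ lam : Comp n r, jH r (yElt lam) = xElt lam := fun lam => jH_jH _
  refine entry_stdMap ?_ ?_ kappa nu
  · obtain ⟨g, hg⟩ := exists_eq_yElt_mul (TDtilde_mem_signSpace (lam := lam) (mu := mu) w).1
    exact ⟨jH r g, by rw [h, hg, map_mul, hx]⟩
  · obtain ⟨g, hg⟩ := exists_eq_mul_yElt (TDtilde_mem_signSpace (lam := lam) (mu := mu) w).2
    exact ⟨jH r g, by rw [h, hg, map_mul, hx]⟩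

theorem entry_thetaTilde (B : Triple n r) (kappa nu : Comp n r) :
    entry kappa nu (thetaTilde B) = if nu = B.mu ∧ kappa = B.lam then
      negtpow (-(len (wzero B.mu) : ℤ)) • C' B.wplus else 0 := by
  rw [thetaTilde, map_smul, Finsupp.sum, map_sum, (alphaTilde_spec B).2, Finsupp.sum]
  simp only [map_smul, entry_psi]
  split_ifs <;> simp

theorem entry_theta (B : Triple n r) (kappa nu : Comp n r) :
    entry kappa nu (theta B) = if nu = B.mu ∧ kappa = B.lam then
      tpow (len (wzero B.mu)) • C B.wplus else 0 := by
  rw [theta, map_smul, Finsupp.sum, map_sum, (alpha_spec B).2, Finsupp.sum]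
  simp only [map_smul, entry_phi]
  split_ifs <;> simp

/-! ### The basis of the second Schur algebra -/

theorem linearIndepOn_C'_wplus (lam mu : Comp n r) :
    LinearIndepOn Laurent (fun B : Triple n r => C' B.wplus) {B | B.lam = lam ∧ B.mu = mu} := by
  refine linearIndependent_C'.comp
    (fun B : {B : Triple n r | B.lam = lam ∧ B.mu = mu} => B.1.wplus) ?_
  rintro ⟨⟨lam, w, mu, h⟩, rfl, rfl⟩ ⟨⟨lam', w', mu', h'⟩, h1, h2⟩ e
  obtain rfl : lam' = lam := h1
  obtain rfl : mu' = mu := h2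
  have h3 := wplus_injective (lam := lam') (mu := mu') (a₁ := ⟨w, h⟩) (a₂ := ⟨w', h'⟩) e
  obtain rfl : w = w' := congrArg Subtype.val h3
  rfl

/-- The entry at `(λ, μ)` sees only the triples with these compositions. There the scalar
`(-t)^{-l(w_{0,μ})}` is one and the same unit, and the `C'_{w⁺}` are independent. -/
theorem linearIndependent_thetaTilde :
    LinearIndependent Laurent (thetaTilde : Triple n r → SchurTilde n r) := by
  classical
  refine (injective_iff_map_eq_zero (Finsupp.linearCombination Laurent thetaTilde)).2
    fun c hc => Finsupp.ext fun B => ?_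
  rw [Finsupp.linearCombination_apply, Finsupp.sum] at hc
  by_contra hB
  replace hB := Finsupp.mem_support_iff.2 hB
  have h1 := congrArg (entry B.lam B.mu) hc
  rw [map_sum, map_zero] at h1
  simp only [map_smul, entry_thetaTilde] at h1
  have h2 := linearIndepOn_iff'.1 (linearIndepOn_C'_wplus B.lam B.mu)
    (c.support.filter fun B' => B'.lam = B.lam ∧ B'.mu = B.mu)
    (fun B' => c B' * negtpow (-(len (wzero B.mu) : ℤ)))
    (fun B' hB' => (Finset.mem_filter.1 hB').2) (by
      rw [Finset.sum_filter]
      refine Eq.trans ?_ h1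
      refine Finset.sum_congr rfl fun B' _ => ?_
      by_cases h : B'.lam = B.lam ∧ B'.mu = B.mu
      · rw [if_pos h, if_pos ⟨h.2.symm, h.1.symm⟩, smul_smul, h.2]
      · rw [if_neg h, if_neg fun h' => h ⟨h'.2.symm, h'.1.symm⟩, smul_zero])
    B (Finset.mem_filter.2 ⟨hB, rfl, rfl⟩)
  exact Finsupp.mem_support_iff.1 hB ((isUnit_negtpow _).mul_left_eq_zero.1 h2)

instance : Finite (Comp n r) := by
  have h : ∀ (lam : Comp n r) i, lam.1 i < r + 1 := fun lam i => by
    have := Finset.single_le_sum (f := lam.1) (fun _ _ => Nat.zero_le _) (Finset.mem_univ i)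
    rw [lam.2] at this
    omega
  refine Finite.of_injective (fun (lam : Comp n r) i => (⟨lam.1 i, h lam i⟩ : Fin (r + 1))) ?_
  intro lam mu e
  exact Subtype.ext (funext fun i => congrArg Fin.val (congrFun e i))

theorem exists_mem_span_thetaTilde {lam mu : Comp n r} {d : Hecke r} (hd : d ∈ signSpace lam mu) :
    ∃ f ∈ Submodule.span Laurent (Set.range (thetaTilde : Triple n r → SchurTilde n r)),
      ∀ kappa nu, entry kappa nu f = if nu = mu ∧ kappa = lam then d else 0 := by
  replace hd := signSpace_le_span hd
  induction hd using Submodule.span_induction with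
  | mem x hx =>
    obtain ⟨z, rfl⟩ := hx
    refine ⟨negtpow (len (wzero mu)) • thetaTilde ⟨lam, z.1, mu, z.2⟩,
      Submodule.smul_mem _ _ (Submodule.subset_span ⟨_, rfl⟩), fun kappa nu => ?_⟩
    rw [map_smul, entry_thetaTilde, smul_ite, smul_zero, smul_smul, mul_comm, negtpow_neg_mul,
      one_smul]
  | zero => exact ⟨0, zero_mem _, fun kappa nu => by simp⟩
  | add x y _ _ hx hy =>
    obtain ⟨f, hf, ef⟩ := hx
    obtain ⟨g, hg, eg⟩ := hy
    refine ⟨f + g, add_mem hf hg, fun kappa nu => ?_⟩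
    rw [map_add, ef, eg]
    split_ifs <;> simp
  | smul c x _ hx =>
    obtain ⟨f, hf, ef⟩ := hx
    refine ⟨c • f, Submodule.smul_mem _ _ hf, fun kappa nu => ?_⟩
    rw [map_smul, ef, smul_ite, smul_zero]

/-- An endomorphism is the sum of its single-entry matrices, a finite sum because there are finitely
many compositions. -/
theorem span_range_thetaTilde :
    Submodule.span Laurent (Set.range (thetaTilde : Triple n r → SchurTilde n r)) = ⊤ := by
  classical
  have := Fintype.ofFinite (Comp n r)
  rw [eq_top_iff]
  rintro f -
  choose g hg eg using fun p : Comp n r × Comp n r =>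
    exists_mem_span_thetaTilde (entry_mem_signSpace f p.1 p.2)
  have h : f = ∑ p, g p := by
    refine entry_ext fun kappa nu => ?_
    rw [map_sum, Finset.sum_eq_single (kappa, nu)]
    · rw [eg, if_pos ⟨rfl, rfl⟩]
    · rintro ⟨kappa', nu'⟩ - hne
      rw [eg, if_neg]
      rintro ⟨rfl, rfl⟩
      exact hne rfl
    · exact fun h => absurd (Finset.mem_univ _) h
  rw [h]
  exact sum_mem fun p _ => hg p

theorem exists_basis_thetaTilde : ∃ b : Module.Basis (Triple n r) Laurent (SchurTilde n r),
    ∀ B, b B = thetaTilde B :=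
  ⟨Module.Basis.mk linearIndependent_thetaTilde span_range_thetaTilde.ge,
    fun _ => Module.Basis.mk_apply _ _ _⟩

/-! ### The values of the basis elements at Kazhdan–Lusztig elements -/

omit [NeZero r] in
theorem smul_eq_mul_algebraMap (c : Laurent) (h : Hecke r) :
    c • h = h * algebraMap Laurent (Hecke r) c := by
  rw [Algebra.smul_def, Algebra.commutes]

theorem exists_thetaTilde_apply (B : Triple n r) :
    ∃ (hmu : C' (wzero B.mu) ∈ rightIdeal (yElt B.mu))
      (hlam : C' B.wplus ∈ rightIdeal (yElt B.lam)),
      thetaTilde B (incl yElt B.mu ⟨C' (wzero B.mu), hmu⟩) =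
        incl yElt B.lam ⟨C' B.wplus, hlam⟩ := by
  have hmu : C' (wzero B.mu) = yElt B.mu *
      algebraMap Laurent (Hecke r) (negtpow (len (wzero B.mu))) := by
    rw [C'_wzero, smul_eq_mul_algebraMap]
  refine ⟨mem_rightIdeal.2 ⟨_, hmu⟩, mem_rightIdeal.2
    (exists_eq_yElt_mul (C'_wplus_mem_signSpace B).1), idealSum_ext fun kappa => ?_⟩
  have h1 : (⟨C' (wzero B.mu), mem_rightIdeal.2 ⟨_, hmu⟩⟩ : rightIdeal (yElt B.mu)) =
      genMul yElt B.mu (algebraMap Laurent (Hecke r) (negtpow (len (wzero B.mu)))) :=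
    Subtype.ext hmu
  rw [h1, apply_genMul, incl_apply, entry_thetaTilde, ← smul_eq_mul_algebraMap]
  by_cases h : kappa = B.lam
  · rw [if_pos ⟨rfl, h⟩, if_pos h, smul_smul, mul_comm, negtpow_neg_mul, one_smul]
  · rw [if_neg fun h' => h h'.2, if_neg h, smul_zero]

/-! ### The isomorphism of Schur algebras induced by `Ψ` -/

theorem Psi_mem_rightIdeal {lam : Comp n r} {x : Hecke r} (hx : x ∈ rightIdeal (xElt lam)) :
    Psi r x ∈ rightIdeal (yElt lam) := by
  obtain ⟨h, rfl⟩ := mem_rightIdeal.1 hx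
  refine mem_rightIdeal.2 ⟨tpow (2 * len (wzero lam)) • Psi r h, ?_⟩
  rw [map_mul, Psi_xElt, smul_mul_assoc, mul_smul_comm]

/-- Inverts `Psi_xElt`; the scalar is an even power of `t`, so `t ↦ -t` fixes it. -/
theorem yElt_eq (lam : Comp n r) :
    yElt lam = Psi r (xElt lam * algebraMap Laurent (Hecke r) (tpow (-(2 * len (wzero lam))))) := by
  rw [← smul_eq_mul_algebraMap, Psi_smul, Psi_xElt, smul_smul, signA_tpow, ← mul_neg, negtpow,
    Int.negOnePow_two_mul, Units.val_one, one_smul, ← LaurentPolynomial.T_add]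
  simp

theorem Psi_mem_rightIdeal' {lam : Comp n r} {y : Hecke r} (hy : y ∈ rightIdeal (yElt lam)) :
    Psi r y ∈ rightIdeal (xElt lam) := by
  obtain ⟨h, rfl⟩ := mem_rightIdeal.1 hy
  rw [map_mul, yElt_eq, Psi_Psi, mul_assoc]
  exact mem_rightIdeal.2 ⟨_, rfl⟩

/-- The bijection `x_λ H → y_λ H` given by `Ψ`. -/
def psiIdeal (lam : Comp n r) : rightIdeal (xElt lam) ≃+ rightIdeal (yElt lam) where
  toFun x := ⟨Psi r x, Psi_mem_rightIdeal x.2⟩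
  invFun y := ⟨Psi r y, Psi_mem_rightIdeal' y.2⟩
  left_inv _ := Subtype.ext (Psi_Psi _)
  right_inv _ := Subtype.ext (Psi_Psi _)
  map_add' _ _ := Subtype.ext (map_add (Psi r) _ _)

/-- The bijection `⨁_λ x_λ H → ⨁_λ y_λ H` given by `Ψ`. -/
def psiSum (n r : ℕ) [NeZero r] :
    IdealSum (xElt : Comp n r → Hecke r) ≃+ IdealSum (yElt : Comp n r → Hecke r) :=
  DFinsupp.mapRange.addEquiv psiIdeal

theorem psiSum_apply (m : IdealSum (xElt : Comp n r → Hecke r)) (lam : Comp n r) :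
    (psiSum n r m lam : Hecke r) = Psi r (m lam) := rfl

/-- The bijection is only semilinear over `Ψ`. Since `Ψ` is an involution, the twist cancels in `E ∘
f ∘ E⁻¹`, which is therefore `H`-linear. -/
theorem psiSum_smul (h : Hecke r) (m : IdealSum (xElt : Comp n r → Hecke r)) :
    psiSum n r (MulOpposite.op h • m) = MulOpposite.op (Psi r h) • psiSum n r m :=
  idealSum_ext fun kappa => map_mul (Psi r) (m kappa : Hecke r) h

theorem psiSum_symm_smul (h : Hecke r) (m : IdealSum (yElt : Comp n r → Hecke r)) :
    (psiSum n r).symm (MulOpposite.op h • m) =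
      MulOpposite.op (Psi r h) • (psiSum n r).symm m := by
  rw [AddEquiv.symm_apply_eq, psiSum_smul, Psi_Psi, AddEquiv.apply_symm_apply]

/-- The ring isomorphism of Schur algebras induced by `Ψ`. -/
def psiSchur (n r : ℕ) [NeZero r] : Schur n r ≃+* SchurTilde n r where
  toFun f :=
    { toFun := fun m => psiSum n r (f ((psiSum n r).symm m))
      map_add' := fun a b => by rw [map_add, map_add, map_add]
      map_smul' := fun a m => by
        rw [← MulOpposite.op_unop a, psiSum_symm_smul, map_smul, psiSum_smul, Psi_Psi]
        rfl }
  invFun g :=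
    { toFun := fun m => (psiSum n r).symm (g (psiSum n r m))
      map_add' := fun a b => by rw [map_add, map_add, map_add]
      map_smul' := fun a m => by
        rw [← MulOpposite.op_unop a, psiSum_smul, map_smul, psiSum_symm_smul, Psi_Psi]
        rfl }
  left_inv f := LinearMap.ext fun m => by simp
  right_inv g := LinearMap.ext fun m => by simp
  map_mul' f g := LinearMap.ext fun m => by simp
  map_add' f g := LinearMap.ext fun m => by simp

theorem psiSchur_apply (f : Schur n r) (m : IdealSum (xElt : Comp n r → Hecke r)) :
    psiSchur n r f (psiSum n r m) = psiSum n r (f m) := by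
  change psiSum n r (f ((psiSum n r).symm (psiSum n r m))) = _
  rw [AddEquiv.symm_apply_apply]

theorem psiSchur_theta (B : Triple n r) : psiSchur n r (theta B) = thetaTilde B := by
  refine entry_ext fun kappa nu => ?_
  -- The generator `y_ν` is the image of `x_ν q^{-l(w_{0,ν})}`. This factor turns the
  -- `t^{l(w_{0,μ})}` in `theta` into the `(-t)^{-l(w_{0,μ})}` of `thetaTilde`.
  have h1 : incl yElt nu (genMul yElt nu 1) = psiSum n r (incl xElt nu (genMul xElt nu
      (algebraMap Laurent (Hecke r) (tpow (-(2 * len (wzero nu))))))) := by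
    refine idealSum_ext fun lam => ?_
    rw [psiSum_apply, incl_apply, incl_apply, genMul_val, genMul_val, apply_ite (Psi r), map_zero,
      ← yElt_eq, mul_one]
  change ((psiSchur n r (theta B)) (incl yElt nu (genMul yElt nu 1)) kappa : Hecke r) = _
  rw [h1, psiSchur_apply, psiSum_apply, apply_genMul, entry_theta, entry_thetaTilde]
  split_ifs with h
  · obtain ⟨rfl, rfl⟩ := h
    rw [← smul_eq_mul_algebraMap, Psi_smul, Psi_smul, Psi_C, smul_smul, signA_tpow, signA_tpow,
      ← negtpow_add]
    congr 2
    ring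
  · rw [zero_mul, map_zero]

end NeZero

end

end AffineSchur

end

theorem theorem3p2 (n r : ℕ) (hn : 0 < n) (hr : 0 < r) :
    (∃ b : Module.Basis (AffineSchur.Triple n r) AffineSchur.Laurent (AffineSchur.SchurTilde n r),
      ∀ B, b B = AffineSchur.thetaTilde B) ∧
    (∀ B : AffineSchur.Triple n r,
      ∃ (hmu : AffineSchur.C' (AffineSchur.wzero B.mu) ∈
          AffineSchur.rightIdeal (AffineSchur.yElt B.mu))
        (hlam : AffineSchur.C' B.wplus ∈ AffineSchur.rightIdeal (AffineSchur.yElt B.lam)),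
        AffineSchur.thetaTilde B
            (AffineSchur.incl AffineSchur.yElt B.mu ⟨AffineSchur.C' (AffineSchur.wzero B.mu), hmu⟩) =
          AffineSchur.incl AffineSchur.yElt B.lam ⟨AffineSchur.C' B.wplus, hlam⟩) ∧
    (∃ F : AffineSchur.Schur n r ≃+* AffineSchur.SchurTilde n r,
      AffineSchur.IsInducedByPsi F ∧ ∀ B, F (AffineSchur.theta B) = AffineSchur.thetaTilde B) := by
  have : NeZero r := ⟨hr.ne'⟩
  exact ⟨AffineSchur.exists_basis_thetaTilde, AffineSchur.exists_thetaTilde_apply,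
    AffineSchur.psiSchur n r, ⟨AffineSchur.psiSum n r, AffineSchur.psiSum_apply,
      AffineSchur.psiSchur_apply⟩, AffineSchur.psiSchur_theta⟩
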